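/- Let $0<q<1$ and let $\mathcal A=\mathcal O(SU_q(2))$ be the complex unital Hopf $*$-algebra with generators $a,b,c,d$, relations $$ab=qba,\quad ac=qca,\quad bd=qdb,\quad cd=qdc,\quad bc=cb,\quad ad=1+qbc,\quad da=1+q^{-1}bc,$$ involution $a^*=d$, $b^*=-qc$, $c^*=-q^{-1}b$, $d^*=a$, and coproduct $\Delta(a)=a\otimes a+b\otimes c$, $\Delta(b)=a\otimes b+b\otimes d$, $\Delta(c)=c\otimes a+d\otimes c$, $\Delta(d)=c\otimes b+d\otimes d$. Write $[x]_q=\frac{q^{-x}-q^{x}}{q^{-1}-q}$. Let $h$ be the Haar state ($h(a^ib^mc^r)=h(b^mc^rd^i)=\delta_{i,0}\,\delta_{m,r}\,(-1)^r[r+1]_q^{-1}$), let $\mathcal H_h$ be the completion of $\mathcal A$ for the inner product $\langle x,y\rangle=h(x^*y)$, and let $\mathcal H=\mathcal H_h\oplus\mathcal H_h$, on which $\mathcal A$ acts diagonally by left multiplication. Put $\Gamma=\mathrm{diag}(1,-1)$. For $l\in\frac12\mathbb N_0$ let $I_l=\{-l,-l+1,\dots,l\}$ and let $t^l_{i,j}\in\mathcal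 A$ $(i,j\in I_l)$ be the matrix coefficients, $\Delta(v^l_j)=\sum_i v^l_i\otimes t^l_{i,j}$, of the $(2l+1)$-dimensional irreducible corepresentation in its orthonormal weight basis $$v^l_j=q^{-\frac12(l-j)(l+j)}\Big(\tfrac{[2l]_q!}{[l-j]_q!\,[l+j]_q!}\Big)^{1/2}a^{l-j}b^{l+j}\qquad(j\in I_l),$$ so that $t^{1/2}=\begin{pmatrix}a&b\\c&d\end{pmatrix}$; the $t^l_{i,j}$ form the Peter–Weyl basis of $\mathcal A$. Let $k,k^{-1},e,f$ be the generators of $U_q(\mathfrak{sl}(2))$, with $\Delta(k)=k\otimes k$, $\Delta(e)=e\otimes k+k^{-1}\otimes e$, $\Delta(f)=f\otimes k+k^{-1}\otimes f$, paired with $\mathcal A$ by $\langle k,a\rangle=q^{-1/2}$, $\langle k,d\rangle=q^{1/2}$, $\langle e,c\rangle=\langle f,b\rangle=1$ and zero on the other generators, and put $\partial_g(x)=\sum x_{(1)}\langle g,x_{(2)}\rangle$ for $g=e,f$. On $\mathcal A$ define, for $n\in\mathbb Z$ and $s\in\mathbb R$, $$\Phi_n(t^l_{i,j})=\delta_{n,2j}\,t^l_{i,j},\quad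 \partial_H(t^l_{i,j})=j\,t^l_{i,j},\quad \Delta_L^s(t^l_{i,j})=q^{2sj}t^l_{i,j},\quad \sigma_L^{s}(t^l_{i,j})=q^{-2sj}t^l_{i,j};$$ equivalently, $\Phi_n$ is the projection onto the degree $n$ part for the grading in which $a,c$ have degree $-1$ and $b,d$ have degree $1$, and $\partial_H=\sum_n\frac n2\Phi_n$, $\Delta_L^s=\sum_n q^{sn}\Phi_n$, $\sigma_L^s=\sum_n q^{-sn}\Phi_n$. On the domain $\mathcal A\oplus\mathcal A\subset\mathcal H$ put $\Psi_n=\mathrm{diag}(\Phi_{n+1},\Phi_{n-1})$, $\hat\Delta_L=\mathrm{diag}(q^{-1}\Delta_L,\,q\Delta_L)$, $\hat\Delta_L^{1/2}=\mathrm{diag}(q^{-1/2}\Delta_L^{1/2},\,q^{1/2}\Delta_L^{1/2})$ and $$\mathcal D=\frac12\sum_{n\in\mathbb Z}\Psi_n\begin{pmatrix}n&0\\0&-n\end{pmatrix}+\hat\Delta_L^{1/2}\begin{pmatrix}0&\partial_e\\ \partial_f&0\end{pmatrix}.$$ Then the following hold. 1. $\mathcal D$, with domain $\mathcal A\oplus\mathcal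 A$, is essentially self-adjoint on $\mathcal H$. 2. With $$\lambda_{l,n}=\sqrt{\left(\tfrac n2\right)^2+q^n\left([l+\tfrac12]_q^2-[\tfrac n2]_q^2\right)},\qquad C^l_{j,\pm}=\frac{\pm\lambda_{l,2j-1}-(j-\frac12)}{q^{j-\frac12}\sqrt{[l+\frac12]_q^2-[j-\frac12]_q^2}},$$ the family of vectors $$\begin{pmatrix}0\\t^l_{i,l}\end{pmatrix},\quad\begin{pmatrix}t^l_{i,-l}\\0\end{pmatrix},\quad\begin{pmatrix}t^l_{i,j}\\C^l_{j,\pm}\,t^l_{i,j-1}\end{pmatrix}\qquad\left(l\in\tfrac12\mathbb N_0,\ i\in I_l,\ j\in I_l\setminus\{-l\}\right)$$ is an orthogonal basis of $\mathcal H$ (non-zero, pairwise orthogonal, with dense span), consisting of eigenvectors of $\mathcal D$ with eigenvalues $-(l+\frac12)$, $-(l+\frac12)$ and $\pm\lambda_{l,2j-1}$, respectively. 3. For every $\alpha\in\mathcal A$ the commutator $[\mathcal D,\alpha]$ has domain $\mathcal A\oplus\mathcal A$, and on it $$[\mathcal D,\alpha]=\tilde S(\alpha)+\tilde T(\alpha)\hat\Delta_L,$$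 where $\tilde S,\tilde T\colon\mathcal A\to B(\mathcal H)$ are the linear maps $$\tilde S(\alpha)=\partial_H(\alpha)\,\Gamma,\qquad \tilde T(\alpha)=\begin{pmatrix}0&q^{-\frac12}\,\partial_e(\sigma_L^{-\frac12}(\alpha))\\ q^{\frac12}\,\partial_f(\sigma_L^{-\frac12}(\alpha))&0\end{pmatrix}.$$ 4. These commutators are not bounded in general: there is $\alpha\in\mathcal A$ for which $[\mathcal D,\alpha]$ is unbounded. -/

import Mathlib

noncomputable section

namespace QSU2

/-- The deformation parameter `q`, a real number with `0 < q < 1`. -/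
abbrev Param : Type := Set.Ioo (0 : ℝ) 1

/-- The parameter as a complex scalar. -/
def qc (q : Param) : ℂ := ((q : ℝ) : ℂ)

theorem q_pos (q : Param) : 0 < (q : ℝ) := q.2.1
theorem q_lt (q : Param) : (q : ℝ) < 1 := q.2.2
theorem qc_ne (q : Param) : qc q ≠ 0 := by
  simpa [qc] using (q_pos q).ne'
theorem qc_conj (q : Param) : (starRingEnd ℂ) (qc q) = qc q := by simp [qc]

/-! ### The algebra of polynomial functions on `SU_q(2)` -/

/-- Names of the four generators. -/
inductive Gen : Type
  | a | b | c | d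

/-- The defining relations, imposed on four elements of a complex algebra. -/
structure Rels (s : ℂ) {B : Type*} [Ring B] [Algebra ℂ B] (a b c d : B) : Prop where
  ab : a * b = s • (b * a)
  ac : a * c = s • (c * a)
  bd : b * d = s • (d * b)
  cd : c * d = s • (d * c)
  bc : b * c = c * b
  ad : a * d = 1 + s • (b * c)
  da : d * a = 1 + s⁻¹ • (b * c)

open FreeAlgebra in
/-- The defining relations in the free algebra on `a, b, c, d`. -/
inductive Rel (s : ℂ) : FreeAlgebra ℂ Gen → FreeAlgebra ℂ Gen → Prop
  | ab : Rel s (ι ℂ Gen.a * ι ℂ Gen.b) (s • (ι ℂ Gen.b * ι ℂ Gen.a))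
  | ac : Rel s (ι ℂ Gen.a * ι ℂ Gen.c) (s • (ι ℂ Gen.c * ι ℂ Gen.a))
  | bd : Rel s (ι ℂ Gen.b * ι ℂ Gen.d) (s • (ι ℂ Gen.d * ι ℂ Gen.b))
  | cd : Rel s (ι ℂ Gen.c * ι ℂ Gen.d) (s • (ι ℂ Gen.d * ι ℂ Gen.c))
  | bc : Rel s (ι ℂ Gen.b * ι ℂ Gen.c) (ι ℂ Gen.c * ι ℂ Gen.b)
  | ad : Rel s (ι ℂ Gen.a * ι ℂ Gen.d) (1 + s • (ι ℂ Gen.b * ι ℂ Gen.c))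
  | da : Rel s (ι ℂ Gen.d * ι ℂ Gen.a) (1 + s⁻¹ • (ι ℂ Gen.b * ι ℂ Gen.c))

/-- The algebra `O(SU_q(2))`: generators `a, b, c, d` and the relations above. -/
def A (q : Param) : Type := RingQuot (Rel (qc q))

instance (q : Param) : Ring (A q) := inferInstanceAs (Ring (RingQuot (Rel (qc q))))
instance (q : Param) : Algebra ℂ (A q) := inferInstanceAs (Algebra ℂ (RingQuot (Rel (qc q))))

/-- The quotient map from the free algebra. -/
def mk (q : Param) : FreeAlgebra ℂ Gen →ₐ[ℂ] A q := RingQuot.mkAlgHom ℂ (Rel (qc q))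

theorem mk_rel (q : Param) {x y : FreeAlgebra ℂ Gen} (h : Rel (qc q) x y) : mk q x = mk q y :=
  RingQuot.mkAlgHom_rel ℂ h

/-- The generators of `O(SU_q(2))`. -/
def gen (q : Param) (g : Gen) : A q := mk q (FreeAlgebra.ι ℂ g)

theorem gen_rels (q : Param) :
    Rels (qc q) (gen q Gen.a) (gen q Gen.b) (gen q Gen.c) (gen q Gen.d) := by
  constructor
  · simpa only [gen, map_mul, map_smul] using mk_rel q Rel.ab
  · simpa only [gen, map_mul, map_smul] using mk_rel q Rel.ac
  · simpa only [gen, map_mul, map_smul] using mk_rel q Rel.bd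
  · simpa only [gen, map_mul, map_smul] using mk_rel q Rel.cd
  · simpa only [gen, map_mul, map_smul] using mk_rel q Rel.bc
  · simpa only [gen, map_mul, map_smul, map_add, map_one] using mk_rel q Rel.ad
  · simpa only [gen, map_mul, map_smul, map_add, map_one] using mk_rel q Rel.da

/-- Four elements indexed by the names of the generators. -/
def genFun {B : Type*} (a b c d : B) : Gen → B
  | Gen.a => a
  | Gen.b => b
  | Gen.c => c
  | Gen.d => d

/-- Elements satisfying the relations define an algebra homomorphism on `O(SU_q(2))`. -/
def lift (q : Param) {B : Type*} [Ring B] [Algebra ℂ B] {a b c d : B}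
    (h : Rels (qc q) a b c d) : A q →ₐ[ℂ] B :=
  RingQuot.liftAlgHom ℂ ⟨FreeAlgebra.lift ℂ (genFun a b c d), by
    intro x y hxy
    cases hxy
    · simpa [genFun] using h.ab
    · simpa [genFun] using h.ac
    · simpa [genFun] using h.bd
    · simpa [genFun] using h.cd
    · simpa [genFun] using h.bc
    · simpa [genFun] using h.ad
    · simpa [genFun] using h.da⟩

theorem lift_gen (q : Param) {B : Type*} [Ring B] [Algebra ℂ B] {a b c d : B}
    (h : Rels (qc q) a b c d) (g : Gen) : lift q h (gen q g) = genFun a b c d g := by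
  simp only [lift, gen, mk]
  erw [RingQuot.liftAlgHom_mkAlgHom_apply]
  simp

/-- To prove a property of all elements, check scalars, generators, sums and products. -/
theorem A_induction (q : Param) {P : A q → Prop} (hs : ∀ z : ℂ, P (algebraMap ℂ (A q) z))
    (hg : ∀ g, P (gen q g)) (hadd : ∀ x y, P x → P y → P (x + y))
    (hmul : ∀ x y, P x → P y → P (x * y)) (x : A q) : P x := by
  obtain ⟨y, rfl⟩ := RingQuot.mkAlgHom_surjective ℂ (Rel (qc q)) x
  induction y using FreeAlgebra.induction with
  | grade0 r => rw [AlgHom.commutes]; exact hs r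
  | grade1 g => exact hg g
  | mul u v hu hv => rw [map_mul]; exact hmul _ _ hu hv
  | add u v hu hv => rw [map_add]; exact hadd _ _ hu hv

/-! ### Coordinates in the polynomial basis -/

/-- Vector space with basis indexed by the polynomial basis of `O(SU_q(2))`: the index `(n, m, r)`
stands for `a ^ n * b ^ m * c ^ r` if `0 ≤ n` and for `b ^ m * c ^ r * d ^ (-n)` if `n ≤ 0`. -/
abbrev M : Type := (ℤ × ℕ × ℕ) →₀ ℂ

/-- Basis vector. -/
def e (n : ℤ) (m r : ℕ) : M := Finsupp.single (n, m, r) 1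

/-- Extend a map on basis vectors linearly. -/
def ext3 {B : Type*} [AddCommGroup B] [Module ℂ B] (f : ℤ → ℕ → ℕ → B) : M →ₗ[ℂ] B :=
  Finsupp.linearCombination ℂ (fun p : ℤ × ℕ × ℕ => f p.1 p.2.1 p.2.2)

theorem ext3_e {B : Type*} [AddCommGroup B] [Module ℂ B] (f : ℤ → ℕ → ℕ → B) (n : ℤ) (m r : ℕ) :
    ext3 f (e n m r) = f n m r := by
  simp [ext3, e]

theorem M_ext {B : Type*} [AddCommGroup B] [Module ℂ B] {f g : M →ₗ[ℂ] B}
    (h : ∀ n m r, f (e n m r) = g (e n m r)) : f = g := by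
  apply Finsupp.lhom_ext'
  rintro ⟨n, m, r⟩
  ext
  exact h n m r

/-- Left multiplication by `a` in coordinates. -/
def Ma (s : ℂ) : Module.End ℂ M := ext3 fun n m r =>
  if 0 ≤ n then e (n + 1) m r
  else s ^ (m + r) • (e (n + 1) m r + s • e (n + 1) (m + 1) (r + 1))
/-- Left multiplication by `b` in coordinates. -/
def Mb (s : ℂ) : Module.End ℂ M := ext3 fun n m r => (s⁻¹) ^ n.toNat • e n (m + 1) r
/-- Left multiplication by `c` in coordinates. -/
def Mc (s : ℂ) : Module.End ℂ M := ext3 fun n m r => (s⁻¹) ^ n.toNat • e n m (r + 1)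
/-- Left multiplication by `d` in coordinates. -/
def Md (s : ℂ) : Module.End ℂ M := ext3 fun n m r =>
  if n ≤ 0 then (s⁻¹) ^ (m + r) • e (n - 1) m r
  else e (n - 1) m r + (s⁻¹ * (s⁻¹) ^ (2 * (n - 1).toNat)) • e (n - 1) (m + 1) (r + 1)

theorem int_cases' (n : ℤ) : (∃ k : ℕ, n = (k : ℤ)) ∨ (∃ k : ℕ, n = -((k + 1 : ℕ) : ℤ)) := by
  rcases le_or_gt 0 n with h | h
  · exact Or.inl ⟨n.toNat, by omega⟩
  · exact Or.inr ⟨(-1 - n).toNat, by omega⟩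

section coordinates
variable (s : ℂ) (k m r : ℕ)

theorem Ma_pos : Ma s (e (k : ℤ) m r) = e ((k + 1 : ℕ) : ℤ) m r := by
  simp [Ma, ext3_e]
theorem Ma_neg : Ma s (e (-((k + 1 : ℕ) : ℤ)) m r) =
    s ^ (m + r) • (e (-(k : ℤ)) m r + s • e (-(k : ℤ)) (m + 1) (r + 1)) := by
  have h : ¬ (0 : ℤ) ≤ -((k + 1 : ℕ) : ℤ) := by omega
  have h2 : -((k + 1 : ℕ) : ℤ) + 1 = -(k : ℤ) := by push_cast; ring
  rw [Ma, ext3_e, if_neg h, h2]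
theorem Mb_pos : Mb s (e (k : ℤ) m r) = (s⁻¹) ^ k • e (k : ℤ) (m + 1) r := by
  simp [Mb, ext3_e]
theorem Mb_neg : Mb s (e (-(k : ℤ)) m r) = e (-(k : ℤ)) (m + 1) r := by
  simp [Mb, ext3_e]
theorem Mc_pos : Mc s (e (k : ℤ) m r) = (s⁻¹) ^ k • e (k : ℤ) m (r + 1) := by
  simp [Mc, ext3_e]
theorem Mc_neg : Mc s (e (-(k : ℤ)) m r) = e (-(k : ℤ)) m (r + 1) := by
  simp [Mc, ext3_e]
theorem Md_neg : Md s (e (-(k : ℤ)) m r) = (s⁻¹) ^ (m + r) • e (-((k + 1 : ℕ) : ℤ)) m r := by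
  have h : -(k : ℤ) ≤ 0 := by omega
  have h2 : -(k : ℤ) - 1 = -((k + 1 : ℕ) : ℤ) := by push_cast; ring
  rw [Md, ext3_e, if_pos h, h2]
theorem Md_pos : Md s (e ((k + 1 : ℕ) : ℤ) m r) =
    e (k : ℤ) m r + (s⁻¹ * (s⁻¹) ^ (2 * k)) • e (k : ℤ) (m + 1) (r + 1) := by
  have h : ¬ ((k + 1 : ℕ) : ℤ) ≤ 0 := by omega
  have h2 : ((k + 1 : ℕ) : ℤ) - 1 = (k : ℤ) := by push_cast; ring
  rw [Md, ext3_e, if_neg h, h2, Int.toNat_natCast]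
theorem Md_zero : Md s (e ((0 : ℕ) : ℤ) m r) = (s⁻¹) ^ (m + r) • e (-((0 + 1 : ℕ) : ℤ)) m r :=
  Md_neg s 0 m r

end coordinates

theorem M_rels {s : ℂ} (hs : s ≠ 0) : Rels s (Ma s) (Mb s) (Mc s) (Md s) := by
  have h00 : (-((0 : ℕ) : ℤ)) = ((0 : ℕ) : ℤ) := by simp
  constructor <;> apply M_ext <;> intro n m r <;>
    simp only [Module.End.mul_apply, LinearMap.smul_apply, LinearMap.add_apply,
      Module.End.one_apply] <;>
    rcases int_cases' n with ⟨_ | k, rfl⟩ | ⟨k, rfl⟩ <;>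
    simp only [Ma_pos, Ma_neg, Mb_pos, Mb_neg, Mc_pos, Mc_neg, Md_pos, Md_neg, Md_zero,
      map_smul, map_add, h00] <;> match_scalars <;> (try simp only [inv_pow, pow_add, mul_one]) <;> (try field_simp) <;> (try ring)

/-- The action of `O(SU_q(2))` on coordinate vectors by left multiplication. -/
def act (q : Param) : A q →ₐ[ℂ] Module.End ℂ M := lift q (M_rels (qc_ne q))

/-- The coordinates of an element of `O(SU_q(2))` in the polynomial basis. -/
def coord (q : Param) : A q →ₗ[ℂ] M where
  toFun x := act q x (e 0 0 0)
  map_add' x y := by simp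
  map_smul' z x := by simp

/-- The monomials of the polynomial basis. -/
def mon (q : Param) (n : ℤ) (m r : ℕ) : A q :=
  if 0 ≤ n then gen q Gen.a ^ n.toNat * gen q Gen.b ^ m * gen q Gen.c ^ r
  else gen q Gen.b ^ m * gen q Gen.c ^ r * gen q Gen.d ^ (-n).toNat

theorem mon_pos (q : Param) (k m r : ℕ) :
    mon q (k : ℤ) m r = gen q Gen.a ^ k * gen q Gen.b ^ m * gen q Gen.c ^ r := by
  simp [mon]
theorem mon_neg (q : Param) (k m r : ℕ) :
    mon q (-(k : ℤ)) m r = gen q Gen.b ^ m * gen q Gen.c ^ r * gen q Gen.d ^ k := by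
  rcases k with _ | k
  · simp [mon]
  · have h : ¬ (0 : ℤ) ≤ -((k + 1 : ℕ) : ℤ) := by omega
    rw [mon, if_neg h]
    simp

theorem comm_pow {B : Type*} [Ring B] [Algebra ℂ B] {x y : B} {t : ℂ} (h : x * y = t • (y * x))
    (n : ℕ) : x * y ^ n = t ^ n • (y ^ n * x) := by
  induction n with
  | zero => simp
  | succ n ih =>
    rw [pow_succ, ← mul_assoc, ih, smul_mul_assoc, mul_assoc, h, mul_smul_comm, smul_smul, pow_succ,
      mul_assoc]

theorem comm_flip {B : Type*} [Ring B] [Algebra ℂ B] {x y : B} {t : ℂ} (ht : t ≠ 0)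
    (h : x * y = t • (y * x)) : y * x = t⁻¹ • (x * y) := by
  rw [h, smul_smul, inv_mul_cancel₀ ht, one_smul]

/-- The linear map sending coordinates to the element they represent. -/
def psi (q : Param) : M →ₗ[ℂ] A q := ext3 (mon q)

theorem comm2 {B : Type*} [Ring B] [Algebra ℂ B] {x y z : B} {t : ℂ} (h : x * y = t • (y * x))
    (h' : x * z = t • (z * x)) (m r : ℕ) :
    x * (y ^ m * z ^ r) = t ^ (m + r) • (y ^ m * z ^ r * x) := by
  rw [← mul_assoc, comm_pow h, smul_mul_assoc, mul_assoc, comm_pow h', mul_smul_comm, smul_smul,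
    pow_add, mul_assoc]

theorem psi_gen (q : Param) (g : Gen) (v : M) :
    psi q (act q (gen q g) v) = gen q g * psi q v := by
  have h00 : (-((0 : ℕ) : ℤ)) = ((0 : ℕ) : ℤ) := by simp
  have R := gen_rels q
  have hs := qc_ne q
  generalize hs' : qc q = s at *
  have hba := comm_flip hs R.ab
  have hca := comm_flip hs R.ac
  have hdb := comm_flip hs R.bd
  have hdc := comm_flip hs R.cd
  have key : (psi q).comp (act q (gen q g)) = (LinearMap.mulLeft ℂ (gen q g)).comp (psi q) := by
    apply M_ext
    intro n m r
    simp only [LinearMap.comp_apply, LinearMap.mulLeft_apply, act, lift_gen, hs']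
    have hbc : ∀ m r : ℕ, gen q Gen.b * gen q Gen.c * (gen q Gen.b ^ m * gen q Gen.c ^ r) =
        gen q Gen.b ^ (m + 1) * gen q Gen.c ^ (r + 1) := by
      intro m r
      have hc : Commute (gen q Gen.b) (gen q Gen.c) := R.bc
      rw [pow_succ' _ m, pow_succ' _ r, mul_assoc, ← mul_assoc (gen q Gen.c),
        (hc.symm.pow_right m).eq]
      simp only [mul_assoc]
    have hcb : ∀ m r : ℕ, gen q Gen.c * (gen q Gen.b ^ m * gen q Gen.c ^ r) =
        gen q Gen.b ^ m * gen q Gen.c ^ (r + 1) := by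
      intro m r
      have hc : Commute (gen q Gen.b) (gen q Gen.c) := R.bc
      rw [pow_succ' _ r, ← mul_assoc, (hc.symm.pow_right m).eq]
      simp only [mul_assoc]
    have hcb' : ∀ m r : ℕ, (gen q Gen.b ^ m * gen q Gen.c ^ r) * (gen q Gen.b * gen q Gen.c) =
        gen q Gen.b ^ (m + 1) * gen q Gen.c ^ (r + 1) := by
      intro m r
      have hc : Commute (gen q Gen.b) (gen q Gen.c) := R.bc
      rw [pow_succ _ m, pow_succ _ r, mul_assoc, ← mul_assoc (gen q Gen.c ^ r),
        ← (hc.pow_right r).eq]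
      simp only [mul_assoc]
    cases g
    · rcases int_cases' n with ⟨k, rfl⟩ | ⟨k, rfl⟩
      · simp only [genFun, Ma_pos, psi, ext3_e, mon_pos, pow_succ', mul_assoc]
      · simp only [genFun, Ma_neg, psi, ext3_e, map_smul, map_add, mon_neg]
        rw [← mul_assoc, comm2 R.ab R.ac, smul_mul_assoc, pow_succ' (gen q Gen.d) k,
          mul_assoc _ (gen q Gen.a) (_ * _),
          ← mul_assoc _ _ (_ ^ k), R.ad, add_mul, one_mul, mul_add, smul_mul_assoc, mul_smul_comm,
          ← mul_assoc _ _ (_ ^ k), hcb']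
    · rcases int_cases' n with ⟨k, rfl⟩ | ⟨k, rfl⟩
      · simp only [genFun, Mb_pos, psi, ext3_e, mon_pos, map_smul]
        simp only [mul_assoc]
        rw [← mul_assoc (gen q Gen.b) (gen q Gen.a ^ k), comm_pow hba, smul_mul_assoc]
        simp only [mul_assoc, pow_succ']
      · simp only [genFun, Mb_neg, psi, ext3_e, mon_neg]
        simp only [mul_assoc, pow_succ']
    · rcases int_cases' n with ⟨k, rfl⟩ | ⟨k, rfl⟩
      · simp only [genFun, Mc_pos, psi, ext3_e, mon_pos, map_smul]
        rw [mul_assoc (_ ^ k) _ (_ ^ r), ← mul_assoc, comm_pow hca, smul_mul_assoc, mul_assoc,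
          mul_assoc, hcb]
      · simp only [genFun, Mc_neg, psi, ext3_e, mon_neg]
        rw [← mul_assoc, hcb]
    · have hneg : ∀ k : ℕ, psi q (Md s (e (-(k : ℤ)) m r)) =
          gen q Gen.d * psi q (e (-(k : ℤ)) m r) := by
        intro k
        simp only [Md_neg, psi, ext3_e, mon_neg, map_smul]
        rw [← mul_assoc, comm2 hdb hdc, smul_mul_assoc, pow_succ', mul_assoc _ _ (_ ^ k)]
      rcases int_cases' n with ⟨_ | k, rfl⟩ | ⟨k, rfl⟩
      · rw [← h00]; exact hneg 0
      · simp only [genFun, Md_pos, psi, ext3_e, map_smul, map_add, mon_pos]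
        rw [mul_assoc (_ ^ (k + 1)), pow_succ' (gen q Gen.a) k, ← mul_assoc (gen q Gen.d),
          ← mul_assoc (gen q Gen.d), R.da, add_mul, add_mul,
          one_mul, smul_mul_assoc, mul_assoc _ _ (_ ^ k), comm_pow hca, mul_smul_comm,
          ← mul_assoc (gen q Gen.b) (gen q Gen.a ^ k), comm_pow hba]
        simp only [smul_mul_assoc, smul_smul]
        rw [mul_assoc (_ ^ k) (gen q Gen.b), mul_assoc (_ ^ k) _ (_ * _), hbc]
        simp only [mul_assoc]
        congr 2
        ring
      · exact hneg (k + 1)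
  exact LinearMap.congr_fun key v

theorem psi_act (q : Param) (x : A q) : ∀ v : M, psi q (act q x v) = x * psi q v := by
  induction x using A_induction q with
  | hs z => intro v; simp [AlgHom.commutes, Algebra.smul_def]
  | hg g => exact psi_gen q g
  | hadd x y hx hy => intro v; simp [hx, hy, add_mul]
  | hmul x y hx hy => intro v; simp [hx, hy, mul_assoc]

theorem psi_coord (q : Param) (x : A q) : psi q (coord q x) = x := by
  have h : psi q (e 0 0 0) = 1 := by simp [psi, ext3_e, mon]
  change psi q (act q x (e 0 0 0)) = x
  rw [psi_act, h, mul_one]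

theorem coord_injective (q : Param) : Function.Injective (coord q) :=
  Function.LeftInverse.injective (psi_coord q)

/-! ### The involution -/

/-- The opposite algebra with conjugated scalars. -/
def OpConj (q : Param) : Type := (A q)ᵐᵒᵖ

instance (q : Param) : Ring (OpConj q) := inferInstanceAs (Ring (A q)ᵐᵒᵖ)
instance (q : Param) : Algebra ℂ (OpConj q) := Algebra.compHom (A q)ᵐᵒᵖ (starRingEnd ℂ)

/-- View an element in the conjugate opposite algebra. -/
def toOp (q : Param) (x : A q) : OpConj q := MulOpposite.op x
/-- Inverse of `toOp`. -/
def ofOp (q : Param) (x : OpConj q) : A q := MulOpposite.unop x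

theorem ofOp_toOp (q : Param) (x : A q) : ofOp q (toOp q x) = x := rfl
theorem toOp_ofOp (q : Param) (x : OpConj q) : toOp q (ofOp q x) = x := rfl
theorem ofOp_add (q : Param) (x y : OpConj q) : ofOp q (x + y) = ofOp q x + ofOp q y := rfl
theorem ofOp_mul (q : Param) (x y : OpConj q) : ofOp q (x * y) = ofOp q y * ofOp q x := rfl
theorem ofOp_one (q : Param) : ofOp q 1 = 1 := rfl
theorem ofOp_smul (q : Param) (z : ℂ) (x : OpConj q) :
    ofOp q (z • x) = (starRingEnd ℂ) z • ofOp q x := rfl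
theorem ofOp_inj (q : Param) {x y : OpConj q} (h : ofOp q x = ofOp q y) : x = y :=
  MulOpposite.unop_injective h

theorem star_rels (q : Param) : Rels (qc q) (toOp q (gen q Gen.d))
    (toOp q (-(qc q) • gen q Gen.c)) (toOp q (-(qc q)⁻¹ • gen q Gen.b))
    (toOp q (gen q Gen.a)) := by
  have R := gen_rels q
  have hs := qc_ne q
  constructor <;> apply ofOp_inj <;>
    simp only [ofOp_mul, ofOp_smul, ofOp_toOp, ofOp_add, ofOp_one, qc_conj, map_inv₀,
      smul_mul_assoc, mul_smul_comm, R.ab, R.ac, R.bd, R.cd, R.bc, R.ad, R.da, smul_smul] <;>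
    match_scalars <;> (try field_simp)

/-- The involution as a homomorphism to the conjugate opposite algebra:
`a ↦ d`, `b ↦ -q c`, `c ↦ -q⁻¹ b`, `d ↦ a`. -/
def starHom (q : Param) : A q →ₐ[ℂ] OpConj q := lift q (star_rels q)

instance (q : Param) : Star (A q) := ⟨fun x => ofOp q (starHom q x)⟩

theorem star_def (q : Param) (x : A q) : star x = ofOp q (starHom q x) := rfl
theorem star_a (q : Param) : star (gen q Gen.a) = gen q Gen.d := by
  simp only [star_def, starHom, lift_gen]; rfl
theorem star_b (q : Param) : star (gen q Gen.b) = -(qc q) • gen q Gen.c := by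
  simp only [star_def, starHom, lift_gen]; rfl
theorem star_c (q : Param) : star (gen q Gen.c) = -(qc q)⁻¹ • gen q Gen.b := by
  simp only [star_def, starHom, lift_gen]; rfl
theorem star_d (q : Param) : star (gen q Gen.d) = gen q Gen.a := by
  simp only [star_def, starHom, lift_gen]; rfl
theorem star_add' (q : Param) (x y : A q) : star (x + y) = star x + star y := by
  simp only [star_def, map_add, ofOp_add]
theorem star_mul' (q : Param) (x y : A q) : star (x * y) = star y * star x := by
  simp only [star_def, map_mul, ofOp_mul]
theorem star_smul' (q : Param) (z : ℂ) (x : A q) : star (z • x) = (starRingEnd ℂ) z • star x := by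
  simp only [star_def, map_smul, ofOp_smul]
theorem star_one' (q : Param) : star (1 : A q) = 1 := by
  simp only [star_def, map_one, ofOp_one]
theorem star_star' (q : Param) (x : A q) : star (star x) = x := by
  induction x using A_induction q with
  | hs z => simp [Algebra.algebraMap_eq_smul_one, star_smul', star_one']
  | hg g =>
    have hs := qc_ne q
    cases g
    · rw [star_a, star_d]
    · rw [star_b, star_smul', star_c, smul_smul]; simp [qc_conj, hs]
    · rw [star_c, star_smul', star_b, smul_smul]; simp [qc_conj, hs]
    · rw [star_d, star_a]
  | hadd x y hx hy => rw [star_add', star_add', hx, hy]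
  | hmul x y hx hy => rw [star_mul', star_mul', hx, hy]

instance (q : Param) : StarRing (A q) where
  star_involutive := star_star' q
  star_mul := star_mul' q
  star_add := star_add' q

instance (q : Param) : StarModule ℂ (A q) := ⟨star_smul' q⟩

/-! ### The Haar state -/

/-- The `q`-number `[x]_q`. -/
def qnum (q : Param) (x : ℝ) : ℝ :=
  ((q : ℝ) ^ (-x) - (q : ℝ) ^ x) / ((q : ℝ)⁻¹ - (q : ℝ))

/-- The Haar state on `O(SU_q(2))`: it sends `a ^ n * b ^ m * c ^ r` and `b ^ m * c ^ r * d ^ n`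
to `(-1) ^ r / [r + 1]_q` if `n = 0` and `m = r`, and to `0` otherwise. -/
def haar (q : Param) : A q →ₗ[ℂ] ℂ :=
  (ext3 fun n m r => if n = 0 ∧ m = r then (-1 : ℂ) ^ r * ((qnum q (r + 1))⁻¹ : ℝ) else 0) ∘ₗ
    coord q

/-! ### Positivity of the Haar state

The Haar state is a weighted sum of vector functionals of a representation on sequences, which
shows that it is positive and faithful. -/

/-- Finitely supported functions on `ℕ × ℤ`. -/
abbrev V : Type := (ℕ × ℤ) →₀ ℂ

/-- Basis vector. -/
def f (n : ℕ) (m : ℤ) : V := Finsupp.single (n, m) 1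

/-- Extend a map on basis vectors linearly. -/
def ext2 (g : ℕ → ℤ → V) : Module.End ℂ V :=
  Finsupp.linearCombination ℂ (fun p : ℕ × ℤ => g p.1 p.2)

theorem ext2_f (g : ℕ → ℤ → V) (n : ℕ) (m : ℤ) : ext2 g (f n m) = g n m := by
  simp [ext2, f]

theorem V_ext {B : Type*} [AddCommGroup B] [Module ℂ B] {g g' : V →ₗ[ℂ] B}
    (h : ∀ n m, g (f n m) = g' (f n m)) : g = g' := by
  apply Finsupp.lhom_ext'
  rintro ⟨n, m⟩
  ext
  exact h n m

def Va (s : ℂ) : Module.End ℂ V := ext2 fun n m => (1 - s ^ (2 * n)) • f (n - 1) m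
def Vb (s : ℂ) : Module.End ℂ V := ext2 fun n m => (-s ^ (n + 1)) • f n (m - 1)
def Vc (s : ℂ) : Module.End ℂ V := ext2 fun n m => s ^ n • f n (m + 1)
def Vd : Module.End ℂ V := ext2 fun n m => f (n + 1) m

theorem V_rels {s : ℂ} (hs : s ≠ 0) : Rels s (Va s) (Vb s) (Vc s) Vd := by
  constructor <;> apply V_ext <;> intro n m <;> rcases n with _ | n <;>
    simp only [Module.End.mul_apply, LinearMap.smul_apply, LinearMap.add_apply,
      Module.End.one_apply, Va, Vb, Vc, Vd, ext2_f, map_smul, add_tsub_cancel_right,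
      sub_add_cancel] <;>
    match_scalars <;> (try simp only [pow_add, mul_one]) <;> (try field_simp) <;>
    (try ring)

/-- The representation. -/
def rep (q : Param) : A q →ₐ[ℂ] Module.End ℂ V := lift q (V_rels (qc_ne q))

/-- Squared norms of the basis vectors. -/
def wt (q : Param) (n : ℕ) : ℝ := ∏ t ∈ Finset.range n, (1 - (q : ℝ) ^ (2 * (t + 1)))

theorem one_sub_pow_pos (q : Param) {n : ℕ} (hn : n ≠ 0) : 0 < 1 - (q : ℝ) ^ n :=
  sub_pos.2 (pow_lt_one₀ (q_pos q).le (q_lt q) hn)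

theorem wt_pos (q : Param) (n : ℕ) : 0 < wt q n :=
  Finset.prod_pos fun t _ => one_sub_pow_pos q (by omega)

theorem wt_succ (q : Param) (n : ℕ) : wt q (n + 1) = wt q n * (1 - (q : ℝ) ^ (2 * (n + 1))) :=
  Finset.prod_range_succ _ _

/-- The weighted inner product on sequences. -/
def form (q : Param) (u v : V) : ℂ :=
  v.sum fun p z => (starRingEnd ℂ) (u p) * z * (wt q p.1 : ℂ)

theorem form_add_right (q : Param) (u v v' : V) : form q u (v + v') = form q u v + form q u v' :=
  Finsupp.sum_add_index' (by simp) (by intros; ring)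
theorem form_smul_right (q : Param) (z : ℂ) (u v : V) : form q u (z • v) = z * form q u v := by
  rw [form, Finsupp.sum_smul_index' (by simp), form, Finsupp.mul_sum]
  refine Finsupp.sum_congr fun p _ => ?_
  simp only [smul_eq_mul]; ring
theorem form_add_left (q : Param) (u u' v : V) : form q (u + u') v = form q u v + form q u' v := by
  simp only [form, ← Finsupp.sum_add]
  refine Finsupp.sum_congr fun p _ => ?_
  simp only [Finsupp.add_apply, map_add]; ring
theorem form_smul_left (q : Param) (z : ℂ) (u v : V) :
    form q (z • u) v = (starRingEnd ℂ) z * form q u v := by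
  simp only [form, Finsupp.mul_sum]
  refine Finsupp.sum_congr fun p _ => ?_
  simp only [Finsupp.smul_apply, smul_eq_mul, map_mul]; ring
theorem form_f (q : Param) (n : ℕ) (m : ℤ) (v : V) :
    form q (f n m) v = wt q n * v (n, m) := by
  induction v using Finsupp.induction_linear with
  | zero => simp [form]
  | add v v' h h' => rw [form_add_right, h, h', Finsupp.add_apply]; ring
  | single p z =>
    rw [form, Finsupp.sum_single_index (by simp)]
    by_cases hp : p = (n, m)
    · subst hp; simp [f]; ring
    · simp [f, hp, Ne.symm hp]

theorem adj_of_basis (q : Param) (S T : Module.End ℂ V)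
    (h : ∀ n m n' m', form q (f n m) (T (f n' m')) = form q (S (f n m)) (f n' m')) (u v : V) :
    form q u (T v) = form q (S u) v := by
  have single_eq : ∀ (p : ℕ × ℤ) (z : ℂ), (Finsupp.single p z : V) = z • f p.1 p.2 := by
    intro p z; simp [f]
  induction u using Finsupp.induction_linear with
  | zero => simp [form]
  | add u u' hu hu' => rw [form_add_left, map_add, form_add_left, hu, hu']
  | single p z =>
    induction v using Finsupp.induction_linear with
    | zero => simp [form]
    | add v v' hu hu' => rw [map_add, form_add_right, form_add_right, hu, hu']
    | single p' z' =>
      simp only [single_eq, map_smul, form_smul_left, form_smul_right, h]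

theorem form_ff (q : Param) (n : ℕ) (m : ℤ) (n' : ℕ) (m' : ℤ) :
    form q (f n m) (f n' m') = if n = n' ∧ m = m' then (wt q n : ℂ) else 0 := by
  rw [form_f, f, Finsupp.single_apply]
  by_cases h : n = n' ∧ m = m'
  · obtain ⟨rfl, rfl⟩ := h; simp
  · rw [if_neg h, if_neg (by intro h'; apply h; simp_all), mul_zero]

theorem wt_succ_c (q : Param) (n : ℕ) :
    (wt q (n + 1) : ℂ) = wt q n * (1 - qc q ^ (2 * (n + 1))) := by
  rw [wt_succ]; simp [qc]

theorem form_gen (q : Param) (g : Gen) (u v : V) :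
    form q u (rep q (gen q g) v) = form q (rep q (star (gen q g)) u) v := by
  apply adj_of_basis
  intro n m n' m'
  have hs := qc_ne q
  cases g
  · simp only [star_a, rep, lift_gen, genFun, Va, Vd, ext2_f, form_smul_right, form_ff]
    rcases n' with _ | n'
    · simp
    · by_cases h : n = n' ∧ m = m'
      · obtain ⟨rfl, rfl⟩ := h
        simp [wt_succ_c]; ring
      · rw [if_neg (by simpa using h), if_neg (by simpa using h)]; simp
  · simp only [star_b, map_smul, LinearMap.smul_apply, rep, lift_gen, genFun, Vb, Vc, ext2_f,
      form_smul_right, form_smul_left, form_ff]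
    by_cases h : n = n' ∧ m = m' - 1
    · obtain ⟨rfl, rfl⟩ := h
      simp [qc_conj]; ring
    · rw [if_neg h, if_neg (by intro h'; apply h; omega)]; simp
  · simp only [star_c, map_smul, LinearMap.smul_apply, rep, lift_gen, genFun, Vb, Vc, ext2_f,
      form_smul_right, form_smul_left, form_ff]
    by_cases h : n = n' ∧ m = m' + 1
    · obtain ⟨rfl, rfl⟩ := h
      simp [qc_conj]; field_simp; ring
    · rw [if_neg h, if_neg (by intro h'; apply h; omega)]; simp
  · simp only [star_d, rep, lift_gen, genFun, Va, Vd, ext2_f, form_smul_left, form_ff]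
    rcases n with _ | n
    · simp
    · by_cases h : n = n' ∧ m = m'
      · obtain ⟨rfl, rfl⟩ := h
        simp [wt_succ_c, qc_conj]; ring
      · rw [if_neg (by simpa using h), if_neg (by simpa using h)]; simp

theorem form_rep (q : Param) (x : A q) :
    ∀ u v : V, form q u (rep q x v) = form q (rep q (star x) u) v := by
  induction x using A_induction q with
  | hs z =>
    intro u v
    simp [Algebra.algebraMap_eq_smul_one, form_smul_left, form_smul_right, star_smul]
  | hg g => exact form_gen q g
  | hadd x y hx hy =>
    intro u v
    simp only [map_add, LinearMap.add_apply, star_add, form_add_left, form_add_right, hx, hy]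
  | hmul x y hx hy =>
    intro u v
    simp only [map_mul, Module.End.mul_apply, star_mul, hx, hy]

/-- Vector functionals of the representation. -/
def phi (q : Param) (N : ℕ) (x : A q) : ℂ := rep q x (f N 0) (N, 0)

theorem form_phi (q : Param) (N : ℕ) (x : A q) :
    form q (f N 0) (rep q x (f N 0)) = wt q N * phi q N x := form_f q N 0 _

theorem phi_star (q : Param) (N : ℕ) (x y : A q) :
    wt q N * phi q N (star x * y) = form q (rep q x (f N 0)) (rep q y (f N 0)) := by
  rw [← form_phi, map_mul, Module.End.mul_apply, form_rep, star_star]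

theorem form_self (q : Param) (u : V) :
    form q u u = ((∑ p ∈ u.support, ‖u p‖ ^ 2 * wt q p.1 : ℝ) : ℂ) := by
  rw [form, Finsupp.sum]
  push_cast
  refine Finset.sum_congr rfl fun p _ => ?_
  rw [Complex.conj_mul']

theorem form_conj (q : Param) (u v : V) : (starRingEnd ℂ) (form q u v) = form q v u := by
  have single_eq : ∀ (p : ℕ × ℤ) (z : ℂ), (Finsupp.single p z : V) = z • f p.1 p.2 := by
    intro p z; simp [f]
  induction u using Finsupp.induction_linear with
  | zero => simp [form]
  | add u u' hu hu' => rw [form_add_left, form_add_right, map_add, hu, hu']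
  | single p z =>
    induction v using Finsupp.induction_linear with
    | zero => simp [form]
    | add v v' hu hu' => rw [form_add_right, form_add_left, map_add, hu, hu']
    | single p' z' =>
      simp only [single_eq, form_smul_left, form_smul_right, form_ff, map_mul, Complex.conj_conj]
      by_cases h : p.1 = p'.1 ∧ p.2 = p'.2
      · rw [if_pos h, if_pos ⟨h.1.symm, h.2.symm⟩, h.1]; simp; ring
      · rw [if_neg h, if_neg (fun h' => h ⟨h'.1.symm, h'.2.symm⟩)]; simp

theorem Vc_pow (s : ℂ) (r n : ℕ) (x : ℤ) : (Vc s ^ r) (f n x) = (s ^ n) ^ r • f n (x + r) := by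
  induction r with
  | zero => simp
  | succ r ih =>
    rw [pow_succ', Module.End.mul_apply, ih, map_smul, Vc, ext2_f, smul_smul, pow_succ]
    push_cast; rw [add_assoc]
theorem Vb_pow (s : ℂ) (m n : ℕ) (x : ℤ) :
    (Vb s ^ m) (f n x) = (-s ^ (n + 1)) ^ m • f n (x - m) := by
  induction m with
  | zero => simp
  | succ m ih =>
    rw [pow_succ', Module.End.mul_apply, ih, map_smul, Vb, ext2_f, smul_smul, ← pow_succ]
    push_cast; rw [sub_sub]
theorem Vd_pow (k n : ℕ) (x : ℤ) : (Vd ^ k) (f n x) = f (n + k) x := by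
  induction k with
  | zero => simp
  | succ k ih => rw [pow_succ', Module.End.mul_apply, ih, Vd, ext2_f, add_assoc]
theorem Va_pow (s : ℂ) (k n : ℕ) (x : ℤ) :
    (Va s ^ k) (f n x) = (∏ t ∈ Finset.range k, (1 - s ^ (2 * (n - t)))) • f (n - k) x := by
  induction k with
  | zero => simp
  | succ k ih =>
    rw [pow_succ', Module.End.mul_apply, ih, map_smul, Va, ext2_f, smul_smul,
      Finset.prod_range_succ, Nat.sub_sub]

theorem f_apply (n : ℕ) (m : ℤ) (n' : ℕ) (m' : ℤ) :
    f n m (n', m') = if n = n' ∧ m = m' then 1 else 0 := by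
  simp [f, Finsupp.single_apply]

theorem rep_mon_apply (q : Param) (N : ℕ) (n : ℤ) (m r : ℕ) (p : ℕ × ℤ) :
    (rep q (mon q n m r) (f N 0)) p =
      if (p.1 : ℤ) = N - n ∧ p.2 = (r : ℤ) - m then
        (-qc q) ^ m * (qc q ^ (N + (-n).toNat)) ^ (m + r) *
          ∏ t ∈ Finset.range n.toNat, (1 - qc q ^ (2 * (N - t))) else 0 := by
  obtain ⟨p1, p2⟩ := p
  have ga : rep q (gen q Gen.a) = Va (qc q) := lift_gen q _ _
  have gb : rep q (gen q Gen.b) = Vb (qc q) := lift_gen q _ _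
  have gc : rep q (gen q Gen.c) = Vc (qc q) := lift_gen q _ _
  have gd : rep q (gen q Gen.d) = Vd := lift_gen q _ _
  rcases int_cases' n with ⟨k, rfl⟩ | ⟨k, rfl⟩
  · simp only [mon_pos, map_mul, map_pow, ga, gb, gc, Module.End.mul_apply, Vc_pow, Vb_pow, map_smul,
      Va_pow, Finsupp.smul_apply, smul_eq_mul, f_apply]
    by_cases hk : k ≤ N
    · by_cases h : (p1 : ℤ) = N - k ∧ p2 = (r : ℤ) - m
      · rw [if_pos h, if_pos ⟨by omega, by omega⟩]
        simp; ring
      · rw [if_neg h, if_neg (by intro h'; apply h; omega)]; simp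
    · have h0 : ∏ t ∈ Finset.range k, (1 - qc q ^ (2 * (N - t))) = 0 :=
        Finset.prod_eq_zero (Finset.mem_range.2 (by omega : N < k)) (by simp)
      rw [if_neg (by omega : ¬ ((p1 : ℤ) = N - k ∧ p2 = (r : ℤ) - m)), h0]; simp
  · simp only [mon_neg, map_mul, map_pow, gd, gb, gc, Module.End.mul_apply, Vc_pow, Vb_pow, map_smul,
      Vd_pow, Finsupp.smul_apply, smul_eq_mul, f_apply, neg_neg,
      Int.toNat_natCast, Int.toNat_neg_natCast]
    by_cases h : (p1 : ℤ) = N - (-((k + 1 : ℕ) : ℤ)) ∧ p2 = (r : ℤ) - m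
    · rw [if_pos h, if_pos ⟨by omega, by omega⟩]
      simp; ring
    · rw [if_neg h, if_neg (by intro h'; apply h; omega)]; simp

theorem phi_mon (q : Param) (N : ℕ) (n : ℤ) (m r : ℕ) :
    phi q N (mon q n m r) = if n = 0 ∧ m = r then (-qc q) ^ r * (qc q ^ N) ^ (2 * r) else 0 := by
  rw [phi, rep_mon_apply]
  by_cases h : n = 0 ∧ m = r
  · obtain ⟨rfl, rfl⟩ := h
    simp [two_mul]
  · rw [if_neg h, if_neg (by intro h'; apply h; simp only at h'; omega)]

theorem qnum_succ (q : Param) (r : ℕ) :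
    qnum q (r + 1) = (((q : ℝ) ^ (r + 1))⁻¹ - (q : ℝ) ^ (r + 1)) / ((q : ℝ)⁻¹ - (q : ℝ)) := by
  rw [qnum, Real.rpow_neg (q_pos q).le]
  norm_cast

theorem hasSum_term (q : Param) (r : ℕ) :
    HasSum (fun N : ℕ => (1 - qc q ^ 2) * qc q ^ (2 * N) * ((-qc q) ^ r * (qc q ^ N) ^ (2 * r)))
      ((-1 : ℂ) ^ r * ((qnum q (r + 1))⁻¹ : ℝ)) := by
  have h1 : ‖qc q ^ (2 * (r + 1))‖ < 1 := by
    rw [norm_pow, qc, Complex.norm_real, Real.norm_of_nonneg (q_pos q).le]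
    exact pow_lt_one₀ (q_pos q).le (q_lt q) (by omega)
  have h2 := (hasSum_geometric_of_norm_lt_one h1).mul_left ((1 - qc q ^ 2) * (-qc q) ^ r)
  have hs := qc_ne q
  have e1 : (1 - qc q ^ (2 * (r + 1))) ≠ 0 := by
    have := one_sub_pow_pos q (n := 2 * (r + 1)) (by omega)
    have h3 : ((1 - (q : ℝ) ^ (2 * (r + 1)) : ℝ) : ℂ) ≠ 0 := by exact_mod_cast this.ne'
    simpa [qc] using h3
  have e2 : (1 - qc q ^ 2) ≠ 0 := by
    have := one_sub_pow_pos q (n := 2) (by omega)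
    have h3 : ((1 - (q : ℝ) ^ 2 : ℝ) : ℂ) ≠ 0 := by exact_mod_cast this.ne'
    simpa [qc] using h3
  have hval : (-1 : ℂ) ^ r * ((qnum q (r + 1))⁻¹ : ℝ) =
      (1 - qc q ^ 2) * (-qc q) ^ r * (1 - qc q ^ (2 * (r + 1)))⁻¹ := by
    rw [qnum_succ]
    have : (((((q : ℝ) ^ (r + 1))⁻¹ - (q : ℝ) ^ (r + 1)) / ((q : ℝ)⁻¹ - (q : ℝ)))⁻¹ : ℝ) =
        ((q : ℝ) ^ r * (1 - (q : ℝ) ^ 2)) / (1 - (q : ℝ) ^ (2 * (r + 1))) := by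
      have hq := (q_pos q).ne'
      have e1' := (one_sub_pow_pos q (n := 2 * (r + 1)) (by omega)).ne'
      have e2' := (one_sub_pow_pos q (n := 2) (by omega)).ne'
      have e3 : ((q : ℝ) ^ (r + 1))⁻¹ - (q : ℝ) ^ (r + 1) =
          (1 - (q : ℝ) ^ (2 * (r + 1))) / (q : ℝ) ^ (r + 1) := by
        field_simp; ring
      have e4 : ((q : ℝ)⁻¹ - (q : ℝ)) = (1 - (q : ℝ) ^ 2) / q := by field_simp
      rw [e3, e4]
      field_simp
      ring
    rw [this]
    push_cast
    change _ * (qc q ^ r * (1 - qc q ^ 2) / (1 - qc q ^ (2 * (r + 1)))) = _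
    rw [neg_pow (qc q) r]
    field_simp
  rw [hval]
  refine h2.congr_fun ?_
  intro N
  rw [← pow_mul, ← pow_mul, mul_assoc, mul_assoc]
  congr 1
  ring

theorem hasSum_haar (q : Param) (x : A q) :
    HasSum (fun N : ℕ => (1 - qc q ^ 2) * qc q ^ (2 * N) * phi q N x) (haar q x) := by
  have phi_add : ∀ N (x y : A q), phi q N (x + y) = phi q N x + phi q N y := by
    intro N x y; simp [phi]
  have phi_smul : ∀ N (z : ℂ) (x : A q), phi q N (z • x) = z * phi q N x := by
    intro N z x; simp [phi]
  have key : ∀ v : M, HasSum (fun N : ℕ => (1 - qc q ^ 2) * qc q ^ (2 * N) * phi q N (psi q v))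
      (ext3 (fun n m r => if n = 0 ∧ m = r then
        (-1 : ℂ) ^ r * ((qnum q (r + 1))⁻¹ : ℝ) else 0) v) := by
    intro v
    induction v using Finsupp.induction_linear with
    | zero => simp [phi]
    | add v w hv hw => simpa [phi_add, mul_add] using hv.add hw
    | single p z =>
      have hp : (Finsupp.single p z : M) = z • e p.1 p.2.1 p.2.2 := by simp [e]
      rw [hp]
      simp only [map_smul, phi_smul, psi, ext3_e, phi_mon, smul_eq_mul]
      by_cases h : p.1 = 0 ∧ p.2.1 = p.2.2
      · simp only [if_pos h]
        refine ((hasSum_term q p.2.2).mul_left z).congr_fun ?_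
        intro N; ring
      · simp [if_neg h]
  have := key (coord q x)
  rw [psi_coord] at this
  exact this

theorem phi_star_eq (q : Param) (N : ℕ) (x y : A q) :
    phi q N (star x * y) =
      (wt q N : ℂ)⁻¹ * form q (rep q x (f N 0)) (rep q y (f N 0)) := by
  rw [← phi_star, ← mul_assoc, inv_mul_cancel₀, one_mul]
  exact_mod_cast (wt_pos q N).ne'

theorem haar_conj (q : Param) (x y : A q) :
    (starRingEnd ℂ) (haar q (star y * x)) = haar q (star x * y) := by
  have h1 := (hasSum_haar q (star y * x)).star
  have h2 := hasSum_haar q (star x * y)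
  refine h1.unique (h2.congr_fun ?_)
  intro N
  have h3 := form_conj q (rep q y (f N 0)) (rep q x (f N 0))
  simp only [phi_star_eq, Complex.star_def, map_mul, map_sub, map_one, map_pow, qc_conj, map_inv₀,
    Complex.conj_ofReal, h3]

/-- The real summands of `haar (star x * x)`. -/
def haarTerm (q : Param) (x : A q) (N : ℕ) : ℝ :=
  (1 - (q : ℝ) ^ 2) * (q : ℝ) ^ (2 * N) * ((wt q N)⁻¹ *
    ∑ p ∈ (rep q x (f N 0)).support, ‖(rep q x (f N 0)) p‖ ^ 2 * wt q p.1)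

theorem haarTerm_nonneg (q : Param) (x : A q) (N : ℕ) : 0 ≤ haarTerm q x N := by
  have h1 := (one_sub_pow_pos q (n := 2) (by omega)).le
  have h2 := (q_pos q).le
  have h3 := (wt_pos q N).le
  have h4 : 0 ≤ ∑ p ∈ (rep q x (f N 0)).support, ‖(rep q x (f N 0)) p‖ ^ 2 * wt q p.1 :=
    Finset.sum_nonneg fun p _ => mul_nonneg (by positivity) (wt_pos q _).le
  unfold haarTerm
  positivity

theorem hasSum_haar_re (q : Param) (x : A q) :
    HasSum (haarTerm q x) (haar q (star x * x)).re := by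
  have h1 := Complex.hasSum_re (hasSum_haar q (star x * x))
  refine h1.congr_fun ?_
  intro N
  rw [phi_star_eq, form_self]
  have : (1 - qc q ^ 2) * qc q ^ (2 * N) * ((wt q N : ℂ)⁻¹ *
      ((∑ p ∈ (rep q x (f N 0)).support, ‖(rep q x (f N 0)) p‖ ^ 2 * wt q p.1 : ℝ) : ℂ)) =
      ((haarTerm q x N : ℝ) : ℂ) := by
    simp only [haarTerm, qc]; push_cast; rfl
  rw [this, Complex.ofReal_re]

theorem haar_nonneg (q : Param) (x : A q) : 0 ≤ (haar q (star x * x)).re :=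
  (hasSum_haar_re q x).nonneg (haarTerm_nonneg q x)

theorem rep_eq_zero (q : Param) (x : A q) (h : (haar q (star x * x)).re = 0) (N : ℕ) :
    rep q x (f N 0) = 0 := by
  have h1 := hasSum_haar_re q x
  rw [h] at h1
  have h2 := congr_fun ((hasSum_zero_iff_of_nonneg (haarTerm_nonneg q x)).1 h1) N
  simp only [haarTerm, Pi.zero_apply, mul_eq_zero, inv_eq_zero] at h2
  have e1 := (one_sub_pow_pos q (n := 2) (by omega)).ne'
  have e2 : (q : ℝ) ^ (2 * N) ≠ 0 := pow_ne_zero _ (q_pos q).ne'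
  have e3 := (wt_pos q N).ne'
  have h3 : ∑ p ∈ (rep q x (f N 0)).support, ‖(rep q x (f N 0)) p‖ ^ 2 * wt q p.1 = 0 := by
    tauto
  rw [Finset.sum_eq_zero_iff_of_nonneg
    (fun p _ => mul_nonneg (by positivity) (wt_pos q _).le)] at h3
  ext p
  by_contra hp
  have h4 := h3 p (by simpa using hp)
  have e4 := (wt_pos q p.1).ne'
  simp only [mul_eq_zero, e4, or_false] at h4
  exact hp (by simpa using h4)

theorem coord_eq_zero (q : Param) (v : M) (h : ∀ N, rep q (psi q v) (f N 0) = 0) : v = 0 := by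
  have hs := qc_ne q
  have expand : ∀ N p, (rep q (psi q v) (f N 0)) p =
      ∑ i ∈ v.support, v i * (rep q (mon q i.1 i.2.1 i.2.2) (f N 0)) p := by
    intro N p
    rw [psi, ext3, Finsupp.linearCombination_apply, Finsupp.sum, map_sum, LinearMap.sum_apply,
      Finsupp.finsetSum_apply]
    refine Finset.sum_congr rfl fun i _ => ?_
    simp
  ext ⟨n0, m0, r0⟩
  by_contra hne
  have hmem : (n0, m0, r0) ∈ v.support := by simpa using hne
  let P : Polynomial ℂ := ∑ i ∈ v.support,
    if i.1 = n0 ∧ (i.2.2 : ℤ) - i.2.1 = (r0 : ℤ) - m0 then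
      Polynomial.monomial (i.2.1 + i.2.2) (v i * (-qc q) ^ i.2.1) else 0
  have hcoeff : P.coeff (m0 + r0) = v (n0, m0, r0) * (-qc q) ^ m0 := by
    simp only [P, Polynomial.finsetSum_coeff]
    rw [Finset.sum_eq_single_of_mem _ hmem]
    · simp
    · rintro ⟨n, m, r⟩ _ hi
      by_cases hc : n = n0 ∧ (r : ℤ) - m = (r0 : ℤ) - m0
      · rw [if_pos hc, Polynomial.coeff_monomial, if_neg]
        intro h'
        apply hi
        simp only [Prod.mk.injEq]
        simp only at h'
        omega
      · rw [if_neg hc, Polynomial.coeff_zero]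
  have hroot : ∀ N : ℕ, n0.toNat ≤ N → P.eval (qc q ^ (N + (-n0).toNat)) = 0 := by
    intro N hN
    have h1 := expand N ((N - n0 : ℤ).toNat, (r0 : ℤ) - m0)
    rw [h N] at h1
    have hP : (∏ t ∈ Finset.range n0.toNat, (1 - qc q ^ (2 * (N - t)))) ≠ 0 := by
      rw [Finset.prod_ne_zero_iff]
      intro t ht
      rw [Finset.mem_range] at ht
      have := one_sub_pow_pos q (n := 2 * (N - t)) (by omega)
      have h3 : ((1 - (q : ℝ) ^ (2 * (N - t)) : ℝ) : ℂ) ≠ 0 := by exact_mod_cast this.ne'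
      simpa [qc] using h3
    have h2 : (∑ i ∈ v.support, v i * (rep q (mon q i.1 i.2.1 i.2.2) (f N 0))
        ((N - n0 : ℤ).toNat, (r0 : ℤ) - m0)) = P.eval (qc q ^ (N + (-n0).toNat)) *
        ∏ t ∈ Finset.range n0.toNat, (1 - qc q ^ (2 * (N - t))) := by
      simp only [P, Polynomial.eval_finsetSum, Finset.sum_mul]
      refine Finset.sum_congr rfl ?_
      rintro ⟨n, m, r⟩ _
      rw [rep_mon_apply]
      by_cases hc : n = n0 ∧ (r : ℤ) - m = (r0 : ℤ) - m0
      · rw [if_pos hc, if_pos (by simp only; omega), Polynomial.eval_monomial, hc.1]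
        ring
      · rw [if_neg hc, if_neg (by simp only; omega)]; simp
    rw [h2] at h1
    simpa [hP] using h1.symm
  have hinj : Function.Injective (fun N : ℕ => qc q ^ (N + n0.toNat + (-n0).toNat)) := by
    intro N N' hNN
    have h1 : (q : ℝ) ^ (N + n0.toNat + (-n0).toNat) = (q : ℝ) ^ (N' + n0.toNat + (-n0).toNat) := by
      simp only [qc] at hNN
      exact_mod_cast hNN
    have h2 := (pow_right_injective₀ (q_pos q) (q_lt q).ne) h1
    omega
  have hP0 : P = 0 := by
    apply Polynomial.eq_zero_of_infinite_isRoot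
    refine (Set.infinite_range_of_injective hinj).mono ?_
    rintro _ ⟨N, rfl⟩
    exact hroot (N + n0.toNat) (by omega)
  rw [hP0, Polynomial.coeff_zero] at hcoeff
  have : v (n0, m0, r0) * (-qc q) ^ m0 ≠ 0 := mul_ne_zero hne (pow_ne_zero _ (neg_ne_zero.2 hs))
  exact this hcoeff.symm

theorem haar_definite (q : Param) (x : A q) (h : (haar q (star x * x)).re = 0) : x = 0 := by
  have h1 : coord q x = 0 := by
    apply coord_eq_zero q
    intro N
    rw [psi_coord]
    exact rep_eq_zero q x h N
  rw [← psi_coord q x, h1, map_zero]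

/-! ### The GNS space -/

/-- The vector space `O(SU_q(2))`, to be equipped with the inner product of the Haar state. -/
def PreGNS (q : Param) : Type := A q

instance (q : Param) : AddCommGroup (PreGNS q) := inferInstanceAs (AddCommGroup (A q))
instance (q : Param) : Module ℂ (PreGNS q) := inferInstanceAs (Module ℂ (A q))

/-- The identity map from `O(SU_q(2))` to the pre-Hilbert space. -/
def toPre (q : Param) : A q ≃ₗ[ℂ] PreGNS q := LinearEquiv.refl ℂ _
/-- The identity map from the pre-Hilbert space to `O(SU_q(2))`. -/
def ofPre (q : Param) : PreGNS q ≃ₗ[ℂ] A q := (toPre q).symm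

theorem ofPre_toPre (q : Param) (x : A q) : ofPre q (toPre q x) = x := rfl
theorem toPre_ofPre (q : Param) (x : PreGNS q) : toPre q (ofPre q x) = x := rfl

/-- The inner product `⟨x, y⟩ = h(x* y)`, conjugate linear in the first variable. -/
abbrev innerCore (q : Param) : InnerProductSpace.Core ℂ (PreGNS q) where
  inner x y := haar q (star (ofPre q x) * ofPre q y)
  conj_inner_symm x y := haar_conj q (ofPre q x) (ofPre q y)
  re_inner_nonneg x := haar_nonneg q (ofPre q x)
  add_left x y z := by simp [add_mul]
  smul_left x y z := by simp [star_smul]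
  definite x hx := haar_definite q (ofPre q x) (by rw [hx, Complex.zero_re])

instance (q : Param) : NormedAddCommGroup (PreGNS q) :=
  InnerProductSpace.Core.toNormedAddCommGroup (cd := innerCore q)
instance (q : Param) : InnerProductSpace ℂ (PreGNS q) :=
  InnerProductSpace.ofCore (innerCore q).toCore

theorem inner_def (q : Param) (x y : PreGNS q) :
    inner ℂ x y = haar q (star (ofPre q x) * ofPre q y) := rfl

/-- The GNS space of the Haar state: the completion of `O(SU_q(2))` for the inner product
`h(x* y)`. -/
def Hh (q : Param) : Type := UniformSpace.Completion (PreGNS q)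

instance (q : Param) : NormedAddCommGroup (Hh q) :=
  inferInstanceAs (NormedAddCommGroup (UniformSpace.Completion (PreGNS q)))
instance (q : Param) : InnerProductSpace ℂ (Hh q) :=
  inferInstanceAs (InnerProductSpace ℂ (UniformSpace.Completion (PreGNS q)))
instance (q : Param) : CompleteSpace (Hh q) :=
  inferInstanceAs (CompleteSpace (UniformSpace.Completion (PreGNS q)))

/-- The inclusion of the pre-Hilbert space in its completion. -/
def toHh (q : Param) : PreGNS q →ₗᵢ[ℂ] Hh q :=
  UniformSpace.Completion.toComplₗᵢ (𝕜 := ℂ) (E := PreGNS q)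

theorem toHh_dense (q : Param) : DenseRange (toHh q) :=
  UniformSpace.Completion.denseRange_coe (α := PreGNS q)

/-- The Hilbert space direct sum of two copies of the GNS space. -/
abbrev H (q : Param) : Type := WithLp 2 (Hh q × Hh q)

theorem norm_sq_A (q : Param) (x : A q) : ‖toPre q x‖ ^ 2 = (haar q (star x * x)).re :=
  norm_sq_eq_re_inner (𝕜 := ℂ) (toPre q x)

theorem norm_ac (q : Param) (x : A q) :
    ‖toPre q (gen q Gen.a * x)‖ ^ 2 + ‖toPre q (gen q Gen.c * x)‖ ^ 2 = ‖toPre q x‖ ^ 2 := by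
  have R := gen_rels q
  have h1 : star (gen q Gen.a * x) * (gen q Gen.a * x) + star (gen q Gen.c * x) * (gen q Gen.c * x)
      = star x * x := by
    have h2 : star (gen q Gen.a * x) * (gen q Gen.a * x) +
        star (gen q Gen.c * x) * (gen q Gen.c * x) =
        star x * (star (gen q Gen.a) * gen q Gen.a + star (gen q Gen.c) * gen q Gen.c) * x := by
      simp only [star_mul]; noncomm_ring
    rw [h2, star_a, star_c, R.da, smul_mul_assoc, add_assoc, neg_smul, add_neg_cancel,
      add_zero, mul_one]
  rw [norm_sq_A, norm_sq_A, norm_sq_A, ← h1, map_add, Complex.add_re]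

theorem norm_gen_le (q : Param) (g : Gen) : ∃ C : ℝ, ∀ x : A q, ‖toPre q (gen q g * x)‖ ≤ C * ‖toPre q x‖ := by
  have R := gen_rels q
  have hc : ∀ x : A q, ‖toPre q (gen q Gen.c * x)‖ ≤ ‖toPre q x‖ := fun x => by
    have := norm_ac q x
    exact abs_le_of_sq_le_sq' (by nlinarith [sq_nonneg ‖toPre q (gen q Gen.a * x)‖]) (norm_nonneg _) |>.2
  cases g
  · refine ⟨1, fun x => ?_⟩
    have := norm_ac q x
    rw [one_mul]
    exact abs_le_of_sq_le_sq' (by nlinarith [sq_nonneg ‖toPre q (gen q Gen.c * x)‖]) (norm_nonneg _) |>.2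
  · refine ⟨q, fun x => ?_⟩
    have h1 : star (gen q Gen.b * x) * (gen q Gen.b * x) =
        (qc q ^ 2) • (star (gen q Gen.c * x) * (gen q Gen.c * x)) := by
      simp only [star_mul, star_b, star_c]
      simp only [mul_smul_comm, smul_mul_assoc, mul_assoc, smul_smul]
      rw [← mul_assoc (gen q Gen.c), ← R.bc, mul_assoc]
      have := qc_ne q
      match_scalars
      field_simp
    have h2 : ‖toPre q (gen q Gen.b * x)‖ ^ 2 = ((q : ℝ) * ‖toPre q (gen q Gen.c * x)‖) ^ 2 := by
      rw [mul_pow, norm_sq_A, norm_sq_A, h1, map_smul, smul_eq_mul, qc, ← Complex.ofReal_pow,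
        Complex.re_ofReal_mul]
    have h3 : ‖toPre q (gen q Gen.b * x)‖ = (q : ℝ) * ‖toPre q (gen q Gen.c * x)‖ :=
      (pow_left_inj₀ (norm_nonneg _) (mul_nonneg (q_pos q).le (norm_nonneg _)) two_ne_zero).1 h2
    rw [h3]
    exact mul_le_mul_of_nonneg_left (hc x) (q_pos q).le
  · exact ⟨1, fun x => by rw [one_mul]; exact hc x⟩
  · refine ⟨1, fun x => ?_⟩
    have h1 : star (gen q Gen.d * x) * (gen q Gen.d * x) =
        star x * x + (-(qc q ^ 2)) • (star (gen q Gen.c * x) * (gen q Gen.c * x)) := by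
      have h2 : star (gen q Gen.d * x) * (gen q Gen.d * x) =
          star x * (gen q Gen.a * gen q Gen.d) * x := by
        simp only [star_mul, star_d]; noncomm_ring
      rw [h2, R.ad]
      simp only [star_mul, star_c]
      simp only [mul_add, add_mul, mul_one, mul_smul_comm, smul_mul_assoc, mul_assoc, smul_smul]
      have := qc_ne q
      match_scalars <;> field_simp
    have h2 : ‖toPre q (gen q Gen.d * x)‖ ^ 2 = ‖toPre q x‖ ^ 2 - (q : ℝ) ^ 2 * ‖toPre q (gen q Gen.c * x)‖ ^ 2 := by
      rw [norm_sq_A, norm_sq_A, norm_sq_A, h1, map_add, map_smul, smul_eq_mul, qc,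
        ← Complex.ofReal_pow, ← Complex.ofReal_neg, Complex.add_re, Complex.re_ofReal_mul]
      ring
    rw [one_mul]
    exact abs_le_of_sq_le_sq' (by nlinarith [sq_nonneg ((q : ℝ) * ‖toPre q (gen q Gen.c * x)‖)])
      (norm_nonneg _) |>.2

theorem norm_mul_bound (q : Param) (y : A q) : ∃ C : ℝ, ∀ x : A q, ‖toPre q (y * x)‖ ≤ C * ‖toPre q x‖ := by
  induction y using A_induction q with
  | hs z =>
    exact ⟨‖z‖, fun x => by rw [← Algebra.smul_def, map_smul, norm_smul]⟩
  | hg g => exact norm_gen_le q g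
  | hadd y z hy hz =>
    obtain ⟨C, hC⟩ := hy
    obtain ⟨C', hC'⟩ := hz
    refine ⟨C + C', fun x => ?_⟩
    rw [add_mul, map_add, add_mul]
    exact (norm_add_le _ _).trans (add_le_add (hC x) (hC' x))
  | hmul y z hy hz =>
    obtain ⟨C, hC⟩ := hy
    obtain ⟨C', hC'⟩ := hz
    refine ⟨|C| * C', fun x => ?_⟩
    rw [mul_assoc, mul_assoc]
    refine (hC _).trans ((mul_le_mul_of_nonneg_right (le_abs_self C) (norm_nonneg _)).trans ?_)
    exact mul_le_mul_of_nonneg_left (hC' x) (abs_nonneg C)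

/-- Left multiplication as a continuous operator on the pre-Hilbert space. -/
def mulL (q : Param) (y : A q) : PreGNS q →L[ℂ] PreGNS q :=
  ((toPre q).toLinearMap ∘ₗ LinearMap.mulLeft ℂ y ∘ₗ
    (ofPre q).toLinearMap).mkContinuousOfExistsBound
      ((norm_mul_bound q y).imp fun _ hC x => hC (ofPre q x))

theorem mulL_apply (q : Param) (y x : A q) : mulL q y (toPre q x) = toPre q (y * x) := rfl

/-- The inclusion of `O(SU_q(2))` in the GNS space. -/
def inc (q : Param) : A q →ₗ[ℂ] Hh q :=
  (toHh q).toLinearMap ∘ₗ (toPre q).toLinearMap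

theorem inc_inner (q : Param) (x y : A q) :
    inner ℂ (inc q x) (inc q y) = haar q (star x * y) :=
  (toHh q).inner_map_map (toPre q x) (toPre q y)

theorem inc_dense (q : Param) : DenseRange (inc q) :=
  (toHh_dense q).comp (toPre q).surjective.denseRange (toHh q).continuous

theorem inc_injective (q : Param) : Function.Injective (inc q) :=
  (toHh q).injective.comp (toPre q).injective

theorem clm_ext (q : Param) {S T : Hh q →L[ℂ] Hh q}
    (h : ∀ x : A q, S (inc q x) = T (inc q x)) : S = T :=
  DFunLike.coe_injective ((inc_dense q).equalizer S.continuous T.continuous (funext h))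

/-- The continuous extension of left multiplication to the completion. -/
def extL (q : Param) (y : A q) : Hh q →L[ℂ] Hh q := (mulL q y).completion

theorem extL_inc (q : Param) (y x : A q) : extL q y (inc q x) = inc q (y * x) :=
  ContinuousLinearMap.completion_apply_coe (mulL q y) (toPre q x)

/-- The GNS representation of `O(SU_q(2))` by left multiplication. -/
def gns (q : Param) : A q →ₗ[ℂ] (Hh q →L[ℂ] Hh q) where
  toFun y := extL q y
  map_add' y z := by
    apply clm_ext
    intro x
    simp only [add_apply, extL_inc, add_mul, map_add]
  map_smul' z y := by
    apply clm_ext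
    intro x
    simp only [smul_apply, extL_inc, smul_mul_assoc, map_smul,
      RingHom.id_apply]

theorem gns_inc (q : Param) (y x : A q) : gns q y (inc q x) = inc q (y * x) :=
  extL_inc q y x

/-! ### Comultiplication, left action of the generators of the quantized enveloping algebra -/

open TensorProduct in
theorem comul_rels (q : Param) : Rels (qc q)
    (gen q Gen.a ⊗ₜ[ℂ] gen q Gen.a + gen q Gen.b ⊗ₜ[ℂ] gen q Gen.c)
    (gen q Gen.a ⊗ₜ[ℂ] gen q Gen.b + gen q Gen.b ⊗ₜ[ℂ] gen q Gen.d)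
    (gen q Gen.c ⊗ₜ[ℂ] gen q Gen.a + gen q Gen.d ⊗ₜ[ℂ] gen q Gen.c)
    (gen q Gen.c ⊗ₜ[ℂ] gen q Gen.b + gen q Gen.d ⊗ₜ[ℂ] gen q Gen.d) := by
  have R := gen_rels q
  have hs := qc_ne q
  have hdb := comm_flip hs R.bd
  have hdc := comm_flip hs R.cd
  constructor <;>
    simp only [add_mul, mul_add, Algebra.TensorProduct.tmul_mul_tmul, R.ab, R.ac, hdb, hdc, R.bc.symm,
      R.ad, R.da, tmul_smul, ← TensorProduct.smul_tmul', tmul_add, add_tmul, Algebra.TensorProduct.one_def,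
      smul_add, smul_smul] <;>
    match_scalars <;> (try field_simp)

open TensorProduct in
/-- The comultiplication: `a ↦ a ⊗ a + b ⊗ c`, `b ↦ a ⊗ b + b ⊗ d`, `c ↦ c ⊗ a + d ⊗ c`,
`d ↦ c ⊗ b + d ⊗ d`. -/
def comul (q : Param) : A q →ₐ[ℂ] A q ⊗[ℂ] A q := lift q (comul_rels q)

/-- The complex number `q ^ x`, for real `x`. -/
def qpow (q : Param) (x : ℝ) : ℂ := (((q : ℝ) ^ x : ℝ) : ℂ)

theorem qpow_add (q : Param) (x y : ℝ) : qpow q (x + y) = qpow q x * qpow q y := by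
  simp [qpow, Real.rpow_add (q_pos q)]
theorem qpow_zero (q : Param) : qpow q 0 = 1 := by simp [qpow]
theorem qpow_one (q : Param) : qpow q 1 = qc q := by simp [qpow, qc]

theorem pair_rels_e (q : Param) : Rels (qc q) (B := Matrix (Fin 2) (Fin 2) ℂ)
    !![qpow q (1 / 2), 0; 0, qpow q (-(1 / 2))] 0 !![0, 1; 0, 0]
    !![qpow q (-(1 / 2)), 0; 0, qpow q (1 / 2)] := by
  have h1 : qpow q 2⁻¹ * qpow q (-2⁻¹) = 1 := by rw [← qpow_add]; simp [qpow_zero]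
  have h2 : qpow q (-2⁻¹) * qpow q 2⁻¹ = 1 := by rw [mul_comm, h1]
  have h3 : qc q * qpow q (-2⁻¹) = qpow q 2⁻¹ := by
    rw [← qpow_one, ← qpow_add]; norm_num
  constructor <;> ext i j <;> fin_cases i <;> fin_cases j <;>
    simp [Matrix.mul_apply, Fin.sum_univ_two, h2, h3, h1]

theorem pair_rels_f (q : Param) : Rels (qc q) (B := Matrix (Fin 2) (Fin 2) ℂ)
    !![qpow q (1 / 2), 0; 0, qpow q (-(1 / 2))] !![0, 1; 0, 0] 0
    !![qpow q (-(1 / 2)), 0; 0, qpow q (1 / 2)] := by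
  have h1 : qpow q 2⁻¹ * qpow q (-2⁻¹) = 1 := by rw [← qpow_add]; simp [qpow_zero]
  have h2 : qpow q (-2⁻¹) * qpow q 2⁻¹ = 1 := by rw [mul_comm, h1]
  have h3 : qc q * qpow q (-2⁻¹) = qpow q 2⁻¹ := by
    rw [← qpow_one, ← qpow_add]; norm_num
  constructor <;> ext i j <;> fin_cases i <;> fin_cases j <;>
    simp [Matrix.mul_apply, Fin.sum_univ_two, h2, h3, h1]

/-- The matrix `[⟨k⁻¹, x⟩, ⟨e, x⟩; 0, ⟨k, x⟩]` of values of the dual pairing of the quantized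
enveloping algebra with `x`. It is multiplicative in `x` because `Δ(k) = k ⊗ k` and
`Δ(e) = e ⊗ k + k⁻¹ ⊗ e`; its values on the generators are `⟨k, a⟩ = q ^ (-1/2)`,
`⟨k, d⟩ = q ^ (1/2)`, `⟨e, c⟩ = 1` and zero otherwise. -/
def pairMatE (q : Param) : A q →ₐ[ℂ] Matrix (Fin 2) (Fin 2) ℂ := lift q (pair_rels_e q)

/-- The matrix `[⟨k⁻¹, x⟩, ⟨f, x⟩; 0, ⟨k, x⟩]`, multiplicative in `x` because
`Δ(f) = f ⊗ k + k⁻¹ ⊗ f`; here `⟨f, b⟩ = 1` and `⟨f, ·⟩` is zero on the other generators. -/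
def pairMatF (q : Param) : A q →ₐ[ℂ] Matrix (Fin 2) (Fin 2) ℂ := lift q (pair_rels_f q)

/-- The functional `⟨k, ·⟩`. -/
def pairK (q : Param) : A q →ₗ[ℂ] ℂ := Matrix.entryLinearMap ℂ ℂ (1 : Fin 2) (1 : Fin 2) ∘ₗ (pairMatE q).toLinearMap
/-- The functional `⟨e, ·⟩`. -/
def pairE (q : Param) : A q →ₗ[ℂ] ℂ := Matrix.entryLinearMap ℂ ℂ (0 : Fin 2) (1 : Fin 2) ∘ₗ (pairMatE q).toLinearMap
/-- The functional `⟨f, ·⟩`. -/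
def pairF (q : Param) : A q →ₗ[ℂ] ℂ := Matrix.entryLinearMap ℂ ℂ (0 : Fin 2) (1 : Fin 2) ∘ₗ (pairMatF q).toLinearMap

open TensorProduct in
/-- The left action `x ↦ ∑ x₍₁₎ ⟨g, x₍₂₎⟩` of a functional `⟨g, ·⟩`. -/
def leftAct (q : Param) (g : A q →ₗ[ℂ] ℂ) : A q →ₗ[ℂ] A q :=
  (TensorProduct.rid ℂ (A q)).toLinearMap ∘ₗ g.lTensor (A q) ∘ₗ (comul q).toLinearMap

/-- `∂_k = k ▷ ·`. -/
def dk (q : Param) : A q →ₗ[ℂ] A q := leftAct q (pairK q)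
/-- `∂_e = e ▷ ·`. -/
def de (q : Param) : A q →ₗ[ℂ] A q := leftAct q (pairE q)
/-- `∂_f = f ▷ ·`. -/
def df (q : Param) : A q →ₗ[ℂ] A q := leftAct q (pairF q)

/-! ### The left spectral subspaces and the diagonal operators -/

/-- The projection `Φ_n` of `O(SU_q(2))` on its part of degree `n`, for the grading (by the left
circle action) in which `a` and `c` have degree `-1`, while `b` and `d` have degree `1`. The
monomial with index `(k, m, r)` has degree `m - k - r`. -/
def Phi (q : Param) (n : ℤ) : A q →ₗ[ℂ] A q :=
  (ext3 fun k m r => if (m : ℤ) - k - r = n then mon q k m r else 0) ∘ₗ coord q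

theorem Phi_finite (q : Param) (x : A q) : (Function.support fun n => Phi q n x).Finite := by
  refine ((coord q x).support.image fun p : ℤ × ℕ × ℕ =>
    (p.2.1 : ℤ) - p.1 - p.2.2).finite_toSet.subset fun n hn => ?_
  by_contra h
  apply hn
  refine Finset.sum_eq_zero fun p hp => ?_
  change coord q x p • (if (p.2.1 : ℤ) - p.1 - p.2.2 = n then mon q p.1 p.2.1 p.2.2 else 0) = 0
  rw [if_neg, smul_zero]
  intro hpn
  exact h (Finset.mem_coe.2 (Finset.mem_image.2 ⟨p, hp, hpn⟩))

/-- The sum of a family of linear maps that is finite at every vector. -/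
def sumOp {E F : Type*} [AddCommGroup E] [Module ℂ E] [AddCommGroup F] [Module ℂ F]
    (L : ℤ → E →ₗ[ℂ] F) (hL : ∀ x, (Function.support fun n => L n x).Finite) : E →ₗ[ℂ] F where
  toFun x := ∑ᶠ n, L n x
  map_add' x y := by
    simp only [map_add]
    exact finsum_add_distrib (hL x) (hL y)
  map_smul' z x := by
    simp only [map_smul, RingHom.id_apply]
    exact (smul_finsum' z (hL x)).symm

/-- The operator `∑ w(n) Φ_n`. -/
def weightOp (q : Param) (w : ℤ → ℂ) : A q →ₗ[ℂ] A q :=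
  sumOp (fun n => w n • Phi q n) fun x =>
    (Phi_finite q x).subset fun n hn h => hn (by
      change w n • Phi q n x = 0
      rw [show Phi q n x = 0 from h, smul_zero])

/-- `∂_H`, which is `n / 2` on degree `n`. -/
def dH (q : Param) : A q →ₗ[ℂ] A q := weightOp q fun n => (n : ℂ) / 2

/-- The power `Δ_L ^ s` of the left modular operator: `q ^ (s n)` on degree `n`. -/
def DeltaL (q : Param) (s : ℝ) : A q →ₗ[ℂ] A q := weightOp q fun n => qpow q (s * n)

/-- The power `σ_L ^ s` of the left modular automorphism: `q ^ (-s n)` on degree `n`. -/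
def sigmaL (q : Param) (s : ℝ) : A q →ₗ[ℂ] A q := weightOp q fun n => qpow q (-s * n)

/-! ### The operator `D` on the algebraic direct sum -/

/-- `Ψ_n = diag(Φ_{n+1}, Φ_{n-1})`. -/
def Psi (q : Param) (n : ℤ) : A q × A q →ₗ[ℂ] A q × A q :=
  (Phi q (n + 1)).prodMap (Phi q (n - 1))

/-- The diagonal matrix `diag(z, w)` of scalars. -/
def scal (q : Param) (z w : ℂ) : A q × A q →ₗ[ℂ] A q × A q :=
  (z • LinearMap.id).prodMap (w • LinearMap.id)

theorem Psi_finite (q : Param) (v : A q × A q) :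
    (Function.support fun n : ℤ => (Psi q n ∘ₗ scal q n (-n)) v).Finite := by
  refine (((Phi_finite q v.1).preimage (f := fun n : ℤ => n + 1)
    (add_left_injective 1).injOn).union ((Phi_finite q v.2).preimage (f := fun n : ℤ => n - 1)
    (sub_left_injective).injOn)).subset fun n hn => ?_
  by_contra h
  simp only [Set.mem_union, Set.mem_preimage, Function.mem_support, not_or, not_not] at h
  apply hn
  simp only [LinearMap.comp_apply, Psi, scal, LinearMap.prodMap_apply, LinearMap.smul_apply,
    LinearMap.id_apply, map_smul, h.1, h.2, smul_zero]
  rfl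

/-- The diagonal part `(1/2) ∑ Ψ_n diag(n, -n)` of `D`. -/
def diagPart (q : Param) : A q × A q →ₗ[ℂ] A q × A q :=
  (1 / 2 : ℂ) • sumOp (fun n : ℤ => Psi q n ∘ₗ scal q n (-n)) (Psi_finite q)

/-- The power `s` of `diag(q⁻¹ Δ_L, q Δ_L)`. -/
def hatDelta (q : Param) (s : ℝ) : A q × A q →ₗ[ℂ] A q × A q :=
  (qpow q (-s) • DeltaL q s).prodMap (qpow q s • DeltaL q s)

/-- The matrix with off-diagonal entries `∂_e` (top right) and `∂_f` (bottom left). -/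
def offDiag (q : Param) : A q × A q →ₗ[ℂ] A q × A q :=
  (de q ∘ₗ LinearMap.snd ℂ (A q) (A q)).prod (df q ∘ₗ LinearMap.fst ℂ (A q) (A q))

/-- The operator `D` on the direct sum of two copies of `O(SU_q(2))`. -/
def preD (q : Param) : A q × A q →ₗ[ℂ] A q × A q :=
  diagPart q + hatDelta q (1 / 2) ∘ₗ offDiag q

/-! ### Unbounded operators on the Hilbert space -/

/-- The inclusion of `O(SU_q(2)) ⊕ O(SU_q(2))` in the Hilbert space. -/
def emb (q : Param) : A q × A q →ₗ[ℂ] H q :=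
  (WithLp.linearEquiv 2 ℂ (Hh q × Hh q)).symm.toLinearMap ∘ₗ (inc q).prodMap (inc q)

theorem emb_apply (q : Param) (v : A q × A q) :
    emb q v = WithLp.toLp 2 (inc q v.1, inc q v.2) := rfl

theorem emb_injective (q : Param) : Function.Injective (emb q) :=
  (WithLp.linearEquiv 2 ℂ (Hh q × Hh q)).symm.injective.comp
    ((inc_injective q).prodMap (inc_injective q))

/-- A linear operator on `O(SU_q(2)) ⊕ O(SU_q(2))` as an unbounded operator with this domain. -/
def toUnbounded (q : Param) (T : A q × A q →ₗ[ℂ] A q × A q) : H q →ₗ.[ℂ] H q where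
  domain := LinearMap.range (emb q)
  toFun := emb q ∘ₗ T ∘ₗ (LinearEquiv.ofInjective (emb q) (emb_injective q)).symm.toLinearMap

theorem toUnbounded_emb (q : Param) (T : A q × A q →ₗ[ℂ] A q × A q) (v : A q × A q) :
    toUnbounded q T ⟨emb q v, v, rfl⟩ = emb q (T v) := by
  change emb q (T ((LinearEquiv.ofInjective (emb q) (emb_injective q)).symm
    ((LinearEquiv.ofInjective (emb q) (emb_injective q)) v))) = _
  rw [LinearEquiv.symm_apply_apply]

/-- The Dirac operator `D`, with domain `O(SU_q(2)) ⊕ O(SU_q(2))`. -/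
def Dirac (q : Param) : H q →ₗ.[ℂ] H q := toUnbounded q (preD q)

/-- The operator `diag(q⁻¹ Δ_L, q Δ_L)`, with domain `O(SU_q(2)) ⊕ O(SU_q(2))`. -/
def hatDeltaL (q : Param) : H q →ₗ.[ℂ] H q := toUnbounded q (hatDelta q 1)

/-- A densely defined closable operator is essentially self-adjoint if its closure is
self-adjoint. -/
def IsEssentiallySelfAdjoint {E : Type*} [NormedAddCommGroup E] [InnerProductSpace ℂ E]
    [CompleteSpace E] (T : E →ₗ.[ℂ] E) : Prop :=
  Dense (T.domain : Set E) ∧ T.IsClosable ∧ IsSelfAdjoint T.closure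

/-- The commutator `T B - B T` of an unbounded and a bounded operator, with its natural domain:
all vectors `v` such that `v` and `B v` lie in the domain of `T`. -/
def commutator {E : Type*} [NormedAddCommGroup E] [InnerProductSpace ℂ E] (T : E →ₗ.[ℂ] E)
    (B : E →L[ℂ] E) : E →ₗ.[ℂ] E where
  domain := T.domain ⊓ T.domain.comap B.toLinearMap
  toFun := T.toFun ∘ₗ (B.toLinearMap.restrict (p := T.domain ⊓ T.domain.comap B.toLinearMap)
      (q := T.domain) fun _ hv => hv.2) -
    B.toLinearMap ∘ₗ T.toFun ∘ₗ Submodule.inclusion inf_le_left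

/-- A bounded operator on the direct sum, given as a `2 × 2` matrix of operators. -/
def block (q : Param) (X Y Z W : Hh q →L[ℂ] Hh q) : H q →L[ℂ] H q :=
  (WithLp.prodContinuousLinearEquiv 2 ℂ (Hh q) (Hh q)).symm.toContinuousLinearMap ∘L
    ((X ∘L ContinuousLinearMap.fst ℂ (Hh q) (Hh q) +
        Y ∘L ContinuousLinearMap.snd ℂ (Hh q) (Hh q)).prod
      (Z ∘L ContinuousLinearMap.fst ℂ (Hh q) (Hh q) +
        W ∘L ContinuousLinearMap.snd ℂ (Hh q) (Hh q))) ∘L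
    (WithLp.prodContinuousLinearEquiv 2 ℂ (Hh q) (Hh q)).toContinuousLinearMap

theorem block_toLp (q : Param) (X Y Z W : Hh q →L[ℂ] Hh q) (x y : Hh q) :
    block q X Y Z W (WithLp.toLp 2 (x, y)) = WithLp.toLp 2 (X x + Y y, Z x + W y) := rfl

theorem block_add (q : Param) (X Y Z W X' Y' Z' W' : Hh q →L[ℂ] Hh q) :
    block q (X + X') (Y + Y') (Z + Z') (W + W') = block q X Y Z W + block q X' Y' Z' W' := by
  ext v
  obtain ⟨x, y⟩ := v
  rw [add_apply]
  simp only [block_toLp, add_apply, ← WithLp.toLp_add, Prod.mk_add_mk]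
  congr 2 <;> abel

theorem block_smul (q : Param) (z : ℂ) (X Y Z W : Hh q →L[ℂ] Hh q) :
    block q (z • X) (z • Y) (z • Z) (z • W) = z • block q X Y Z W := by
  ext v
  obtain ⟨x, y⟩ := v
  rw [smul_apply]
  simp only [block_toLp, smul_apply, ← WithLp.toLp_smul, Prod.smul_mk, smul_add]

/-- The grading operator `diag(1, -1)`. -/
def Gam (q : Param) : H q →L[ℂ] H q := block q 1 0 0 (-1)

/-- The representation of `O(SU_q(2))` on the direct sum: the diagonal one. -/
def repH (q : Param) : A q →ₗ[ℂ] (H q →L[ℂ] H q) where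
  toFun α := block q (gns q α) 0 0 (gns q α)
  map_add' α β := by rw [← block_add, map_add, add_zero]
  map_smul' z α := by rw [map_smul, RingHom.id_apply, ← block_smul, smul_zero]

/-- The map `α ↦ ∂_H(α) Γ`. -/
def Stilde (q : Param) : A q →ₗ[ℂ] (H q →L[ℂ] H q) where
  toFun α := repH q (dH q α) ∘L Gam q
  map_add' α β := by rw [map_add, map_add, ContinuousLinearMap.add_comp]
  map_smul' z α := by rw [map_smul, map_smul, ContinuousLinearMap.smul_comp, RingHom.id_apply]

/-- The map sending `α` to the off-diagonal matrix with entries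
`q ^ (-1/2) ∂_e(σ_L ^ (-1/2) (α))` (top right) and `q ^ (1/2) ∂_f(σ_L ^ (-1/2) (α))`
(bottom left). -/
def Ttilde (q : Param) : A q →ₗ[ℂ] (H q →L[ℂ] H q) where
  toFun α := block q 0 (qpow q (-(1 / 2)) • gns q (de q (sigmaL q (-(1 / 2)) α)))
    (qpow q (1 / 2) • gns q (df q (sigmaL q (-(1 / 2)) α))) 0
  map_add' α β := by simp only [← block_add, map_add, add_zero, smul_add]
  map_smul' z α := by
    simp only [← block_smul, map_smul, smul_zero, RingHom.id_apply, smul_comm z]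

/-! ### The Peter-Weyl basis -/

/-- The `q`-factorial `[1]_q [2]_q ⋯ [n]_q`. -/
def qfact (q : Param) (n : ℕ) : ℝ := ∏ k ∈ Finset.range n, qnum q (k + 1)

/-- Normalization of `a ^ (n - p) * b ^ p` in the orthonormal weight basis of the irreducible
corepresentation of dimension `n + 1`. -/
def nrm (q : Param) (n p : ℕ) : ℝ :=
  (q : ℝ) ^ (-((p : ℝ) * (n - p)) / 2) * √(qfact q n / (qfact q p * qfact q (n - p)))

/-- The orthonormal weight basis `v_j = nrm(j) a ^ (n - j) b ^ j`, `j = 0, …, n`, of the irreducible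
corepresentation of dimension `n + 1`, realized inside `O(SU_q(2))` with the comultiplication as
coaction. -/
def wvec (q : Param) (n : ℕ) (j : Fin (n + 1)) : A q :=
  (nrm q n j : ℂ) • (gen q Gen.a ^ (n - j : ℕ) * gen q Gen.b ^ (j : ℕ))

/-- The functional extracting from an element the coefficient of the basis vector `v_i`. -/
def wcoeff (q : Param) (n : ℕ) (i : Fin (n + 1)) : A q →ₗ[ℂ] ℂ :=
  ((nrm q n i)⁻¹ : ℂ) •
    (Finsupp.lapply ((n : ℤ) - (i : ℤ), (i : ℕ), 0) ∘ₗ coord q : A q →ₗ[ℂ] ℂ)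

open TensorProduct in
/-- The matrix coefficients `t^l_{ij}` with `l = n / 2`, determined by `Δ(v_j) = ∑ v_i ⊗ t_{ij}`.
The position `i = 0, …, n` stands for the weight `i - l`. -/
def pw (q : Param) (n : ℕ) (i j : Fin (n + 1)) : A q :=
  TensorProduct.lid ℂ (A q) ((wcoeff q n i).rTensor (A q) (comul q (wvec q n j)))

/-! ### Eigenvectors and eigenvalues -/

/-- The numbers `λ_{l,n}`. -/
def lam (q : Param) (l n : ℝ) : ℝ :=
  √((n / 2) ^ 2 + (q : ℝ) ^ n * (qnum q (l + 1 / 2) ^ 2 - qnum q (n / 2) ^ 2))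

/-- The numbers `C^l_{j,±}`; the sign is the last argument. -/
def coefC (q : Param) (l j : ℝ) (ε : ℤˣ) : ℝ :=
  (((ε : ℤ) : ℝ) * lam q l (2 * j - 1) - (j - 1 / 2)) /
    ((q : ℝ) ^ (j - 1 / 2) * √(qnum q (l + 1 / 2) ^ 2 - qnum q (j - 1 / 2) ^ 2))

/-- Index set of the eigenbasis. Here `n = 2 l`. -/
inductive EigIdx : Type
  | low (n : ℕ) (i : Fin (n + 1))
  | up (n : ℕ) (i : Fin (n + 1))
  | mid (n : ℕ) (i : Fin (n + 1)) (j : Fin n) (ε : ℤˣ)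

/-- The weight `i - n / 2` of the basis vector at position `i`. -/
def weight (n : ℕ) (i : Fin (n + 1)) : ℝ := (i : ℝ) - n / 2

/-- The eigenvectors `(0, t_{i,l})`, `(t_{i,-l}, 0)` and `(t_{ij}, C_{j,±} t_{i,j-1})`, `j ≠ -l`. -/
def eigVec (q : Param) : EigIdx → A q × A q
  | EigIdx.low n i => (0, pw q n i (Fin.last n))
  | EigIdx.up n i => (pw q n i 0, 0)
  | EigIdx.mid n i j ε =>
    (pw q n i j.succ, (coefC q ((n : ℝ) / 2) (weight n j.succ) ε : ℂ) • pw q n i j.castSucc)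

/-- The eigenvalues `-(l + 1/2)`, `-(l + 1/2)` and `± λ_{l,2j-1}`. -/
def eigVal (q : Param) : EigIdx → ℝ
  | EigIdx.low n _ => -((n : ℝ) / 2 + 1 / 2)
  | EigIdx.up n _ => -((n : ℝ) / 2 + 1 / 2)
  | EigIdx.mid n _ j ε => ((ε : ℤ) : ℝ) * lam q ((n : ℝ) / 2) (2 * weight n j.succ - 1)

end QSU2

end

noncomputable section

namespace QSU2

/-! ### Essential self-adjointness from an orthogonal eigenbasis -/

/-! The operator splits into blocks of size at most two on matrix coefficients, and everything
follows from diagonalizing these blocks.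

Adjointness comes from invariance of the Haar state: `haar` vanishes on the range of `∂_f`
(`haar_df`), and with the twisted Leibniz rule and `df_star` this makes `∂_e` and `∂_f` adjoint to
each other (`haar_star_de`, `haar_star_df`). Both act on the second leg of the comultiplication,
hence on `t^l_{i,j}` as on the weight vector `v^l_j`. The normalization of `v^l_j` is such that both
move between neighbouring weights with the same real factor √([l-j][l+j+1]) (`de_pw`, `df_pw`).

The `t^l_{i,j}` are joint eigenvectors of three symmetric operators: a left scaling automorphism, a
right one, and `∂_f ∂_e`. The eigenvalues separate the indices, which gives `pw_orthogonal`. They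
span the algebra because there are at least as many of them as monomials in each step of the degree
filtration (`span_pw_eq_filt`).

On the span of `(t_{i,j}, 0)` and `(0, t_{i,j-1})` the operator is the matrix [[δ, ω], [ω, -δ]] with
δ = j - 1/2 and ω = q^δ √([l+1/2]² - [δ]²) (`preD_pair`). Its square is δ² + ω² = λ², so the
eigenvalues are ±λ with eigenvectors (1, (±λ - δ)/ω). The remaining vectors are extreme weights,
where the off-diagonal part vanishes and only the diagonal entry -(l + 1/2) is left. Hence the
domain contains an orthogonal basis of eigenvectors with real eigenvalues, and
`isEssentiallySelfAdjoint_of_orthogonal` applies.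

For the commutators, `Δ_L^{1/2}` is the algebra automorphism `kl`, and applying it untwists one side
of the Leibniz rule: `kl(∂_e(αy)) = α kl(∂_e y) + kl(∂_e α) kl²(y)`. The first term cancels in the
commutator and the second carries the factor `Δ_L = kl²` (`preD_commutator`). With α = a on `(0,
c^N)`, the first component is q^{-N} b c^N, while ‖c^N‖ is at most a constant times ‖b c^N‖; so the
commutator is unbounded. -/

/-- The adjoint multiplies the `i`-th coordinate by `c i`, even on vectors outside the domain of
`T`. As `c i` is real, the Parseval expansions of both sides agree term by term. -/
theorem adjoint_symmetric_of_hilbertBasis {E : Type*} [NormedAddCommGroup E]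
    [InnerProductSpace ℂ E] [CompleteSpace E] {T : E →ₗ.[ℂ] E} (hd : Dense (T.domain : Set E))
    {ι : Type*} (B : HilbertBasis ι ℂ E) (u : ι → T.domain) (hu : ∀ i, (u i : E) = B i) (c : ι → ℝ)
    (hT : ∀ i, T (u i) = (c i : ℂ) • (u i : E)) :
    T.adjoint.IsFormalAdjoint T.adjoint := by
  have key : ∀ (x : T.adjoint.domain) i,
      inner ℂ (T.adjoint x) (B i) = (c i : ℂ) * inner ℂ (x : E) (B i) := by
    intro x i
    rw [← hu i, LinearPMap.adjoint_isFormalAdjoint hd x (u i), hT, inner_smul_right]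
  intro x y
  have h1 := B.hasSum_inner_mul_inner (T.adjoint x) (y : E)
  have h2 := B.hasSum_inner_mul_inner (x : E) (T.adjoint y)
  refine h1.unique (h2.congr_fun fun i => ?_)
  rw [key, ← inner_conj_symm (B i) (T.adjoint y), key, map_mul, inner_conj_symm,
    Complex.conj_ofReal]
  ring

/-- The eigenvectors form a core: partial sums of the expansion of `x` lie in the domain of `T`, and
their images under `T` are the partial sums of the expansion of `T.adjoint x`. -/
theorem mem_closure_graph_of_hilbertBasis {E : Type*} [NormedAddCommGroup E]
    [InnerProductSpace ℂ E] [CompleteSpace E] {T : E →ₗ.[ℂ] E} (hd : Dense (T.domain : Set E))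
    {ι : Type*} (B : HilbertBasis ι ℂ E) (u : ι → T.domain) (hu : ∀ i, (u i : E) = B i) (c : ι → ℝ)
    (hT : ∀ i, T (u i) = (c i : ℂ) • (u i : E)) (x : T.adjoint.domain) :
    ((x : E), T.adjoint x) ∈ T.graph.topologicalClosure := by
  have key : ∀ i, inner ℂ (B i) (T.adjoint x) = (c i : ℂ) * inner ℂ (B i) (x : E) := by
    intro i
    have h := LinearPMap.adjoint_isFormalAdjoint hd x (u i)
    rw [hT, inner_smul_right, hu] at h
    rw [← inner_conj_symm, h, map_mul, inner_conj_symm, Complex.conj_ofReal]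
  have hsum : ∀ y : E, HasSum (fun i => inner ℂ (B i) y • B i) y := fun y =>
    (B.hasSum_repr y).congr_fun fun i => by rw [B.repr_apply_apply]
  refine mem_closure_of_tendsto ((hsum x).prodMk_nhds (hsum (T.adjoint x)))
    (Filter.Eventually.of_forall fun s => ?_)
  refine (LinearPMap.mem_graph_iff T).2 ⟨∑ i ∈ s, inner ℂ (B i) (x : E) • u i, ?_, ?_⟩
  · simp [hu]
  · rw [← LinearPMap.toFun_eq_coe, map_sum]
    refine Finset.sum_congr rfl fun i _ => ?_
    rw [map_smul, LinearPMap.toFun_eq_coe, hT, hu, smul_smul]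
    dsimp only
    rw [key, mul_comm]

/-- A symmetric operator whose domain contains an orthogonal basis of eigenvectors is essentially
self-adjoint. -/
theorem isEssentiallySelfAdjoint_of_orthogonal {E : Type*} [NormedAddCommGroup E]
    [InnerProductSpace ℂ E] [CompleteSpace E] {T : E →ₗ.[ℂ] E} (hs : T.IsFormalAdjoint T)
    {ι : Type*} (v : ι → T.domain) (c : ι → ℝ) (h0 : ∀ i, (v i : E) ≠ 0)
    (ho : ∀ i j, i ≠ j → inner ℂ (v i : E) (v j) = 0)
    (hT : ∀ i, T (v i) = (c i : ℂ) • (v i : E))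
    (hsp : (Submodule.span ℂ (Set.range fun i => (v i : E))).topologicalClosure = ⊤) :
    IsEssentiallySelfAdjoint T := by
  have hd : Dense (T.domain : Set E) := by
    have h1 : Dense ((Submodule.span ℂ (Set.range fun i => (v i : E)) : Submodule ℂ E) : Set E) :=
      Submodule.dense_iff_topologicalClosure_eq_top.2 hsp
    refine h1.mono (Submodule.span_le.2 ?_)
    rintro _ ⟨i, rfl⟩
    exact (v i).2
  -- Normalization is done inside the domain, so that `T` can still be applied to the resulting
  -- orthonormal basis.
  let u : ι → T.domain := fun i => ((‖(v i : E)‖ : ℂ)⁻¹) • v i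
  have hn : ∀ i, ((‖(v i : E)‖ : ℂ)⁻¹) ≠ 0 := fun i => by simpa using h0 i
  have hon : Orthonormal ℂ fun i => (u i : E) := by
    constructor
    · intro i
      simp only [u, Submodule.coe_smul, norm_smul, norm_inv, Complex.norm_real, norm_norm]
      exact inv_mul_cancel₀ (norm_ne_zero_iff.2 (h0 i))
    · intro i j hij
      simp only [u, Submodule.coe_smul, inner_smul_left, inner_smul_right, ho i j hij, mul_zero]
  have hspan : Submodule.span ℂ (Set.range fun i => (v i : E)) ≤
      Submodule.span ℂ (Set.range fun i => (u i : E)) := by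
    refine Submodule.span_le.2 ?_
    rintro _ ⟨i, rfl⟩
    have : (v i : E) = ((‖(v i : E)‖ : ℂ)) • (u i : E) := by
      simp only [u, Submodule.coe_smul, smul_smul]
      rw [mul_inv_cancel₀ (by simpa using h0 i), one_smul]
    dsimp only
    rw [this]
    exact Submodule.smul_mem _ _ (Submodule.subset_span ⟨i, rfl⟩)
  have hsp' : ⊤ ≤ (Submodule.span ℂ (Set.range fun i => (u i : E))).topologicalClosure := by
    rw [← hsp]
    exact Submodule.topologicalClosure_mono hspan
  let B := HilbertBasis.mk hon hsp'
  have hu : ∀ i, (u i : E) = B i := fun i => by simp [B]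
  have hTu : ∀ i, T (u i) = (c i : ℂ) • (u i : E) := fun i => by
    simp only [u, LinearPMap.map_smul, hT, Submodule.coe_smul, smul_comm (c i : ℂ)]
  have hle : T ≤ T.adjoint := hs.le_adjoint hd
  have hcl := LinearPMap.adjoint_isClosed (T := T) hd
  have hcb : T.IsClosable := hcl.isClosable.leIsClosable hle
  -- One inclusion holds because the adjoint is a closed extension of `T`, the other because the
  -- eigenvectors form a core for the adjoint.
  have hclosure : T.closure = T.adjoint := by
    refine le_antisymm ?_ ?_
    · refine LinearPMap.le_of_le_graph ?_
      rw [← hcb.graph_closure_eq_closure_graph]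
      exact Submodule.topologicalClosure_minimal _ (LinearPMap.le_graph_of_le hle) hcl
    · refine LinearPMap.le_of_le_graph ?_
      rw [← hcb.graph_closure_eq_closure_graph]
      rintro ⟨x, y⟩ hxy
      rw [LinearPMap.mem_graph_iff'] at hxy
      obtain ⟨z, hz⟩ := hxy
      rw [← hz]
      exact mem_closure_graph_of_hilbertBasis hd B u hu c hTu z
  refine ⟨hd, hcb, ?_⟩
  rw [hclosure, LinearPMap.isSelfAdjoint_def]
  have hd' : Dense (T.adjoint.domain : Set E) := hd.mono hle.1
  refine le_antisymm ?_ ((adjoint_symmetric_of_hilbertBasis hd B u hu c hTu).le_adjoint hd')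
  -- Taking adjoints reverses `T ≤ T.adjoint`, so the second adjoint lies below the first.
  refine LinearPMap.IsFormalAdjoint.le_adjoint hd fun x y => ?_
  have h1 := (LinearPMap.adjoint_isFormalAdjoint hd').symm ⟨x, hle.1 x.2⟩ y
  rw [← h1]
  congr 1
  exact hle.2 rfl

/-! ### The monomial basis -/

theorem psi_e (q : Param) (n : ℤ) (m r : ℕ) : psi q (e n m r) = mon q n m r := ext3_e _ n m r

/-- Linear independence of the monomials: `rep` separates coordinate vectors by `coord_eq_zero`, and
`psi` kills the difference of the two sides by `psi_coord`. -/
theorem coord_psi (q : Param) (v : M) : coord q (psi q v) = v := by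
  rw [← sub_eq_zero]
  apply coord_eq_zero q
  intro N
  rw [map_sub, psi_coord, sub_self, map_zero, LinearMap.zero_apply]

theorem coord_mon (q : Param) (n : ℤ) (m r : ℕ) : coord q (mon q n m r) = e n m r := by
  rw [← psi_e, coord_psi]

theorem linearMap_ext_mon (q : Param) {B : Type*} [AddCommGroup B] [Module ℂ B]
    {F G : A q →ₗ[ℂ] B} (h : ∀ n m r, F (mon q n m r) = G (mon q n m r)) : F = G := by
  have : F ∘ₗ psi q = G ∘ₗ psi q := M_ext fun n m r => by simp [psi_e, h]
  ext x
  rw [← psi_coord q x]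
  exact LinearMap.congr_fun this _

theorem algHom_ext_gen (q : Param) {B : Type*} [Ring B] [Algebra ℂ B] {F G : A q →ₐ[ℂ] B}
    (h : ∀ g, F (gen q g) = G (gen q g)) : F = G := by
  ext x
  induction x using A_induction q with
  | hs z => simp
  | hg g => exact h g
  | hadd x y hx hy => rw [map_add, map_add, hx, hy]
  | hmul x y hx hy => rw [map_mul, map_mul, hx, hy]

theorem haar_mon (q : Param) (n : ℤ) (m r : ℕ) : haar q (mon q n m r) =
    if n = 0 ∧ m = r then (-1 : ℂ) ^ r * ((qnum q (r + 1))⁻¹ : ℝ) else 0 := by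
  rw [haar, LinearMap.comp_apply, coord_mon, ext3_e]

/-! ### The two-sided circle action -/

theorem circ_rels (q : Param) (z w : ℂˣ) : Rels (qc q)
    (((z⁻¹ * w⁻¹ : ℂˣ) : ℂ) • gen q Gen.a) (((z * w⁻¹ : ℂˣ) : ℂ) • gen q Gen.b)
    (((z⁻¹ * w : ℂˣ) : ℂ) • gen q Gen.c) (((z * w : ℂˣ) : ℂ) • gen q Gen.d) := by
  have R := gen_rels q
  have hz := z.ne_zero
  have hw := w.ne_zero
  constructor <;>
    simp only [smul_mul_assoc, mul_smul_comm, R.ab, R.ac, R.bd, R.cd, R.bc, R.ad, R.da, smul_smul,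
      smul_add, Units.val_mul, Units.val_inv_eq_inv_val] <;>
    match_scalars <;> field_simp

/-- The automorphism that multiplies a monomial of left degree `L` and right degree `R` by
`z ^ L * w ^ R`; here `a, b, c, d` have bidegrees `(-1, -1), (1, -1), (-1, 1), (1, 1)`. -/
def circ (q : Param) (z w : ℂˣ) : A q →ₐ[ℂ] A q := lift q (circ_rels q z w)

theorem circ_a (q : Param) (z w : ℂˣ) :
    circ q z w (gen q Gen.a) = ((z⁻¹ * w⁻¹ : ℂˣ) : ℂ) • gen q Gen.a := lift_gen q _ _
theorem circ_b (q : Param) (z w : ℂˣ) :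
    circ q z w (gen q Gen.b) = ((z * w⁻¹ : ℂˣ) : ℂ) • gen q Gen.b := lift_gen q _ _
theorem circ_c (q : Param) (z w : ℂˣ) :
    circ q z w (gen q Gen.c) = ((z⁻¹ * w : ℂˣ) : ℂ) • gen q Gen.c := lift_gen q _ _
theorem circ_d (q : Param) (z w : ℂˣ) :
    circ q z w (gen q Gen.d) = ((z * w : ℂˣ) : ℂ) • gen q Gen.d := lift_gen q _ _

theorem circ_mon (q : Param) (z w : ℂˣ) (n : ℤ) (m r : ℕ) : circ q z w (mon q n m r) =
    ((z ^ ((m : ℤ) - n - r) * w ^ (-(m : ℤ) - n + r) : ℂˣ) : ℂ) • mon q n m r := by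
  have hz := z.ne_zero
  have hw := w.ne_zero
  rcases int_cases' n with ⟨k, rfl⟩ | ⟨k, rfl⟩
  · simp only [mon_pos, map_mul, map_pow, circ_a, circ_b, circ_c, smul_pow, smul_mul_assoc,
      mul_smul_comm, smul_smul]
    congr 1
    simp only [Units.val_mul, Units.val_inv_eq_inv_val, Units.val_zpow_eq_zpow_val, zpow_sub₀ hz,
      zpow_sub₀ hw, zpow_add₀ hw, zpow_neg, zpow_natCast, mul_pow, inv_pow]
    field_simp
  · simp only [mon_neg, map_mul, map_pow, circ_d, circ_b, circ_c, smul_pow, smul_mul_assoc,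
      mul_smul_comm, smul_smul]
    congr 1
    simp only [Units.val_mul, Units.val_inv_eq_inv_val, Units.val_zpow_eq_zpow_val, zpow_sub₀ hz,
      zpow_sub₀ hw, zpow_add₀ hw, zpow_neg, zpow_natCast, mul_pow, inv_pow]
    field_simp

/-- The monomials with non-zero Haar value, `n = 0` and `m = r`, are exactly those of bidegree (0,
0), on which `circ` is trivial. -/
theorem haar_circ (q : Param) (z w : ℂˣ) (x : A q) : haar q (circ q z w x) = haar q x := by
  have : haar q ∘ₗ (circ q z w).toLinearMap = haar q := by
    apply linearMap_ext_mon
    intro n m r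
    simp only [LinearMap.comp_apply, AlgHom.toLinearMap_apply, circ_mon, map_smul, haar_mon]
    by_cases h : n = 0 ∧ m = r
    · obtain ⟨rfl, rfl⟩ := h
      simp
    · simp [if_neg h]
  exact LinearMap.congr_fun this x

theorem circ_circ (q : Param) (z w z' w' : ℂˣ) (x : A q) :
    circ q z w (circ q z' w' x) = circ q (z * z') (w * w') x := by
  have : (circ q z w).comp (circ q z' w') = circ q (z * z') (w * w') := by
    apply algHom_ext_gen
    intro g
    cases g <;>
      simp only [AlgHom.comp_apply, circ_a, circ_b, circ_c, circ_d, map_smul, smul_smul,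
        ← Units.val_mul] <;> congr 2 <;> (try simp only [mul_inv]) <;> ac_rfl
  exact DFunLike.congr_fun this x

theorem circ_one (q : Param) (x : A q) : circ q 1 1 x = x := by
  have : circ q 1 1 = AlgHom.id ℂ (A q) := by
    apply algHom_ext_gen
    intro g
    cases g <;> simp [circ_a, circ_b, circ_c, circ_d]
  exact DFunLike.congr_fun this x

theorem star_circ (q : Param) (z w : ℂˣ) (x : A q) :
    star (circ q z w x) = circ q (star z)⁻¹ (star w)⁻¹ (star x) := by
  induction x using A_induction q with
  | hs u => simp [Algebra.algebraMap_eq_smul_one, star_smul]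
  | hg g =>
    cases g <;>
      simp only [circ_a, circ_b, circ_c, circ_d, star_smul, star_a, star_b, star_c, star_d,
        map_smul, smul_smul, ← Units.coe_star, star_mul, star_inv, inv_inv] <;>
      congr 1 <;> simp [mul_comm]
  | hadd x y hx hy => simp only [map_add, star_add, hx, hy]
  | hmul x y hx hy => simp only [map_mul, star_mul, hx, hy]

/-! ### The twisted derivations -/

/-- The unit `q ^ (1/2)`. -/
def qhalf (q : Param) : ℂˣ :=
  Units.mk0 (qpow q (1 / 2)) (by simpa [qpow] using (Real.rpow_pos_of_pos (q_pos q) _).ne')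

theorem qhalf_val (q : Param) : (qhalf q : ℂ) = qpow q (1 / 2) := rfl

theorem qhalf_inv_val (q : Param) : ((qhalf q)⁻¹ : ℂˣ) = qpow q (-(1 / 2)) := by
  rw [Units.val_inv_eq_inv_val, qhalf_val, qpow, qpow, Real.rpow_neg (q_pos q).le,
    Complex.ofReal_inv]

theorem qhalf_sq (q : Param) : (qhalf q : ℂ) ^ 2 = qc q := by
  rw [qhalf_val, pow_two, ← qpow_add, ← qpow_one]
  norm_num

theorem star_qhalf (q : Param) : star (qhalf q) = qhalf q := by
  ext
  rw [Units.coe_star, qhalf_val, qpow, Complex.star_def, Complex.conj_ofReal]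

/-- The algebra automorphism `k ▷ ·`. -/
abbrev kl (q : Param) : A q →ₐ[ℂ] A q := circ q (qhalf q) 1
/-- The inverse of `kl`. -/
abbrev klInv (q : Param) : A q →ₐ[ℂ] A q := circ q (qhalf q)⁻¹ 1

theorem kl_klInv (q : Param) (x : A q) : kl q (klInv q x) = x := by
  rw [circ_circ, mul_inv_cancel, mul_one, circ_one]

theorem star_kl (q : Param) (x : A q) : star (kl q x) = klInv q (star x) := by
  rw [star_circ, star_qhalf, star_one, inv_one]

theorem star_klInv (q : Param) (x : A q) : star (klInv q x) = kl q (star x) := by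
  rw [star_circ, star_inv, star_qhalf, star_one, inv_one, inv_inv]

/-- The matrix entries of a matrix representation of `O(SU_q(2))`. -/
def ent (q : Param) (P : A q →ₐ[ℂ] Matrix (Fin 2) (Fin 2) ℂ) (i j : Fin 2) : A q →ₗ[ℂ] ℂ :=
  Matrix.entryLinearMap ℂ ℂ i j ∘ₗ P.toLinearMap

theorem ent_apply (q : Param) (P : A q →ₐ[ℂ] Matrix (Fin 2) (Fin 2) ℂ) (i j : Fin 2) (x : A q) :
    ent q P i j x = P x i j := rfl

open TensorProduct in
/-- Evaluation of a functional on the second tensor factor. -/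
def evalR (q : Param) (g : A q →ₗ[ℂ] ℂ) : A q ⊗[ℂ] A q →ₗ[ℂ] A q :=
  (TensorProduct.rid ℂ (A q)).toLinearMap ∘ₗ g.lTensor (A q)

open TensorProduct in
theorem evalR_tmul (q : Param) (g : A q →ₗ[ℂ] ℂ) (x y : A q) :
    evalR q g (x ⊗ₜ y) = g y • x := by
  simp [evalR]

theorem leftAct_eq (q : Param) (g : A q →ₗ[ℂ] ℂ) (x : A q) :
    leftAct q g x = evalR q g (comul q x) := rfl

open TensorProduct in
-- Multiplicativity of the matrix `P` is the dual form of the coproduct formulas for `k`, `e`, `f`.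
-- Expanding the matrix product turns it into a Leibniz rule.
theorem evalR_mul (q : Param) (P : A q →ₐ[ℂ] Matrix (Fin 2) (Fin 2) ℂ) (i j : Fin 2)
    (X Y : A q ⊗[ℂ] A q) : evalR q (ent q P i j) (X * Y) =
      ∑ k, evalR q (ent q P i k) X * evalR q (ent q P k j) Y := by
  induction X with
  | zero => simp
  | add X X' h h' => simp only [add_mul, map_add, h, h', Finset.sum_add_distrib]
  | tmul x x' =>
    induction Y with
    | zero => simp
    | add Y Y' h h' => simp only [mul_add, map_add, h, h', Finset.sum_add_distrib]
    | tmul y y' =>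
      simp only [Algebra.TensorProduct.tmul_mul_tmul, evalR_tmul, ent_apply, map_mul,
        Matrix.mul_apply, Finset.sum_smul, smul_mul_smul_comm]

theorem leftAct_mul (q : Param) (P : A q →ₐ[ℂ] Matrix (Fin 2) (Fin 2) ℂ) (i j : Fin 2)
    (x y : A q) : leftAct q (ent q P i j) (x * y) =
      ∑ k, leftAct q (ent q P i k) x * leftAct q (ent q P k j) y := by
  simp only [leftAct_eq, map_mul, evalR_mul]

theorem leftAct_algebraMap (q : Param) (P : A q →ₐ[ℂ] Matrix (Fin 2) (Fin 2) ℂ) (i j : Fin 2)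
    (z : ℂ) : leftAct q (ent q P i j) (algebraMap ℂ (A q) z) =
      if i = j then algebraMap ℂ (A q) z else 0 := by
  rw [leftAct_eq, AlgHom.commutes, Algebra.algebraMap_eq_smul_one, map_smul,
    Algebra.TensorProduct.one_def, evalR_tmul, ent_apply, map_one, Matrix.one_apply]
  split_ifs <;> simp [Algebra.algebraMap_eq_smul_one]

/-! ### Values of the comultiplication, the pairings, `∂_e` and `∂_f` on the generators -/

section generators
open TensorProduct
variable (q : Param)

theorem comul_a : comul q (gen q Gen.a) =
    gen q Gen.a ⊗ₜ[ℂ] gen q Gen.a + gen q Gen.b ⊗ₜ[ℂ] gen q Gen.c := lift_gen q _ _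
theorem comul_b : comul q (gen q Gen.b) =
    gen q Gen.a ⊗ₜ[ℂ] gen q Gen.b + gen q Gen.b ⊗ₜ[ℂ] gen q Gen.d := lift_gen q _ _
theorem comul_c : comul q (gen q Gen.c) =
    gen q Gen.c ⊗ₜ[ℂ] gen q Gen.a + gen q Gen.d ⊗ₜ[ℂ] gen q Gen.c := lift_gen q _ _
theorem comul_d : comul q (gen q Gen.d) =
    gen q Gen.c ⊗ₜ[ℂ] gen q Gen.b + gen q Gen.d ⊗ₜ[ℂ] gen q Gen.d := lift_gen q _ _

theorem pairMatE_gen (g : Gen) : pairMatE q (gen q g) = genFun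
    !![qpow q (1 / 2), 0; 0, qpow q (-(1 / 2))] 0 !![0, 1; 0, 0]
    !![qpow q (-(1 / 2)), 0; 0, qpow q (1 / 2)] g := lift_gen q _ _
theorem pairMatF_gen (g : Gen) : pairMatF q (gen q g) = genFun
    !![qpow q (1 / 2), 0; 0, qpow q (-(1 / 2))] !![0, 1; 0, 0] 0
    !![qpow q (-(1 / 2)), 0; 0, qpow q (1 / 2)] g := lift_gen q _ _

theorem de_a : de q (gen q Gen.a) = gen q Gen.b := by
  change leftAct q (ent q (pairMatE q) 0 1) _ = _
  simp [leftAct_eq, comul_a, evalR_tmul, ent_apply, pairMatE_gen, genFun]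
theorem de_b : de q (gen q Gen.b) = 0 := by
  change leftAct q (ent q (pairMatE q) 0 1) _ = _
  simp [leftAct_eq, comul_b, evalR_tmul, ent_apply, pairMatE_gen, genFun]
theorem de_c : de q (gen q Gen.c) = gen q Gen.d := by
  change leftAct q (ent q (pairMatE q) 0 1) _ = _
  simp [leftAct_eq, comul_c, evalR_tmul, ent_apply, pairMatE_gen, genFun]
theorem de_d : de q (gen q Gen.d) = 0 := by
  change leftAct q (ent q (pairMatE q) 0 1) _ = _
  simp [leftAct_eq, comul_d, evalR_tmul, ent_apply, pairMatE_gen, genFun]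
theorem df_a : df q (gen q Gen.a) = 0 := by
  change leftAct q (ent q (pairMatF q) 0 1) _ = _
  simp [leftAct_eq, comul_a, evalR_tmul, ent_apply, pairMatF_gen, genFun]
theorem df_b : df q (gen q Gen.b) = gen q Gen.a := by
  change leftAct q (ent q (pairMatF q) 0 1) _ = _
  simp [leftAct_eq, comul_b, evalR_tmul, ent_apply, pairMatF_gen, genFun]
theorem df_c : df q (gen q Gen.c) = 0 := by
  change leftAct q (ent q (pairMatF q) 0 1) _ = _
  simp [leftAct_eq, comul_c, evalR_tmul, ent_apply, pairMatF_gen, genFun]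
theorem df_d : df q (gen q Gen.d) = gen q Gen.c := by
  change leftAct q (ent q (pairMatF q) 0 1) _ = _
  simp [leftAct_eq, comul_d, evalR_tmul, ent_apply, pairMatF_gen, genFun]

theorem de_algebraMap (z : ℂ) : de q (algebraMap ℂ (A q) z) = 0 :=
  (leftAct_algebraMap q (pairMatE q) 0 1 z).trans (if_neg (by decide))
theorem df_algebraMap (z : ℂ) : df q (algebraMap ℂ (A q) z) = 0 :=
  (leftAct_algebraMap q (pairMatF q) 0 1 z).trans (if_neg (by decide))

end generators

/-- The three entries are treated together because the product formula mixes them: the matrix of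
actions stays upper triangular only once the lower left entry is known to vanish. -/
theorem leftAct_ent_E (q : Param) (x : A q) :
    leftAct q (ent q (pairMatE q) 1 0) x = 0 ∧ leftAct q (ent q (pairMatE q) 0 0) x = klInv q x ∧
      leftAct q (ent q (pairMatE q) 1 1) x = kl q x := by
  induction x using A_induction q with
  | hs z => simp [leftAct_algebraMap]
  | hg g =>
    cases g <;>
      simp [leftAct_eq, comul_a, comul_b, comul_c, comul_d, evalR_tmul, ent_apply, pairMatE_gen,
        genFun, kl, klInv, circ_a, circ_b, circ_c, circ_d, ← qhalf_inv_val, ← qhalf_val, -one_div]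
  | hadd x y hx hy => simp only [map_add, hx, hy, add_zero, and_self]
  | hmul x y hx hy =>
    simp only [leftAct_mul, Fin.sum_univ_two, hx, hy, zero_mul, mul_zero, add_zero, zero_add,
      map_mul, and_self]

theorem leftAct_ent_F (q : Param) (x : A q) :
    leftAct q (ent q (pairMatF q) 1 0) x = 0 ∧ leftAct q (ent q (pairMatF q) 0 0) x = klInv q x ∧
      leftAct q (ent q (pairMatF q) 1 1) x = kl q x := by
  induction x using A_induction q with
  | hs z => simp [leftAct_algebraMap]
  | hg g =>
    cases g <;>
      simp [leftAct_eq, comul_a, comul_b, comul_c, comul_d, evalR_tmul, ent_apply, pairMatF_gen,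
        genFun, kl, klInv, circ_a, circ_b, circ_c, circ_d, ← qhalf_inv_val, ← qhalf_val, -one_div]
  | hadd x y hx hy => simp only [map_add, hx, hy, add_zero, and_self]
  | hmul x y hx hy =>
    simp only [leftAct_mul, Fin.sum_univ_two, hx, hy, zero_mul, mul_zero, add_zero, zero_add,
      map_mul, and_self]

/-- The upper right entry of a product of two upper triangular matrices with diagonal `klInv`, `kl`.
-/
theorem de_mul (q : Param) (x y : A q) :
    de q (x * y) = klInv q x * de q y + de q x * kl q y := by
  change leftAct q (ent q (pairMatE q) 0 1) _ = _
  rw [leftAct_mul, Fin.sum_univ_two, (leftAct_ent_E q x).2.1, (leftAct_ent_E q y).2.2]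
  rfl

theorem df_mul (q : Param) (x y : A q) :
    df q (x * y) = klInv q x * df q y + df q x * kl q y := by
  change leftAct q (ent q (pairMatF q) 0 1) _ = _
  rw [leftAct_mul, Fin.sum_univ_two, (leftAct_ent_F q x).2.1, (leftAct_ent_F q y).2.2]
  rfl

/-- `∂_e` raises the left degree by 2 and keeps the right degree, as is visible from a ↦ b and c ↦
d. -/
theorem circ_de (q : Param) (z w : ℂˣ) (x : A q) :
    circ q z w (de q x) = ((z ^ 2 : ℂˣ) : ℂ) • de q (circ q z w x) := by
  induction x using A_induction q with
  | hs u => simp [de_algebraMap]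
  | hg g =>
    have hz := z.ne_zero
    cases g <;> simp [circ_a, circ_b, circ_c, circ_d, de_a, de_b, de_c, de_d, smul_smul] <;>
      congr 1 <;> field_simp
  | hadd x y hx hy => simp only [map_add, hx, hy, smul_add]
  | hmul x y hx hy =>
    simp only [map_mul, de_mul, map_add, hx, hy, smul_add, mul_smul_comm, smul_mul_assoc,
      circ_circ, mul_comm z, mul_one, one_mul]

theorem circ_df (q : Param) (z w : ℂˣ) (x : A q) :
    circ q z w (df q x) = ((z ^ (-2 : ℤ) : ℂˣ) : ℂ) • df q (circ q z w x) := by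
  induction x using A_induction q with
  | hs u => simp [df_algebraMap]
  | hg g =>
    have hz := z.ne_zero
    cases g <;> simp [circ_a, circ_b, circ_c, circ_d, df_a, df_b, df_c, df_d, smul_smul] <;>
      congr 1 <;> field_simp
  | hadd x y hx hy => simp only [map_add, hx, hy, smul_add]
  | hmul x y hx hy =>
    simp only [map_mul, df_mul, map_add, hx, hy, smul_add, mul_smul_comm, smul_mul_assoc,
      circ_circ, mul_comm z, mul_one, one_mul]

/-- The involution reverses products and exchanges `kl` with `klInv`, so it carries the twisted
Leibniz rule of `∂_e` to that of `∂_f`. Hence only generators have to be checked. -/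
theorem df_star (q : Param) (x : A q) : df q (star x) = (-(qc q)⁻¹) • star (de q x) := by
  induction x using A_induction q with
  | hs u => simp [Algebra.algebraMap_eq_smul_one, star_smul,
      (by simpa using de_algebraMap q 1 : de q 1 = 0),
      (by simpa using df_algebraMap q 1 : df q 1 = 0)]
  | hg g =>
    have hs := qc_ne q
    cases g <;>
      simp [star_a, star_b, star_c, star_d, de_a, de_b, de_c, de_d, df_a, df_b, df_c, df_d,
        smul_smul, hs]
  | hadd x y hx hy => simp only [map_add, star_add, hx, hy, smul_add]
  | hmul x y hx hy =>
    simp only [star_mul, df_mul, de_mul, star_add, star_kl, star_klInv, hx, hy, smul_add,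
      mul_smul_comm, smul_mul_assoc]
    abel

/-! ### `q`-numbers -/

theorem qinv_sub_pos (q : Param) : 0 < (q : ℝ)⁻¹ - q := by
  have h1 := one_lt_inv_iff₀.2 ⟨q_pos q, q_lt q⟩
  have h2 := q_lt q
  linarith

theorem qnum_add_one (q : Param) (x : ℝ) :
    qnum q (x + 1) = (q : ℝ) ^ (-x) + q * qnum q x := by
  have h := (one_sub_pow_pos q two_ne_zero).ne'
  have hq := (q_pos q).ne'
  rw [qnum, qnum, neg_add, Real.rpow_add (q_pos q), Real.rpow_add (q_pos q), Real.rpow_neg_one,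
    Real.rpow_one]
  field_simp
  ring

theorem qnum_add_one' (q : Param) (x : ℝ) :
    qnum q (x + 1) = (q : ℝ) ^ x + (q : ℝ)⁻¹ * qnum q x := by
  have h := (one_sub_pow_pos q two_ne_zero).ne'
  have hq := (q_pos q).ne'
  rw [qnum, qnum, neg_add, Real.rpow_add (q_pos q), Real.rpow_add (q_pos q), Real.rpow_neg_one,
    Real.rpow_one]
  field_simp
  ring

theorem qnum_zero (q : Param) : qnum q 0 = 0 := by simp [qnum]

theorem qnum_one (q : Param) : qnum q 1 = 1 := by
  have h := qnum_add_one q 0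
  simpa [qnum_zero] using h

theorem qnum_strictMono (q : Param) : StrictMono (qnum q) := by
  intro x y hxy
  rw [qnum, qnum]
  refine div_lt_div_of_pos_right ?_ (qinv_sub_pos q)
  have h1 := Real.rpow_lt_rpow_of_exponent_gt (q_pos q) (q_lt q) hxy
  have h2 := Real.rpow_lt_rpow_of_exponent_gt (q_pos q) (q_lt q) (neg_lt_neg hxy)
  linarith

theorem qnum_pos (q : Param) {x : ℝ} (hx : 0 < x) : 0 < qnum q x := by
  rw [← qnum_zero q]
  exact qnum_strictMono q hx

theorem qnum_nonneg (q : Param) {x : ℝ} (hx : 0 ≤ x) : 0 ≤ qnum q x := by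
  rw [← qnum_zero q]
  exact (qnum_strictMono q).monotone hx

/-- The `q`-analogue of xy = ((x+y)/2)² - ((x-y)/2)². It puts the eigenvalues of `∂_f ∂_e` in the
form that occurs in `lam`, with a first square depending only on `l` and a second only on the
weight. -/
theorem qnum_mul (q : Param) (x y : ℝ) :
    qnum q x * qnum q y = qnum q ((x + y) / 2) ^ 2 - qnum q ((x - y) / 2) ^ 2 := by
  have h := (qinv_sub_pos q).ne'
  obtain ⟨u, hu⟩ : ∃ u, u = x / 2 := ⟨_, rfl⟩
  obtain ⟨v, hv⟩ : ∃ v, v = y / 2 := ⟨_, rfl⟩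
  have hx : x = u + u := by linarith
  have hy : y = v + v := by linarith
  have e1 : (x + y) / 2 = u + v := by linarith
  have e2 : (x - y) / 2 = u - v := by linarith
  have hU := (Real.rpow_pos_of_pos (q_pos q) u).ne'
  have hV := (Real.rpow_pos_of_pos (q_pos q) v).ne'
  rw [e1, e2, hx, hy]
  simp only [qnum, Real.rpow_neg (q_pos q).le, Real.rpow_add (q_pos q), Real.rpow_sub (q_pos q)]
  field_simp
  ring

theorem qnum_nat_succ (q : Param) (n : ℕ) :
    ((qnum q (n + 1 : ℕ) : ℝ) : ℂ) = (qc q ^ n)⁻¹ + qc q * (qnum q n : ℝ) := by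
  push_cast
  rw [qnum_add_one, Real.rpow_neg (q_pos q).le, Real.rpow_natCast]
  push_cast
  rfl

theorem qnum_nat_succ' (q : Param) (n : ℕ) :
    ((qnum q (n + 1 : ℕ) : ℝ) : ℂ) = qc q ^ n + (qc q)⁻¹ * (qnum q n : ℝ) := by
  push_cast
  rw [qnum_add_one', Real.rpow_natCast]
  push_cast
  rfl

/-! ### Derivatives of monomials -/

section monomials
variable (q : Param)

theorem kl_b_pow (s : ℕ) : kl q (gen q Gen.b ^ s) = (qhalf q : ℂ) ^ s • gen q Gen.b ^ s := by
  simp [circ_b, smul_pow]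
theorem kl_c_pow (s : ℕ) : kl q (gen q Gen.c ^ s) = ((qhalf q : ℂ)⁻¹) ^ s • gen q Gen.c ^ s := by
  simp [circ_c, smul_pow]
theorem klInv_a_pow (s : ℕ) : klInv q (gen q Gen.a ^ s) = (qhalf q : ℂ) ^ s • gen q Gen.a ^ s := by
  simp [circ_a, smul_pow]
theorem klInv_b_pow (s : ℕ) :
    klInv q (gen q Gen.b ^ s) = ((qhalf q : ℂ)⁻¹) ^ s • gen q Gen.b ^ s := by
  simp [circ_b, smul_pow]
theorem klInv_c_pow (s : ℕ) : klInv q (gen q Gen.c ^ s) = (qhalf q : ℂ) ^ s • gen q Gen.c ^ s := by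
  simp [circ_c, smul_pow]

theorem df_one : df q 1 = 0 := by simpa using df_algebraMap q 1
theorem de_one : de q 1 = 0 := by simpa using de_algebraMap q 1

theorem df_pow_eq_zero {x : A q} (hx : df q x = 0) (s : ℕ) : df q (x ^ s) = 0 := by
  induction s with
  | zero => rw [pow_zero, df_one]
  | succ s ih => rw [pow_succ, df_mul, hx, ih, mul_zero, zero_mul, add_zero]
theorem de_pow_eq_zero {x : A q} (hx : de q x = 0) (s : ℕ) : de q (x ^ s) = 0 := by
  induction s with
  | zero => rw [pow_zero, de_one]
  | succ s ih => rw [pow_succ, de_mul, hx, ih, mul_zero, zero_mul, add_zero]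

theorem df_b_pow (m : ℕ) : df q (gen q Gen.b ^ (m + 1)) =
    (((qhalf q : ℂ)⁻¹) ^ m * (qnum q (m + 1 : ℕ) : ℝ)) • (gen q Gen.a * gen q Gen.b ^ m) := by
  have hh := (qhalf q).ne_zero
  have hs := qc_ne q
  induction m with
  | zero => simp [df_b, qnum_one]
  | succ m ih =>
    have h1 := comm_pow (gen_rels q).ab (m + 1)
    have h2 := comm_flip (pow_ne_zero _ hs) h1
    rw [pow_succ, df_mul, ih, df_b, klInv_b_pow, smul_mul_assoc, h2,
      qnum_nat_succ q (m + 1), circ_b]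
    simp only [smul_mul_assoc, mul_smul_comm, smul_smul, mul_assoc, ← pow_succ, ← add_smul]
    congr 1
    simp only [inv_one, mul_one, ← qhalf_sq, inv_pow]
    field_simp
    ring

theorem de_a_pow (m : ℕ) : de q (gen q Gen.a ^ (m + 1)) =
    (((qhalf q : ℂ)⁻¹) ^ m * (qnum q (m + 1 : ℕ) : ℝ)) • (gen q Gen.a ^ m * gen q Gen.b) := by
  have hh := (qhalf q).ne_zero
  have hs := qc_ne q
  induction m with
  | zero => simp [de_a, qnum_one]
  | succ m ih =>
    have h2 := comm_flip hs (gen_rels q).ab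
    rw [pow_succ, de_mul, ih, de_a, klInv_a_pow, smul_mul_assoc,
      qnum_nat_succ' q (m + 1), circ_a]
    simp only [smul_mul_assoc, mul_smul_comm, smul_smul, mul_assoc, h2]
    simp only [← mul_assoc, ← pow_succ, ← add_smul]
    congr 1
    simp only [inv_one, mul_one, ← qhalf_sq, Units.val_inv_eq_inv_val, inv_pow]
    field_simp
    ring

theorem de_ab (s p : ℕ) : de q (gen q Gen.a ^ (s + 1) * gen q Gen.b ^ p) =
    (((qhalf q : ℂ)⁻¹) ^ s * (qhalf q : ℂ) ^ p * (qnum q (s + 1 : ℕ) : ℝ)) •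
      (gen q Gen.a ^ s * gen q Gen.b ^ (p + 1)) := by
  rw [de_mul, de_pow_eq_zero q (de_b q), mul_zero, zero_add, de_a_pow, kl_b_pow, smul_mul_assoc,
    mul_smul_comm, smul_smul, mul_assoc (gen q Gen.a ^ s), ← pow_succ']
  congr 1
  ring

theorem df_ab (s p : ℕ) : df q (gen q Gen.a ^ s * gen q Gen.b ^ (p + 1)) =
    ((qhalf q : ℂ) ^ s * ((qhalf q : ℂ)⁻¹) ^ p * (qnum q (p + 1 : ℕ) : ℝ)) •
      (gen q Gen.a ^ (s + 1) * gen q Gen.b ^ p) := by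
  rw [df_mul, df_pow_eq_zero q (df_a q), zero_mul, add_zero, df_b_pow, klInv_a_pow, smul_mul_assoc,
    mul_smul_comm, smul_smul, ← mul_assoc (gen q Gen.a ^ s), ← pow_succ]
  congr 1
  ring

/-- These are the only monomials that `∂_f` sends to bidegree (0, 0), where the Haar state can be
non-zero. -/
theorem df_bcd (r : ℕ) :
    df q (gen q Gen.b ^ (r + 1) * gen q Gen.c ^ r * gen q Gen.d) =
      ((qhalf q : ℂ) * qc q ^ r * (qnum q (r + 1 : ℕ) : ℝ)) • mon q 0 r r +
      ((qhalf q : ℂ) * qc q ^ (r + 1) * (qnum q (r + 1 : ℕ) : ℝ) + (qhalf q : ℂ)⁻¹) •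
        mon q 0 (r + 1) (r + 1) := by
  have hh := (qhalf q).ne_zero
  have R := gen_rels q
  have hbc : Commute (gen q Gen.b) (gen q Gen.c) := R.bc
  have hm : ∀ r, mon q 0 r r = gen q Gen.b ^ r * gen q Gen.c ^ r := fun r => by simp [mon]
  have h1 : df q (gen q Gen.c ^ r * gen q Gen.d) = (qhalf q : ℂ) ^ r • gen q Gen.c ^ (r + 1) := by
    rw [df_mul, df_pow_eq_zero q (df_c q), zero_mul, add_zero, df_d, klInv_c_pow, smul_mul_assoc,
      pow_succ]
  -- Moving `a` past `b ^ r * c ^ r` costs q^{2r}; then ad = 1 + q bc produces the two monomials.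
  have h2 : gen q Gen.a * (gen q Gen.b ^ r * gen q Gen.c ^ r) * gen q Gen.d =
      qc q ^ (2 * r) • mon q 0 r r + (qc q ^ (2 * r) * qc q) • mon q 0 (r + 1) (r + 1) := by
    rw [comm2 R.ab R.ac, smul_mul_assoc, mul_assoc _ (gen q Gen.a), R.ad, mul_add, mul_one,
      mul_smul_comm, smul_add, smul_smul, ← two_mul, hm, hm, pow_succ, pow_succ,
      mul_assoc (gen q Gen.b ^ r), ← mul_assoc (gen q Gen.c ^ r), ← (hbc.pow_right r).eq]
    simp only [mul_assoc]
  have h3 : df q (gen q Gen.b ^ (r + 1)) * kl q (gen q Gen.c ^ r * gen q Gen.d) =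
      (((qhalf q : ℂ)⁻¹) ^ r * (qnum q (r + 1 : ℕ) : ℝ) * (((qhalf q : ℂ)⁻¹) ^ r * qhalf q)) •
        (gen q Gen.a * (gen q Gen.b ^ r * gen q Gen.c ^ r) * gen q Gen.d) := by
    rw [df_b_pow, map_mul, kl_c_pow, circ_d]
    simp only [smul_mul_assoc, mul_smul_comm, smul_smul, mul_assoc, mul_one]
    congr 1
    ring
  rw [mul_assoc, df_mul, h1, h3, klInv_b_pow, smul_mul_smul_comm, ← hm, h2]
  simp only [smul_add, smul_smul]
  rw [add_comm, add_assoc, ← add_smul]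
  simp only [← qhalf_sq, inv_pow]
  congr 2
  · field_simp
    ring
  · field_simp
    ring

/-- The Haar values 1/[r+1] and 1/[r+2] enter with opposite signs. They cancel by the recursion
[r+2] = q^{-(r+1)} + q [r+1]. -/
theorem haar_df_bcd (r : ℕ) :
    haar q (df q (gen q Gen.b ^ (r + 1) * gen q Gen.c ^ r * gen q Gen.d)) = 0 := by
  have hh := (qhalf q).ne_zero
  have hs := qc_ne q
  have e1 : ((qnum q ((r : ℝ) + 1) : ℝ) : ℂ) ≠ 0 := by
    exact_mod_cast (qnum_pos q (by positivity)).ne'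
  have e2 : ((qnum q ((r : ℝ) + 1 + 1) : ℝ) : ℂ) ≠ 0 := by
    exact_mod_cast (qnum_pos q (by positivity)).ne'
  have h := qnum_nat_succ q (r + 1)
  push_cast at h
  rw [df_bcd, map_add, map_smul, map_smul, haar_mon, haar_mon, if_pos ⟨rfl, rfl⟩,
    if_pos ⟨rfl, rfl⟩]
  push_cast
  have h' : qc q * ((qnum q ((r : ℝ) + 1) : ℝ) : ℂ) =
    ((qnum q ((r : ℝ) + 1 + 1) : ℝ) : ℂ) - (qc q ^ (r + 1))⁻¹ := by rw [h]; ring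
  rw [smul_eq_mul, smul_eq_mul]
  have hq2 := qhalf_sq q
  field_simp
  rw [pow_succ (-1 : ℂ), hq2]
  have h3 : qc q ^ (r + 1) * (qnum q ((r : ℝ) + 1 + 1) : ℝ) = 1 +
      qc q ^ (r + 1) * (qc q * (qnum q ((r : ℝ) + 1) : ℝ)) := by
    rw [h']; field_simp; ring
  linear_combination (-1) ^ r * h3

end monomials

/-! ### Invariance of the Haar state -/

/-- The unit `2` of `ℂ`, a scalar all of whose non-trivial powers differ from `1`. -/
def unitTwo : ℂˣ := Units.mk0 2 two_ne_zero

theorem unitTwo_zpow_injective {m n : ℤ} (h : ((unitTwo ^ m : ℂˣ) : ℂ) = (unitTwo ^ n : ℂˣ)) :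
    m = n := by
  rw [Units.val_zpow_eq_zpow_val, Units.val_zpow_eq_zpow_val] at h
  have h2 : ((2 : ℝ) ^ m) = (2 : ℝ) ^ n := by
    have h1 : (((2 : ℝ) ^ m : ℝ) : ℂ) = ((2 : ℝ) ^ n : ℝ) := by
      push_cast
      exact h
    exact_mod_cast h1
  exact zpow_right_injective₀ (by norm_num) (by norm_num) h2

theorem star_unitTwo : star unitTwo = unitTwo := by
  ext
  simp [unitTwo]

theorem haar_df (q : Param) (x : A q) : haar q (df q x) = 0 := by
  have : haar q ∘ₗ df q = 0 := by
    apply linearMap_ext_mon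
    intro n m r
    rw [LinearMap.comp_apply, LinearMap.zero_apply]
    by_cases hmn : n = -((1 : ℕ) : ℤ) ∧ m = r + 1
    · obtain ⟨rfl, rfl⟩ := hmn
      rw [mon_neg, pow_one, haar_df_bcd]
    -- A non-zero Haar value forces the bidegree of the argument to vanish, by invariance under
    -- `circ`. Since `∂_f` shifts the left degree by -2, this leaves only the case treated above.
    · by_contra h0
      have key : ∀ z w : ℂˣ,
          ((z ^ (-2 + ((m : ℤ) - n - r)) * w ^ (-(m : ℤ) - n + r) : ℂˣ) : ℂ) = 1 := by
        intro z w
        have h := haar_circ q z w (df q (mon q n m r))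
        rw [circ_df, circ_mon, map_smul, map_smul, map_smul, smul_smul, smul_eq_mul] at h
        rw [zpow_add, mul_assoc, Units.val_mul]
        exact mul_right_cancel₀ h0 (h.trans (one_mul _).symm)
      have h1 := key unitTwo 1
      have h2 := key 1 unitTwo
      rw [one_zpow, mul_one] at h1
      rw [one_zpow, one_mul] at h2
      have e1 := unitTwo_zpow_injective (n := 0) (by simpa using h1)
      have e2 := unitTwo_zpow_injective (n := 0) (by simpa using h2)
      omega
  exact LinearMap.congr_fun this x

/-- `∂_e` and `∂_f` are adjoint to each other. -/
theorem haar_star_de (q : Param) (x y : A q) :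
    haar q (star (de q x) * y) = haar q (star x * df q y) := by
  -- The Leibniz rule for `star x * z` puts `kl z` next to `∂_f (star x)`, so `y` is written in this
  -- form.
  obtain ⟨z, rfl⟩ : ∃ z, kl q z = y := ⟨_, kl_klInv q y⟩
  have hs := qc_ne q
  have h := haar_df q (star x * z)
  rw [df_mul, df_star, map_add, smul_mul_assoc, map_smul, smul_eq_mul] at h
  -- Invariance of the Haar state moves `kl` to the other factor. Commuting it past `∂_f` gives q⁻¹,
  -- the same factor as in `df_star`.
  have h1 : haar q (klInv q (star x) * df q z) = (qc q)⁻¹ * haar q (star x * df q (kl q z)) := by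
    rw [← haar_circ q (qhalf q) 1, map_mul, kl_klInv, circ_df, mul_smul_comm, map_smul, smul_eq_mul,
      ← qhalf_sq, zpow_neg, Units.val_inv_eq_inv_val, Units.val_zpow_eq_zpow_val]
    norm_cast
  rw [h1] at h
  have h2 : (qc q)⁻¹ * (haar q (star x * df q (kl q z)) - haar q (star (de q x) * kl q z)) = 0 := by
    rw [← h]; ring
  exact (sub_eq_zero.1 ((mul_eq_zero_iff_left (inv_ne_zero hs)).1 h2)).symm

theorem haar_star_df (q : Param) (x y : A q) :
    haar q (star (df q x) * y) = haar q (star x * de q y) := by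
  rw [← haar_conj q (df q x) y, ← haar_star_de, haar_conj]

/-- With real parameters `circ` is a symmetric operator, since the involution inverts it and the
Haar state is invariant. This is why a real scalar is used below to detect degrees. -/
theorem haar_star_circ (q : Param) (z w : ℂˣ) (hz : star z = z) (hw : star w = w) (x y : A q) :
    haar q (star (circ q z w x) * y) = haar q (star x * circ q z w y) := by
  rw [star_circ, hz, hw, ← haar_circ q z w, map_mul, circ_circ, mul_inv_cancel, mul_inv_cancel,
    circ_one]

/-! ### Matrix coefficients -/

section coefficients
open TensorProduct
variable (q : Param)

/-- Evaluation of a functional on the first tensor factor. -/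
def evalL (φ : A q →ₗ[ℂ] ℂ) : A q ⊗[ℂ] A q →ₗ[ℂ] A q :=
  (TensorProduct.lid ℂ (A q)).toLinearMap ∘ₗ φ.rTensor (A q)

theorem evalL_tmul (φ : A q →ₗ[ℂ] ℂ) (x y : A q) : evalL q φ (x ⊗ₜ y) = φ x • y := by
  simp [evalL]

/-- The map `x ↦ ∑ φ(x₍₁₎) x₍₂₎`. -/
def pwMap (φ : A q →ₗ[ℂ] ℂ) : A q →ₗ[ℂ] A q := evalL q φ ∘ₗ (comul q).toLinearMap

theorem pwMap_apply (φ : A q →ₗ[ℂ] ℂ) (x : A q) : pwMap q φ x = evalL q φ (comul q x) := rfl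

theorem pw_eq (n : ℕ) (i j : Fin (n + 1)) : pw q n i j = pwMap q (wcoeff q n i) (wvec q n j) := rfl

theorem evalL_lTensor (φ : A q →ₗ[ℂ] ℂ) (T : A q →ₗ[ℂ] A q) (X : A q ⊗[ℂ] A q) :
    evalL q φ (T.lTensor (A q) X) = T (evalL q φ X) := by
  induction X with
  | zero => simp
  | add X Y h h' => simp only [map_add, h, h']
  | tmul x y => rw [LinearMap.lTensor_tmul, evalL_tmul, evalL_tmul, map_smul]

theorem comul_circ_left (z : ℂˣ) (x : A q) :
    comul q (circ q z 1 x) = (circ q z 1).toLinearMap.lTensor (A q) (comul q x) := by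
  have : (comul q).comp (circ q z 1) =
      (Algebra.TensorProduct.map (AlgHom.id ℂ (A q)) (circ q z 1)).comp (comul q) := by
    apply algHom_ext_gen
    intro g
    cases g <;>
      simp only [AlgHom.comp_apply, circ_a, circ_b, circ_c, circ_d, comul_a, comul_b, comul_c,
        comul_d, map_smul, map_add, Algebra.TensorProduct.map_tmul, AlgHom.id_apply, tmul_smul,
        smul_add, inv_one, mul_one]
  exact DFunLike.congr_fun this x

/-- In every term of the comultiplication the right degree of the second leg equals the left degree
of the first, the two being the contracted index. So right scaling of the output is absorbed into
the functional. -/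
theorem circ_right_evalL (w : ℂˣ) (φ : A q →ₗ[ℂ] ℂ) (x : A q) :
    circ q 1 w (pwMap q φ x) = pwMap q (φ ∘ₗ (circ q w 1).toLinearMap) x := by
  have h1 : (Algebra.TensorProduct.map (AlgHom.id ℂ (A q)) (circ q 1 w)).comp (comul q) =
      (Algebra.TensorProduct.map (circ q w 1) (AlgHom.id ℂ (A q))).comp (comul q) := by
    apply algHom_ext_gen
    intro g
    cases g <;>
      simp only [AlgHom.comp_apply, circ_a, circ_b, circ_c, circ_d, comul_a, comul_b, comul_c,
        comul_d, map_add, Algebra.TensorProduct.map_tmul, AlgHom.id_apply, tmul_smul,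
        ← smul_tmul', inv_one, one_mul, mul_one]
  have h2 : ∀ X : A q ⊗[ℂ] A q, evalL q (φ ∘ₗ (circ q w 1).toLinearMap) X =
      evalL q φ (Algebra.TensorProduct.map (circ q w 1) (AlgHom.id ℂ (A q)) X) := by
    intro X
    induction X with
    | zero => simp
    | add X Y h h' => simp only [map_add, h, h']
    | tmul x y => rw [Algebra.TensorProduct.map_tmul, evalL_tmul, evalL_tmul]; rfl
  have h3 := evalL_lTensor q φ (circ q 1 w).toLinearMap (comul q x)
  rw [pwMap_apply, pwMap_apply, h2, ← AlgHom.comp_apply, ← h1]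
  exact h3.symm

theorem lTensor_twisted {T S S' : A q →ₗ[ℂ] A q}
    (h : ∀ x y, T (x * y) = S x * T y + T x * S' y) (X Y : A q ⊗[ℂ] A q) :
    T.lTensor (A q) (X * Y) = S.lTensor (A q) X * T.lTensor (A q) Y +
      T.lTensor (A q) X * S'.lTensor (A q) Y := by
  induction X with
  | zero => simp
  | add X X' h h' => simp only [add_mul, map_add, h, h']; abel
  | tmul x x' =>
    induction Y with
    | zero => simp
    | add Y Y' h h' => simp only [mul_add, map_add, h, h']; abel
    | tmul y y' =>
      simp only [Algebra.TensorProduct.tmul_mul_tmul, LinearMap.lTensor_tmul, h, tmul_add]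

/-- An instance of coassociativity. It is checked on generators and extended to products by the
twisted Leibniz rule. -/
theorem comul_de (x : A q) : comul q (de q x) = (de q).lTensor (A q) (comul q x) := by
  induction x using A_induction q with
  | hs z =>
    rw [de_algebraMap, AlgHom.commutes, Algebra.algebraMap_eq_smul_one,
      Algebra.TensorProduct.one_def, map_smul, LinearMap.lTensor_tmul, de_one, tmul_zero, smul_zero,
      map_zero]
  | hg g => cases g <;> simp [de_a, de_b, de_c, de_d, comul_a, comul_b, comul_c, comul_d]
  | hadd x y hx hy => simp only [map_add, hx, hy]
  | hmul x y hx hy =>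
    rw [de_mul, map_add, map_mul, map_mul, map_mul, hx, hy, comul_circ_left, comul_circ_left,
      lTensor_twisted q (S := (klInv q).toLinearMap) (S' := (kl q).toLinearMap) (de_mul q)]

theorem comul_df (x : A q) : comul q (df q x) = (df q).lTensor (A q) (comul q x) := by
  induction x using A_induction q with
  | hs z =>
    rw [df_algebraMap, AlgHom.commutes, Algebra.algebraMap_eq_smul_one,
      Algebra.TensorProduct.one_def, map_smul, LinearMap.lTensor_tmul, df_one, tmul_zero, smul_zero,
      map_zero]
  | hg g => cases g <;> simp [df_a, df_b, df_c, df_d, comul_a, comul_b, comul_c, comul_d]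
  | hadd x y hx hy => simp only [map_add, hx, hy]
  | hmul x y hx hy =>
    rw [df_mul, map_add, map_mul, map_mul, map_mul, hx, hy, comul_circ_left, comul_circ_left,
      lTensor_twisted q (S := (klInv q).toLinearMap) (S' := (kl q).toLinearMap) (df_mul q)]

theorem de_pwMap (φ : A q →ₗ[ℂ] ℂ) (x : A q) : de q (pwMap q φ x) = pwMap q φ (de q x) := by
  rw [pwMap_apply, pwMap_apply, comul_de, evalL_lTensor]
theorem df_pwMap (φ : A q →ₗ[ℂ] ℂ) (x : A q) : df q (pwMap q φ x) = pwMap q φ (df q x) := by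
  rw [pwMap_apply, pwMap_apply, comul_df, evalL_lTensor]
theorem circ_left_pwMap (z : ℂˣ) (φ : A q →ₗ[ℂ] ℂ) (x : A q) :
    circ q z 1 (pwMap q φ x) = pwMap q φ (circ q z 1 x) := by
  rw [pwMap_apply, pwMap_apply, comul_circ_left, evalL_lTensor]; rfl

/-! ### The counit, as a test for non-vanishing of matrix coefficients -/

theorem counit_rels : Rels (qc q) (B := ℂ) 1 0 0 1 := by
  constructor <;> simp

/-- The counit. -/
def counit : A q →ₐ[ℂ] ℂ := lift q (counit_rels q)

theorem counit_pwMap (φ : A q →ₗ[ℂ] ℂ) (x : A q) : counit q (pwMap q φ x) = φ x := by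
  have h1 : ((Algebra.TensorProduct.rid ℂ ℂ (A q)).toAlgHom.comp
      (Algebra.TensorProduct.map (AlgHom.id ℂ (A q)) (counit q))).comp (comul q) =
      AlgHom.id ℂ (A q) := by
    apply algHom_ext_gen
    intro g
    have ha : counit q (gen q Gen.a) = 1 := lift_gen q _ _
    have hb : counit q (gen q Gen.b) = 0 := lift_gen q _ _
    have hc : counit q (gen q Gen.c) = 0 := lift_gen q _ _
    have hd : counit q (gen q Gen.d) = 1 := lift_gen q _ _
    cases g <;> simp [comul_a, comul_b, comul_c, comul_d, ha, hb, hc, hd]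
  have h2 : ∀ X : A q ⊗[ℂ] A q, counit q (evalL q φ X) =
      φ (((Algebra.TensorProduct.rid ℂ ℂ (A q)).toAlgHom.comp
        (Algebra.TensorProduct.map (AlgHom.id ℂ (A q)) (counit q))) X) := by
    intro X
    induction X with
    | zero => simp
    | add X Y h h' => simp only [map_add, h, h']
    | tmul x y => simp [evalL_tmul, mul_comm]
  rw [pwMap_apply, h2, ← AlgHom.comp_apply, h1, AlgHom.id_apply]

end coefficients

/-! ### The weight basis -/

theorem qfact_pos (q : Param) (n : ℕ) : 0 < qfact q n :=
  Finset.prod_pos fun k _ => qnum_pos q (by positivity)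

theorem qfact_succ (q : Param) (n : ℕ) : qfact q (n + 1) = qfact q n * qnum q (n + 1) :=
  Finset.prod_range_succ _ _

theorem nrm_pos (q : Param) (n p : ℕ) : 0 < nrm q n p := by
  have h1 := qfact_pos q n
  have h2 := qfact_pos q p
  have h3 := qfact_pos q (n - p)
  have h4 := q_pos q
  unfold nrm
  positivity

/-- The coefficients of `∂_e` and `∂_f` in the weight basis. -/
def ladder (q : Param) (n p : ℕ) : ℝ := √(qnum q ((n : ℝ) - p) * qnum q (p + 1))

theorem ladder_pos (q : Param) {n p : ℕ} (h : p < n) : 0 < ladder q n p := by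
  have h' : (p : ℝ) < n := by exact_mod_cast h
  exact Real.sqrt_pos.2 (mul_pos (qnum_pos q (by linarith)) (qnum_pos q (by positivity)))

theorem ladder_sq (q : Param) {n p : ℕ} (h : p < n) :
    ladder q n p ^ 2 = qnum q ((n : ℝ) - p) * qnum q (p + 1) := by
  have h' : (p : ℝ) < n := by exact_mod_cast h
  exact Real.sq_sqrt (mul_pos (qnum_pos q (by linarith)) (qnum_pos q (by positivity))).le

theorem qhalf_pow (q : Param) (s : ℕ) : (qhalf q : ℂ) ^ s = (((q : ℝ) ^ ((s : ℝ) / 2) : ℝ) : ℂ) := by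
  rw [qhalf_val, qpow, ← Complex.ofReal_pow, ← Real.rpow_natCast, ← Real.rpow_mul (q_pos q).le]
  congr 2
  ring

theorem qhalf_inv_pow (q : Param) (s : ℕ) :
    ((qhalf q : ℂ)⁻¹) ^ s = (((q : ℝ) ^ (-(s : ℝ) / 2) : ℝ) : ℂ) := by
  rw [inv_pow, qhalf_pow, ← Complex.ofReal_inv, ← Real.rpow_neg (q_pos q).le]
  congr 2
  ring

/-! ### Ratios of neighbouring normalization constants -/

section nrm
variable (q : Param) (p s : ℕ)

/-- Here and in `nrm_right` a common square root is split off, so that neighbouring constants differ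
only by a power of `q` and the square root of a single `q`-number. -/
theorem nrm_left : nrm q (p + s + 1) p =
    (q : ℝ) ^ (-((p : ℝ) * (s + 1)) / 2) *
      (√(qfact q (p + s + 1) / (qfact q p * qfact q s)) / √(qnum q (s + 1))) := by
  have h : p + s + 1 - p = s + 1 := by omega
  rw [nrm, h, qfact_succ q s, ← mul_assoc, ← div_div, Real.sqrt_div' _ (qnum_pos q (by positivity)).le]
  push_cast
  ring_nf

theorem nrm_right : nrm q (p + s + 1) (p + 1) =
    (q : ℝ) ^ (-(((p : ℝ) + 1) * s) / 2) *
      (√(qfact q (p + s + 1) / (qfact q p * qfact q s)) / √(qnum q (p + 1))) := by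
  have h : p + s + 1 - (p + 1) = s := by omega
  rw [nrm, h, qfact_succ q p, mul_right_comm, ← div_div,
    Real.sqrt_div' _ (qnum_pos q (by positivity)).le]
  push_cast
  ring_nf

theorem ladder_eq : ladder q (p + s + 1) p = √(qnum q (s + 1)) * √(qnum q (p + 1)) := by
  rw [← Real.sqrt_mul (qnum_nonneg q (by positivity)), ladder]
  push_cast
  congr 3
  ring

/-- Together with `nrm_lower` this is what the normalization of the weight vectors achieves: raising
and lowering get the same coefficient. -/
theorem nrm_raise : nrm q (p + s + 1) p *
    ((q : ℝ) ^ (-(s : ℝ) / 2) * (q : ℝ) ^ ((p : ℝ) / 2) * qnum q (s + 1 : ℕ)) =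
      ladder q (p + s + 1) p * nrm q (p + s + 1) (p + 1) := by
  have h1 : 0 < qnum q ((s : ℝ) + 1) := qnum_pos q (by positivity)
  have h2 : 0 < qnum q ((p : ℝ) + 1) := qnum_pos q (by positivity)
  have e1 : (q : ℝ) ^ (-((p : ℝ) * (s + 1)) / 2) * (q : ℝ) ^ (-(s : ℝ) / 2) *
      (q : ℝ) ^ ((p : ℝ) / 2) = (q : ℝ) ^ (-(((p : ℝ) + 1) * s) / 2) := by
    rw [← Real.rpow_add (q_pos q), ← Real.rpow_add (q_pos q)]
    congr 1
    ring
  rw [nrm_left, nrm_right, ladder_eq, ← e1]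
  push_cast
  have h3 := Real.sqrt_pos.2 h1
  have h4 := Real.sqrt_pos.2 h2
  have h5 := Real.sq_sqrt h1.le
  field_simp
  rw [h5]
  ring

theorem nrm_lower : nrm q (p + s + 1) (p + 1) *
    ((q : ℝ) ^ ((s : ℝ) / 2) * (q : ℝ) ^ (-(p : ℝ) / 2) * qnum q (p + 1 : ℕ)) =
      ladder q (p + s + 1) p * nrm q (p + s + 1) p := by
  have h1 : 0 < qnum q ((s : ℝ) + 1) := qnum_pos q (by positivity)
  have h2 : 0 < qnum q ((p : ℝ) + 1) := qnum_pos q (by positivity)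
  have e1 : (q : ℝ) ^ (-(((p : ℝ) + 1) * s) / 2) * (q : ℝ) ^ ((s : ℝ) / 2) *
      (q : ℝ) ^ (-(p : ℝ) / 2) = (q : ℝ) ^ (-((p : ℝ) * (s + 1)) / 2) := by
    rw [← Real.rpow_add (q_pos q), ← Real.rpow_add (q_pos q)]
    congr 1
    ring
  rw [nrm_left, nrm_right, ladder_eq, ← e1]
  push_cast
  have h3 := Real.sqrt_pos.2 h1
  have h4 := Real.sqrt_pos.2 h2
  have h5 := Real.sq_sqrt h2.le
  field_simp
  rw [h5]
  ring

end nrm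

theorem de_wvec (q : Param) (n : ℕ) (j : Fin n) :
    de q (wvec q n j.castSucc) = (ladder q n j : ℂ) • wvec q n j.succ := by
  obtain ⟨p, hp⟩ := j
  obtain ⟨s, rfl⟩ : ∃ s, n = p + s + 1 := ⟨n - p - 1, by omega⟩
  have h1 : p + s + 1 - p = s + 1 := by omega
  have h2 : p + s + 1 - (p + 1) = s := by omega
  simp only [wvec, Fin.castSucc_mk, Fin.succ_mk, h1, h2, map_smul, de_ab, smul_smul]
  congr 1
  rw [qhalf_pow, qhalf_inv_pow]
  exact_mod_cast nrm_raise q p s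

theorem df_wvec (q : Param) (n : ℕ) (j : Fin n) :
    df q (wvec q n j.succ) = (ladder q n j : ℂ) • wvec q n j.castSucc := by
  obtain ⟨p, hp⟩ := j
  obtain ⟨s, rfl⟩ : ∃ s, n = p + s + 1 := ⟨n - p - 1, by omega⟩
  have h1 : p + s + 1 - p = s + 1 := by omega
  have h2 : p + s + 1 - (p + 1) = s := by omega
  simp only [wvec, Fin.castSucc_mk, Fin.succ_mk, h1, h2, map_smul, df_ab, smul_smul]
  congr 1
  rw [qhalf_pow, qhalf_inv_pow]
  exact_mod_cast nrm_lower q p s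

theorem de_wvec_last (q : Param) (n : ℕ) : de q (wvec q n (Fin.last n)) = 0 := by
  simp [wvec, de_pow_eq_zero q (de_b q)]

theorem df_wvec_zero (q : Param) (n : ℕ) : df q (wvec q n 0) = 0 := by
  simp [wvec, df_pow_eq_zero q (df_a q)]

theorem wvec_eq_mon (q : Param) (n : ℕ) (j : Fin (n + 1)) :
    wvec q n j = (nrm q n j : ℂ) • mon q ((n - j : ℕ) : ℤ) j 0 := by
  rw [mon_pos, pow_zero, mul_one, wvec]

theorem circ_wvec (q : Param) (z : ℂˣ) (n : ℕ) (j : Fin (n + 1)) :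
    circ q z 1 (wvec q n j) = ((z ^ (2 * (j : ℤ) - n) : ℂˣ) : ℂ) • wvec q n j := by
  have hj := j.is_le
  rw [wvec_eq_mon, map_smul, circ_mon, one_zpow, mul_one, smul_comm]
  congr 3
  push_cast [hj]
  ring

theorem wcoeff_mon (q : Param) (n : ℕ) (i : Fin (n + 1)) (k : ℤ) (m r : ℕ) :
    wcoeff q n i (mon q k m r) =
      if k = (n : ℤ) - i ∧ m = i ∧ r = 0 then ((nrm q n i)⁻¹ : ℂ) else 0 := by
  rw [wcoeff, LinearMap.smul_apply, LinearMap.comp_apply, coord_mon, Finsupp.lapply_apply, e,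
    Finsupp.single_apply]
  simp [Prod.ext_iff]

/-- The functional reads off the single monomial `a ^ (n - i) * b ^ i`, whose left degree is `2 i -
n`. Through `circ_right_evalL` this becomes the right degree of `pw q n i j`. -/
theorem wcoeff_circ (q : Param) (w : ℂˣ) (n : ℕ) (i : Fin (n + 1)) :
    wcoeff q n i ∘ₗ (circ q w 1).toLinearMap =
      ((w ^ (2 * (i : ℤ) - n) : ℂˣ) : ℂ) • wcoeff q n i := by
  apply linearMap_ext_mon
  intro k m r
  simp only [LinearMap.comp_apply, AlgHom.toLinearMap_apply, circ_mon, map_smul,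
    LinearMap.smul_apply, wcoeff_mon]
  by_cases h : k = (n : ℤ) - i ∧ m = i ∧ r = 0
  · obtain ⟨rfl, rfl, rfl⟩ := h
    rw [one_zpow, mul_one]
    congr 3
    push_cast
    ring
  · rw [if_neg h, smul_zero, smul_zero]

theorem wcoeff_wvec (q : Param) (n : ℕ) (i : Fin (n + 1)) : wcoeff q n i (wvec q n i) = 1 := by
  have hi := i.is_le
  rw [wvec_eq_mon, map_smul, wcoeff_mon, if_pos ⟨by omega, rfl, rfl⟩, smul_eq_mul, mul_inv_cancel₀]
  exact_mod_cast (nrm_pos q n i).ne'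

/-! ### The Peter-Weyl basis -/

section pw
variable (q : Param) (n : ℕ) (i : Fin (n + 1))

theorem de_pw (j : Fin n) :
    de q (pw q n i j.castSucc) = (ladder q n j : ℂ) • pw q n i j.succ := by
  rw [pw_eq, de_pwMap, de_wvec, map_smul, ← pw_eq]
theorem df_pw (j : Fin n) :
    df q (pw q n i j.succ) = (ladder q n j : ℂ) • pw q n i j.castSucc := by
  rw [pw_eq, df_pwMap, df_wvec, map_smul, ← pw_eq]
theorem de_pw_last : de q (pw q n i (Fin.last n)) = 0 := by
  rw [pw_eq, de_pwMap, de_wvec_last, map_zero]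
theorem df_pw_zero : df q (pw q n i 0) = 0 := by
  rw [pw_eq, df_pwMap, df_wvec_zero, map_zero]
theorem circ_left_pw (z : ℂˣ) (j : Fin (n + 1)) :
    circ q z 1 (pw q n i j) = ((z ^ (2 * (j : ℤ) - n) : ℂˣ) : ℂ) • pw q n i j := by
  rw [pw_eq, circ_left_pwMap, circ_wvec, map_smul]
theorem circ_right_pw (w : ℂˣ) (j : Fin (n + 1)) :
    circ q 1 w (pw q n i j) = ((w ^ (2 * (i : ℤ) - n) : ℂˣ) : ℂ) • pw q n i j := by
  have h : ∀ (z : ℂ) (φ : A q →ₗ[ℂ] ℂ) (x : A q), pwMap q (z • φ) x = z • pwMap q φ x := by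
    intro z φ x
    simp [pwMap, evalL, LinearMap.rTensor_smul]
  rw [pw_eq, circ_right_evalL, wcoeff_circ, h]

/-- This operator plays the role of the Casimir element: at fixed weight its eigenvalues tell
different `n` apart. At the last position both sides vanish, since [n - n] = 0. -/
theorem df_de_pw (j : Fin (n + 1)) : df q (de q (pw q n i j)) =
    ((qnum q ((n : ℝ) - j) * qnum q ((j : ℝ) + 1) : ℝ) : ℂ) • pw q n i j := by
  induction j using Fin.lastCases with
  | last => simp [de_pw_last, qnum_zero]
  | cast j =>
    rw [de_pw, map_smul, df_pw, smul_smul, ← Complex.ofReal_mul, ← pow_two, ladder_sq q j.2]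
    rfl

/-- `∂_e` and `∂_f` are mutually adjoint and link the two vectors with the same non-zero real
coefficient, so the norms coincide. -/
theorem pw_norm_step (j : Fin n) :
    haar q (star (pw q n i j.succ) * pw q n i j.succ) =
      haar q (star (pw q n i j.castSucc) * pw q n i j.castSucc) := by
  have h := haar_star_de q (pw q n i j.castSucc) (pw q n i j.succ)
  have hl : (ladder q n j : ℂ) ≠ 0 := by exact_mod_cast (ladder_pos q j.2).ne'
  rw [de_pw, df_pw, star_smul, smul_mul_assoc, mul_smul_comm, map_smul, map_smul, Complex.star_def,
    Complex.conj_ofReal] at h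
  exact smul_right_injective _ hl h

theorem pw_norm_eq (j j' : Fin (n + 1)) :
    haar q (star (pw q n i j) * pw q n i j) = haar q (star (pw q n i j') * pw q n i j') := by
  have : ∀ j : Fin (n + 1), haar q (star (pw q n i j) * pw q n i j) =
      haar q (star (pw q n i 0) * pw q n i 0) := by
    intro j
    induction j using Fin.induction with
    | zero => rfl
    | succ j ih => rw [pw_norm_step, ih]
  rw [this j, this j']

/-- The norm does not depend on the second index, so it suffices to look at the diagonal entry, on
which the counit is 1. -/
theorem pw_ne_zero (j : Fin (n + 1)) : pw q n i j ≠ 0 := by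
  intro h
  have h1 := pw_norm_eq q n i i j
  rw [h, mul_zero, map_zero] at h1
  have h2 := haar_definite q (pw q n i i) (by rw [h1, Complex.zero_re])
  have h3 := counit_pwMap q (wcoeff q n i) (wvec q n i)
  rw [← pw_eq, h2, map_zero, wcoeff_wvec] at h3
  exact zero_ne_one h3

end pw

/-- Orthogonality of eigenvectors of a symmetric operator for distinct eigenvalues. The operator
itself enters only through the identity `e`. -/
theorem smul_haar_eq_zero_of_ne (q : Param) {x y : A q} {s t : ℂ} (h : s ≠ t)
    (e : haar q (star x * t • y) = haar q (star (s • x) * y)) (hs : star s = s) :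
    haar q (star x * y) = 0 := by
  rw [mul_smul_comm, star_smul, smul_mul_assoc, hs, map_smul, map_smul, smul_eq_mul, smul_eq_mul]
    at e
  have h1 : (t - s) * haar q (star x * y) = 0 := by rw [sub_mul, e, sub_self]
  exact (mul_eq_zero.1 h1).resolve_left (sub_ne_zero.2 h.symm)

theorem star_unitTwo_zpow (k : ℤ) :
    star ((unitTwo ^ k : ℂˣ) : ℂ) = ((unitTwo ^ k : ℂˣ) : ℂ) := by
  rw [← Units.coe_star, star_zpow, star_unitTwo]

/-- Different left or right degrees are separated by the scaling automorphisms with the real scalar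
`unitTwo`; if both degrees agree, `n ≠ n'` and `∂_f ∂_e` separates. -/
theorem pw_orthogonal (q : Param) {n n' : ℕ} (i j : Fin (n + 1)) (i' j' : Fin (n' + 1))
    (h : ¬ (n = n' ∧ (i : ℕ) = i' ∧ (j : ℕ) = j')) :
    haar q (star (pw q n i j) * pw q n' i' j') = 0 := by
  by_cases h1 : 2 * (j : ℤ) - n = 2 * (j' : ℤ) - n'
  · by_cases h2 : 2 * (i : ℤ) - n = 2 * (i' : ℤ) - n'
    · have hn : n ≠ n' := by
        rintro rfl
        apply h
        omega
      refine smul_haar_eq_zero_of_ne q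
        (s := ((qnum q ((n : ℝ) - j) * qnum q ((j : ℝ) + 1) : ℝ) : ℂ))
        (t := ((qnum q ((n' : ℝ) - j') * qnum q ((j' : ℝ) + 1) : ℝ) : ℂ)) ?_ ?_ ?_
      · intro heq
        have h3 := Complex.ofReal_injective heq
        have h4 : 2 * (j : ℝ) - n = 2 * (j' : ℝ) - n' := by exact_mod_cast h1
        -- Equal left degrees make the second squares in `qnum_mul` equal. What remains is
        -- [(n+1)/2]² = [(n'+1)/2]², excluded by strict monotonicity.
        have h5 : ((n : ℝ) - j - (j + 1)) / 2 = ((n' : ℝ) - j' - (j' + 1)) / 2 := by linarith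
        rw [qnum_mul, qnum_mul, h5, sub_left_inj] at h3
        have h6 := (pow_left_inj₀ (qnum_nonneg q (by ring_nf; positivity))
          (qnum_nonneg q (by ring_nf; positivity)) two_ne_zero).1 h3
        have h7 := (qnum_strictMono q).injective h6
        apply hn
        have h8 : (n : ℝ) = n' := by linarith
        exact_mod_cast h8
      · rw [← df_de_pw, ← df_de_pw, haar_star_df, haar_star_de]
      · rw [Complex.star_def, Complex.conj_ofReal]
    · refine smul_haar_eq_zero_of_ne q (s := ((unitTwo ^ (2 * (i : ℤ) - n) : ℂˣ) : ℂ))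
        (t := ((unitTwo ^ (2 * (i' : ℤ) - n') : ℂˣ) : ℂ))
        (fun h => h2 (unitTwo_zpow_injective h)) ?_ (star_unitTwo_zpow _)
      rw [← circ_right_pw, ← circ_right_pw, haar_star_circ _ _ _ (star_one _) star_unitTwo]
  · refine smul_haar_eq_zero_of_ne q (s := ((unitTwo ^ (2 * (j : ℤ) - n) : ℂˣ) : ℂ))
        (t := ((unitTwo ^ (2 * (j' : ℤ) - n') : ℂˣ) : ℂ))
        (fun h => h1 (unitTwo_zpow_injective h)) ?_ (star_unitTwo_zpow _)
    rw [← circ_left_pw, ← circ_left_pw, haar_star_circ _ _ _ star_unitTwo (star_one _)]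

/-! ### The degree filtration and the span of the Peter-Weyl basis -/

/-- Indices of the monomials of total degree at most `N`. -/
abbrev MonIdx (N : ℕ) : Type := {p : ℤ × ℕ × ℕ // p.1.natAbs + p.2.1 + p.2.2 ≤ N}

/-- The span of the monomials of total degree at most `N`. -/
def filt (q : Param) (N : ℕ) : Submodule ℂ (A q) :=
  Submodule.span ℂ (Set.range fun p : MonIdx N => mon q p.1.1 p.1.2.1 p.1.2.2)

theorem mon_mem_filt (q : Param) {N : ℕ} {k : ℤ} {m r : ℕ} (h : k.natAbs + m + r ≤ N) :
    mon q k m r ∈ filt q N :=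
  Submodule.subset_span ⟨⟨(k, m, r), h⟩, rfl⟩

theorem gen_mul_mon_mem (q : Param) (g : Gen) {N : ℕ} {k : ℤ} {m r : ℕ}
    (h : k.natAbs + m + r ≤ N) : gen q g * mon q k m r ∈ filt q (N + 1) := by
  rw [← psi_e, ← psi_gen]
  have hm : ∀ {k : ℤ} {m r : ℕ}, k.natAbs + m + r ≤ N + 1 → psi q (e k m r) ∈ filt q (N + 1) := by
    intro k m r h
    rw [psi_e]
    exact mon_mem_filt q h
  cases g <;> simp only [act, lift_gen, genFun, Ma, Mb, Mc, Md, ext3_e]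
  · split_ifs with h0
    · exact hm (by omega)
    · rw [map_smul, map_add, map_smul]
      exact Submodule.smul_mem _ _
        (Submodule.add_mem _ (hm (by omega)) (Submodule.smul_mem _ _ (hm (by omega))))
  · rw [map_smul]
    exact Submodule.smul_mem _ _ (hm (by omega))
  · rw [map_smul]
    exact Submodule.smul_mem _ _ (hm (by omega))
  · split_ifs with h0
    · rw [map_smul]
      exact Submodule.smul_mem _ _ (hm (by omega))
    · rw [map_add, map_smul]
      exact Submodule.add_mem _ (hm (by omega)) (Submodule.smul_mem _ _ (hm (by omega)))

theorem gen_mul_mem_filt (q : Param) (g : Gen) {N : ℕ} {x : A q} (hx : x ∈ filt q N) :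
    gen q g * x ∈ filt q (N + 1) := by
  induction hx using Submodule.span_induction with
  | mem x hx =>
    obtain ⟨p, rfl⟩ := hx
    exact gen_mul_mon_mem q g p.2
  | zero => rw [mul_zero]; exact Submodule.zero_mem _
  | add x y _ _ hx hy => rw [mul_add]; exact Submodule.add_mem _ hx hy
  | smul z x _ hx => rw [mul_smul_comm]; exact Submodule.smul_mem _ _ hx

/-! ### Compatibility of the comultiplication with the degree filtration -/

section tensor
open TensorProduct

/-- The tensors with second factors in the filtration subspace `filt q N`. -/
def tensorFilt (q : Param) (N : ℕ) : Submodule ℂ (A q ⊗[ℂ] A q) :=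
  Submodule.span ℂ {X | ∃ x, ∃ y ∈ filt q N, x ⊗ₜ[ℂ] y = X}

theorem gen_tmul_gen_mul_mem (q : Param) (g g' : Gen) {N : ℕ} {X : A q ⊗[ℂ] A q}
    (hX : X ∈ tensorFilt q N) : (gen q g ⊗ₜ[ℂ] gen q g') * X ∈ tensorFilt q (N + 1) := by
  induction hX using Submodule.span_induction with
  | mem X hX =>
    obtain ⟨x, y, hy, rfl⟩ := hX
    rw [Algebra.TensorProduct.tmul_mul_tmul]
    exact Submodule.subset_span ⟨_, _, gen_mul_mem_filt q g' hy, rfl⟩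
  | zero => rw [mul_zero]; exact Submodule.zero_mem _
  | add x y _ _ hx hy => rw [mul_add]; exact Submodule.add_mem _ hx hy
  | smul z x _ hx => rw [mul_smul_comm]; exact Submodule.smul_mem _ _ hx

theorem comul_gen_mul_mem (q : Param) (g : Gen) {N : ℕ} {x : A q}
    (hx : comul q x ∈ tensorFilt q N) : comul q (gen q g * x) ∈ tensorFilt q (N + 1) := by
  rw [map_mul]
  cases g <;> simp only [comul_a, comul_b, comul_c, comul_d, add_mul] <;>
    exact Submodule.add_mem _ (gen_tmul_gen_mul_mem q _ _ hx) (gen_tmul_gen_mul_mem q _ _ hx)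

theorem comul_gen_pow_mul_mem (q : Param) (g : Gen) {N : ℕ} {x : A q}
    (hx : comul q x ∈ tensorFilt q N) (s : ℕ) :
    comul q (gen q g ^ s * x) ∈ tensorFilt q (N + s) := by
  induction s with
  | zero => simpa using hx
  | succ s ih => rw [pow_succ', mul_assoc]; exact comul_gen_mul_mem q g ih

theorem evalL_mem_filt (q : Param) (φ : A q →ₗ[ℂ] ℂ) {N : ℕ} {X : A q ⊗[ℂ] A q}
    (hX : X ∈ tensorFilt q N) : evalL q φ X ∈ filt q N := by
  have : tensorFilt q N ≤ (filt q N).comap (evalL q φ) := by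
    refine Submodule.span_le.2 ?_
    rintro _ ⟨x, y, hy, rfl⟩
    rw [SetLike.mem_coe, Submodule.mem_comap, evalL_tmul]
    exact Submodule.smul_mem _ _ hy
  exact this hX

end tensor

/-- The weight vectors are products of `n` generators, and each generator contributes one generator
to the second leg. -/
theorem pw_mem_filt (q : Param) (n : ℕ) (i j : Fin (n + 1)) : pw q n i j ∈ filt q n := by
  rw [pw_eq, pwMap_apply]
  apply evalL_mem_filt
  rw [wvec, map_smul]
  apply Submodule.smul_mem
  have h0 : comul q 1 ∈ tensorFilt q 0 := by
    rw [map_one, Algebra.TensorProduct.one_def]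
    refine Submodule.subset_span ⟨1, 1, ?_, rfl⟩
    simpa [mon] using mon_mem_filt q (N := 0) (k := 0) (m := 0) (r := 0) (by simp)
  have h1 := comul_gen_pow_mul_mem q Gen.a
    (comul_gen_pow_mul_mem q Gen.b h0 j) (n - j)
  have h2 : 0 + (j : ℕ) + (n - j) = n := by have := j.is_le; omega
  rwa [h2, mul_one] at h1

/-- Indices of the Peter-Weyl basis elements with `2 l ≤ N`. -/
abbrev PwIdx (N : ℕ) : Type := Σ n : Fin (N + 1), Fin ((n : ℕ) + 1) × Fin ((n : ℕ) + 1)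

/-- The monomial with index `(k, m, r)` corresponds to the matrix coefficient with
`n = |k| + m + r` at the position `(r + k⁻, m + k⁻)`. -/
def monToPw (N : ℕ) (p : MonIdx N) : PwIdx N :=
  ⟨⟨p.1.1.natAbs + p.1.2.1 + p.1.2.2, Nat.lt_succ_of_le p.2⟩,
    ⟨p.1.2.2 + (-p.1.1).toNat, by dsimp only; omega⟩,
    ⟨p.1.2.1 + (-p.1.1).toNat, by dsimp only; omega⟩⟩

theorem monToPw_injective (N : ℕ) : Function.Injective (monToPw N) := by
  rintro ⟨⟨k, m, r⟩, h⟩ ⟨⟨k', m', r'⟩, h'⟩ heq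
  have e1 := congrArg (fun x : PwIdx N => (x.1 : ℕ)) heq
  have e2 := congrArg (fun x : PwIdx N => (x.2.1 : ℕ)) heq
  have e3 := congrArg (fun x : PwIdx N => (x.2.2 : ℕ)) heq
  simp only [monToPw] at e1 e2 e3
  simp only [Subtype.mk.injEq, Prod.mk.injEq]
  omega

/-- Non-zero pairwise orthogonal vectors are independent; the inclusion into the Hilbert space
supplies the inner product. -/
theorem linearIndependent_pw (q : Param) (N : ℕ) :
    LinearIndependent ℂ fun p : PwIdx N => pw q p.1 p.2.1 p.2.2 := by
  refine LinearIndependent.of_comp (inc q) ?_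
  refine linearIndependent_of_ne_zero_of_inner_eq_zero (fun p => ?_) ?_
  · rw [Function.comp_apply, Ne, map_eq_zero_iff _ (inc_injective q)]
    exact pw_ne_zero q _ _ _
  · rintro ⟨n, i, j⟩ ⟨n', i', j'⟩ hne
    refine (inc_inner q _ _).trans (pw_orthogonal q i j i' j' ?_)
    rintro ⟨h1, h2, h3⟩
    apply hne
    obtain rfl := Fin.ext h1
    obtain rfl := Fin.ext h2
    obtain rfl := Fin.ext h3
    rfl

/-- A dimension count replaces any explicit inversion. The independent matrix coefficients lie in
`filt q N`, whose dimension is at most the number of monomials, and `monToPw` bounds that number by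
the number of matrix coefficients. -/
theorem span_pw_eq_filt (q : Param) (N : ℕ) :
    Submodule.span ℂ (Set.range fun p : PwIdx N => pw q p.1 p.2.1 p.2.2) = filt q N := by
  have hmono : ∀ {n : ℕ}, n ≤ N → filt q n ≤ filt q N := by
    intro n hn
    refine Submodule.span_le.2 ?_
    rintro _ ⟨p, rfl⟩
    exact mon_mem_filt q (p.2.trans hn)
  have : Finite (MonIdx N) := Finite.of_injective _ (monToPw_injective N)
  have : Fintype (MonIdx N) := Fintype.ofFinite _
  have : FiniteDimensional ℂ (filt q N) :=
    FiniteDimensional.span_of_finite ℂ (Set.finite_range _)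
  refine Submodule.eq_of_le_of_finrank_le (Submodule.span_le.2 ?_) ?_
  · rintro _ ⟨p, rfl⟩
    exact hmono (Nat.le_of_lt_succ p.1.2) (pw_mem_filt q _ _ _)
  · rw [finrank_span_eq_card (linearIndependent_pw q N)]
    exact (finrank_range_le_card _).trans (Fintype.card_le_of_injective _ (monToPw_injective N))

/-- The Peter-Weyl basis spans the algebra. -/
theorem span_pw (q : Param) (S : Submodule ℂ (A q)) (hS : ∀ n i j, pw q n i j ∈ S) : S = ⊤ := by
  have hmon : ∀ k m r, mon q k m r ∈ S := by
    intro k m r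
    have h := mon_mem_filt q (le_refl (k.natAbs + m + r))
    rw [← span_pw_eq_filt] at h
    refine (Submodule.span_le.2 ?_ : _ ≤ S) h
    rintro _ ⟨p, rfl⟩
    exact hS _ _ _
  rw [eq_top_iff]
  rintro x -
  rw [← psi_coord q x]
  exact Submodule.sum_mem _ fun p _ => Submodule.smul_mem _ _ (hmon _ _ _)

/-! ### Operators diagonal in the grading -/

theorem Phi_mon (q : Param) (n : ℤ) (k : ℤ) (m r : ℕ) :
    Phi q n (mon q k m r) = if (m : ℤ) - k - r = n then mon q k m r else 0 := by
  rw [Phi, LinearMap.comp_apply, coord_mon, ext3_e]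

theorem weightOp_apply (q : Param) (w : ℤ → ℂ) (x : A q) :
    weightOp q w x = ∑ᶠ n, w n • Phi q n x := rfl

theorem weightOp_mon (q : Param) (w : ℤ → ℂ) (k : ℤ) (m r : ℕ) :
    weightOp q w (mon q k m r) = w ((m : ℤ) - k - r) • mon q k m r := by
  rw [weightOp_apply, finsum_eq_single _ ((m : ℤ) - k - r), Phi_mon, if_pos rfl]
  intro n hn
  rw [Phi_mon, if_neg hn.symm, smul_zero]

theorem coord_circ (q : Param) (z w : ℂˣ) (x : A q) (p : ℤ × ℕ × ℕ) :
    coord q (circ q z w x) p =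
      ((z ^ ((p.2.1 : ℤ) - p.1 - p.2.2) * w ^ (-(p.2.1 : ℤ) - p.1 + p.2.2) : ℂˣ) : ℂ) *
        coord q x p := by
  have : (Finsupp.lapply p ∘ₗ coord q) ∘ₗ (circ q z w).toLinearMap =
      ((z ^ ((p.2.1 : ℤ) - p.1 - p.2.2) * w ^ (-(p.2.1 : ℤ) - p.1 + p.2.2) : ℂˣ) : ℂ) •
        (Finsupp.lapply p ∘ₗ coord q) := by
    apply linearMap_ext_mon
    intro k m r
    simp only [LinearMap.comp_apply, AlgHom.toLinearMap_apply, circ_mon, map_smul,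
      LinearMap.smul_apply, coord_mon, Finsupp.lapply_apply, e, Finsupp.single_apply]
    by_cases h : (k, m, r) = p
    · subst h
      rfl
    · simp [if_neg h]
  exact LinearMap.congr_fun this x

/-- On vectors of degree `L`, the operator `∑ w(n) Φ_n` is multiplication by `w(L)`. -/
theorem weightOp_of_degree (q : Param) (w : ℤ → ℂ) {x : A q} {L : ℤ}
    (hx : circ q unitTwo 1 x = ((unitTwo ^ L : ℂˣ) : ℂ) • x) : weightOp q w x = w L • x := by
  -- Powers of 2 are distinct, so the scaling by the single scalar `unitTwo` already forces every
  -- monomial of `x` to have degree `L`.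
  have hdeg : ∀ p ∈ (coord q x).support, (p.2.1 : ℤ) - p.1 - p.2.2 = L := by
    intro p hp
    have h := coord_circ q unitTwo 1 x p
    rw [hx, map_smul, Finsupp.smul_apply, smul_eq_mul, one_zpow, mul_one] at h
    exact (unitTwo_zpow_injective (mul_right_cancel₀ (Finsupp.mem_support_iff.1 hp) h)).symm
  have hsum : x = ∑ p ∈ (coord q x).support, coord q x p • mon q p.1 p.2.1 p.2.2 :=
    (psi_coord q x).symm
  conv_lhs => rw [hsum]
  conv_rhs => rw [hsum]
  rw [map_sum, Finset.smul_sum]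
  refine Finset.sum_congr rfl fun p hp => ?_
  rw [map_smul, weightOp_mon, hdeg p hp, smul_comm]

/-- Weights that are powers of a fixed unit give algebra automorphisms. In particular Δ_L^{1/2} and
σ_L^{-1/2} are both `kl`. -/
theorem weightOp_eq_circ (q : Param) (w : ℤ → ℂ) (z : ℂˣ)
    (h : ∀ n, w n = ((z ^ n : ℂˣ) : ℂ)) (x : A q) : weightOp q w x = circ q z 1 x := by
  have : weightOp q w = (circ q z 1).toLinearMap := by
    apply linearMap_ext_mon
    intro k m r
    rw [weightOp_mon, AlgHom.toLinearMap_apply, circ_mon, h, one_zpow, mul_one]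
  exact LinearMap.congr_fun this x

theorem qpow_mul_qpow_neg (q : Param) (x : ℝ) : qpow q x * qpow q (-x) = 1 := by
  rw [← qpow_add, add_neg_cancel, qpow_zero]

theorem qhalf_zpow (q : Param) (k : ℤ) : ((qhalf q ^ k : ℂˣ) : ℂ) = qpow q ((k : ℝ) / 2) := by
  rw [Units.val_zpow_eq_zpow_val, qhalf_val, qpow, ← Complex.ofReal_zpow, ← Real.rpow_intCast,
    ← Real.rpow_mul (q_pos q).le, qpow]
  congr 2
  ring

theorem DeltaL_half (q : Param) (x : A q) : DeltaL q (1 / 2) x = kl q x :=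
  weightOp_eq_circ q _ _ (fun n => by rw [qhalf_zpow]; congr 1; ring) x

theorem DeltaL_one (q : Param) (x : A q) : DeltaL q 1 x = kl q (kl q x) := by
  rw [circ_circ, mul_one]
  refine weightOp_eq_circ q _ _ (fun n => ?_) x
  rw [mul_zpow, Units.val_mul, qhalf_zpow, ← qpow_add]
  congr 1
  ring

theorem sigmaL_neg_half (q : Param) (x : A q) : sigmaL q (-(1 / 2)) x = kl q x :=
  weightOp_eq_circ q _ _ (fun n => by rw [qhalf_zpow]; congr 1; ring) x

theorem dH_mon (q : Param) (k : ℤ) (m r : ℕ) :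
    dH q (mon q k m r) = ((((m : ℤ) - k - r : ℤ) : ℂ) / 2) • mon q k m r :=
  weightOp_mon q _ k m r

theorem dH_of_degree (q : Param) {x : A q} {L : ℤ}
    (hx : circ q unitTwo 1 x = ((unitTwo ^ L : ℂˣ) : ℂ) • x) : dH q x = ((L : ℂ) / 2) • x :=
  weightOp_of_degree q _ hx

theorem dH_pw (q : Param) (n : ℕ) (i j : Fin (n + 1)) :
    dH q (pw q n i j) = (((2 * (j : ℤ) - n : ℤ) : ℂ) / 2) • pw q n i j :=
  dH_of_degree q (circ_left_pw q n i unitTwo j)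

/-- `∂_H` is a derivation. -/
theorem dH_mul (q : Param) (x y : A q) : dH q (x * y) = dH q x * y + x * dH q y := by
  have : (LinearMap.mul ℂ (A q)).compr₂ (dH q) =
      (LinearMap.mul ℂ (A q)).comp (dH q) + (LinearMap.mul ℂ (A q)).compl₂ (dH q) := by
    apply linearMap_ext_mon
    intro k m r
    apply linearMap_ext_mon
    intro k' m' r'
    simp only [LinearMap.compr₂_apply, LinearMap.mul_apply', LinearMap.add_apply,
      LinearMap.comp_apply, LinearMap.compl₂_apply, dH_mon, smul_mul_assoc, mul_smul_comm,
      ← add_smul]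
    -- A product of two monomials need not be a monomial, but it is homogeneous of the sum of the
    -- degrees.
    rw [dH_of_degree q (L := ((m : ℤ) - k - r) + ((m' : ℤ) - k' - r'))]
    · congr 1
      push_cast
      ring
    · rw [map_mul, circ_mon, circ_mon, smul_mul_smul_comm, one_zpow, one_zpow, mul_one, mul_one,
        zpow_add unitTwo, Units.val_mul]
  exact LinearMap.congr_fun (LinearMap.congr_fun this x) y

/-! ### The operator `D` on the algebraic direct sum -/

theorem sumOp_apply {E F : Type*} [AddCommGroup E] [Module ℂ E] [AddCommGroup F] [Module ℂ F]
    (L : ℤ → E →ₗ[ℂ] F) (hL : ∀ x, (Function.support fun n => L n x).Finite) (x : E) :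
    sumOp L hL x = ∑ᶠ n, L n x := rfl

theorem Psi_scal_apply (q : Param) (n : ℤ) (x y : A q) : (Psi q n ∘ₗ scal q n (-n)) (x, y) =
    ((n : ℂ) • Phi q (n + 1) x, (-n : ℂ) • Phi q (n - 1) y) := by
  simp [Psi, scal]

theorem diagPart_apply (q : Param) (x y : A q) : diagPart q (x, y) =
    (dH q x - (1 / 2 : ℂ) • x, -dH q y - (1 / 2 : ℂ) • y) := by
  have : diagPart q =
      (dH q - (1 / 2 : ℂ) • LinearMap.id).prodMap (-dH q - (1 / 2 : ℂ) • LinearMap.id) := by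
    apply LinearMap.prod_ext
    · apply linearMap_ext_mon
      intro k m r
      -- In the first component `Ψ_n` sees degree n + 1, so only n = degree - 1 contributes; this
      -- shift is the source of the -1/2.
      rw [LinearMap.comp_apply, LinearMap.inl_apply, diagPart, LinearMap.smul_apply, sumOp_apply,
        finsum_eq_single _ ((m : ℤ) - k - r - 1), Psi_scal_apply, sub_add_cancel, Phi_mon,
        if_pos rfl]
      · simp only [map_zero, smul_zero, Prod.smul_mk, LinearMap.comp_apply, LinearMap.inl_apply,
          LinearMap.prodMap_apply, LinearMap.sub_apply, dH_mon, LinearMap.smul_apply,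
          LinearMap.id_apply, smul_smul, ← sub_smul]
        congr 2
        push_cast
        ring
      · intro n hn
        rw [Psi_scal_apply, Phi_mon, if_neg (by omega)]
        simp
    · apply linearMap_ext_mon
      intro k m r
      -- Here n = degree + 1 contributes with the sign -1, which again gives -1/2.
      rw [LinearMap.comp_apply, LinearMap.inr_apply, diagPart, LinearMap.smul_apply, sumOp_apply,
        finsum_eq_single _ ((m : ℤ) - k - r + 1), Psi_scal_apply, add_sub_cancel_right, Phi_mon,
        if_pos rfl]
      · simp only [map_zero, smul_zero, Prod.smul_mk, LinearMap.comp_apply, LinearMap.inr_apply,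
          LinearMap.prodMap_apply, LinearMap.sub_apply, LinearMap.neg_apply, dH_mon,
          LinearMap.smul_apply, LinearMap.id_apply, smul_smul, ← sub_smul, ← neg_smul]
        congr 2
        push_cast
        ring
      · intro n hn
        rw [Psi_scal_apply, Phi_mon, if_neg (by omega)]
        simp
  rw [this]
  rfl

theorem preD_apply (q : Param) (x y : A q) : preD q (x, y) =
    (dH q x - (1 / 2 : ℂ) • x + qpow q (-(1 / 2)) • kl q (de q y),
      -dH q y - (1 / 2 : ℂ) • y + qpow q (1 / 2) • kl q (df q x)) := by
  rw [preD, LinearMap.add_apply, diagPart_apply, ← DeltaL_half, ← DeltaL_half]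
  rfl

/-! ### The eigenvectors -/

/-- The diagonal entry `j - 1/2` of `D` on the span of `(t_{ij}, 0)` and `(0, t_{i,j-1})`. -/
def eigDiag (n j : ℕ) : ℝ := (j : ℝ) + 1 / 2 - n / 2

/-- The off-diagonal entry of `D` on the span of `(t_{ij}, 0)` and `(0, t_{i,j-1})`. -/
def eigOff (q : Param) (n j : ℕ) : ℝ := (q : ℝ) ^ eigDiag n j * ladder q n j

theorem eigOff_pos (q : Param) {n j : ℕ} (h : j < n) : 0 < eigOff q n j :=
  mul_pos (Real.rpow_pos_of_pos (q_pos q) _) (ladder_pos q h)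

theorem weight_succ (n : ℕ) (j : Fin n) : weight n j.succ = eigDiag n j + 1 / 2 := by
  simp only [weight, eigDiag, Fin.val_succ]
  push_cast
  ring

theorem ladder_sq' (q : Param) {n j : ℕ} (h : j < n) :
    ladder q n j ^ 2 = qnum q ((n : ℝ) / 2 + 1 / 2) ^ 2 - qnum q (eigDiag n j) ^ 2 := by
  have e1 : ((j : ℝ) + 1 + (n - j)) / 2 = (n : ℝ) / 2 + 1 / 2 := by ring
  have e2 : ((j : ℝ) + 1 - (n - j)) / 2 = eigDiag n j := by rw [eigDiag]; ring
  rw [ladder_sq q h, mul_comm, qnum_mul, e1, e2]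

/-- The absolute value of the eigenvalues of `D` on the span of `(t_{ij}, 0)` and
`(0, t_{i,j-1})`. -/
def eigAbs (q : Param) (n j : ℕ) : ℝ := √(eigDiag n j ^ 2 + eigOff q n j ^ 2)

theorem eigAbs_sq (q : Param) (n j : ℕ) :
    eigAbs q n j ^ 2 = eigDiag n j ^ 2 + eigOff q n j ^ 2 := Real.sq_sqrt (by positivity)

theorem eigAbs_pos (q : Param) {n j : ℕ} (h : j < n) : 0 < eigAbs q n j := by
  have := eigOff_pos q h
  exact Real.sqrt_pos.2 (by positivity)

/-- The radicand of `lam` is the sum of the squares of the diagonal and off-diagonal entries of the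
2 × 2 block. -/
theorem lam_eq (q : Param) (n : ℕ) (j : Fin n) :
    lam q ((n : ℝ) / 2) (2 * weight n j.succ - 1) = eigAbs q n j := by
  have e1 : 2 * weight n j.succ - 1 = 2 * eigDiag n j := by rw [weight_succ]; ring
  have e2 : 2 * eigDiag n j / 2 = eigDiag n j := by ring
  have e3 : (q : ℝ) ^ (2 * eigDiag n j) = ((q : ℝ) ^ eigDiag n j) ^ 2 := by
    rw [mul_comm, Real.rpow_mul (q_pos q).le, Real.rpow_two]
  rw [lam, eigAbs, e1, e2, ← ladder_sq' q j.2, e3, ← mul_pow]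
  rfl

theorem coefC_eq (q : Param) (n : ℕ) (j : Fin n) (ε : ℤˣ) :
    coefC q ((n : ℝ) / 2) (weight n j.succ) ε =
      (((ε : ℤ) : ℝ) * eigAbs q n j - eigDiag n j) / eigOff q n j := by
  have e1 : weight n j.succ - 1 / 2 = eigDiag n j := by rw [weight_succ]; ring
  rw [coefC, lam_eq, e1, ← ladder_sq' q j.2, Real.sqrt_sq (ladder_pos q j.2).le]
  rfl

theorem unit_sq (ε : ℤˣ) : (((ε : ℤ) : ℝ)) ^ 2 = 1 := by
  rcases Int.units_eq_one_or ε with rfl | rfl <;> norm_num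

theorem kl_pw (q : Param) (n : ℕ) (i j : Fin (n + 1)) :
    kl q (pw q n i j) = qpow q ((j : ℝ) - n / 2) • pw q n i j := by
  rw [circ_left_pw, qhalf_zpow]
  congr 2
  push_cast
  ring

/-- The block is symmetric and traceless. The factors q^{∓1/2} compensate the different weights of
the two components, so both off-diagonal entries carry the same power of `q`. -/
theorem preD_pair (q : Param) (n : ℕ) (i : Fin (n + 1)) (j : Fin n) (C : ℂ) :
    preD q (pw q n i j.succ, C • pw q n i j.castSucc) =
      (((eigDiag n j : ℝ) + (eigOff q n j : ℝ) * C) • pw q n i j.succ,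
        ((eigOff q n j : ℝ) - (eigDiag n j : ℝ) * C) • pw q n i j.castSucc) := by
  have e1 : qpow q (-(1 / 2)) * (C * ((ladder q n j : ℂ) * qpow q (((j : ℕ) + 1 : ℕ) - n / 2))) =
      (eigOff q n j : ℝ) * C := by
    have : qpow q (-(1 / 2)) * qpow q (((j : ℕ) + 1 : ℕ) - n / 2) =
        ((q : ℝ) ^ eigDiag n j : ℝ) := by
      rw [← qpow_add, qpow, eigDiag]
      congr 2
      push_cast
      ring
    rw [eigOff, Complex.ofReal_mul, ← this]
    ring
  have e2 : qpow q (1 / 2) * ((ladder q n j : ℂ) * qpow q ((j : ℕ) - n / 2)) =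
      (eigOff q n j : ℝ) := by
    have : qpow q (1 / 2) * qpow q ((j : ℕ) - n / 2) = ((q : ℝ) ^ eigDiag n j : ℝ) := by
      rw [← qpow_add, qpow, eigDiag]
      congr 2
      ring
    rw [eigOff, Complex.ofReal_mul, ← this]
    ring
  rw [preD_apply]
  simp only [map_smul, de_pw, df_pw, dH_pw, kl_pw, smul_smul, ← sub_smul, ← add_smul, ← neg_smul, Fin.val_succ,
    Fin.val_castSucc, e2, eigDiag]
  congr 2
  · push_cast at e1 ⊢
    linear_combination e1
  · push_cast
    ring

theorem preD_eigVec (q : Param) (ν : EigIdx) :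
    preD q (eigVec q ν) = (eigVal q ν : ℂ) • eigVec q ν := by
  rcases ν with ⟨n, i⟩ | ⟨n, i⟩ | ⟨n, i, j, ε⟩
  · simp only [eigVec, eigVal, preD_apply, map_zero, smul_zero, sub_zero, add_zero,
      de_pw_last, dH_pw, ← sub_smul, ← neg_smul, Prod.smul_mk, Fin.val_last]
    congr 2
    push_cast
    ring
  · simp only [eigVec, eigVal, preD_apply, map_zero, smul_zero, sub_zero, add_zero, neg_zero,
      df_pw_zero, dH_pw, ← sub_smul, Prod.smul_mk, Fin.val_zero]
    congr 2
    push_cast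
    ring
  · have hw := (eigOff_pos q j.2).ne'
    have h1 := eigAbs_sq q n j
    have h2 := unit_sq ε
    rw [eigVec, eigVal, preD_pair, lam_eq, coefC_eq, Prod.smul_mk, smul_smul]
    congr 2
    · rw [← Complex.ofReal_mul, ← Complex.ofReal_add]
      congr 1
      field_simp
      ring
    · rw [← Complex.ofReal_mul, ← Complex.ofReal_sub, ← Complex.ofReal_mul]
      congr 1
      field_simp
      -- This is ω² - δ(ελ - δ) = ελ(ελ - δ), which holds as λ² = δ² + ω² and ε² = 1.
      linear_combination (-1 : ℝ) * h1 - eigAbs q n j ^ 2 * h2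

/-! ### The orthogonal eigenbasis -/

theorem inner_emb (q : Param) (u v : A q × A q) : inner ℂ (emb q u) (emb q v) =
    haar q (star u.1 * v.1) + haar q (star u.2 * v.2) := by
  rw [emb_apply, emb_apply, WithLp.prod_inner_apply]
  exact congrArg₂ _ (inc_inner q _ _) (inc_inner q _ _)

theorem eigVec_ne_zero (q : Param) (ν : EigIdx) : emb q (eigVec q ν) ≠ 0 := by
  rw [Ne, map_eq_zero_iff _ (emb_injective q)]
  rcases ν with ⟨n, i⟩ | ⟨n, i⟩ | ⟨n, i, j, ε⟩
  · exact fun h => pw_ne_zero q n i _ (congrArg Prod.snd h)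
  · exact fun h => pw_ne_zero q n i _ (congrArg Prod.fst h)
  · exact fun h => pw_ne_zero q n i _ (congrArg Prod.fst h)

/-- The product is (λ - δ)(-λ - δ)/ω² = (δ² - λ²)/ω². It expresses orthogonality of the two
eigenvectors of the symmetric block. -/
theorem coefC_mul (q : Param) (n : ℕ) (j : Fin n) {ε ε' : ℤˣ} (h : ε ≠ ε') :
    coefC q ((n : ℝ) / 2) (weight n j.succ) ε * coefC q ((n : ℝ) / 2) (weight n j.succ) ε' = -1 := by
  have hw := (eigOff_pos q j.2).ne'
  have h1 := eigAbs_sq q n j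
  rw [coefC_eq, coefC_eq]
  rcases Int.units_eq_one_or ε with rfl | rfl <;> rcases Int.units_eq_one_or ε' with rfl | rfl
  · exact absurd rfl h
  · push_cast
    field_simp
    linear_combination -h1
  · push_cast
    field_simp
    linear_combination -h1
  · exact absurd rfl h

theorem eigVec_orthogonal (q : Param) {ν μ : EigIdx} (h : ν ≠ μ) :
    inner ℂ (emb q (eigVec q ν)) (emb q (eigVec q μ)) = 0 := by
  rw [inner_emb]
  rcases ν with ⟨n, i⟩ | ⟨n, i⟩ | ⟨n, i, j, ε⟩ <;>
    rcases μ with ⟨n', i'⟩ | ⟨n', i'⟩ | ⟨n', i', j', ε'⟩ <;>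
    simp only [eigVec, star_zero, zero_mul, mul_zero, map_zero, zero_add, add_zero, star_smul,
      mul_smul_comm, smul_mul_assoc, map_smul]
  · refine pw_orthogonal q _ _ _ _ ?_
    rintro ⟨rfl, h2, -⟩
    exact h (by rw [Fin.ext h2])
  · rw [pw_orthogonal, smul_zero]
    rintro ⟨rfl, -, h3⟩
    simp only [Fin.val_last, Fin.val_castSucc] at h3
    omega
  · refine pw_orthogonal q _ _ _ _ ?_
    rintro ⟨rfl, h2, -⟩
    exact h (by rw [Fin.ext h2])
  · rw [pw_orthogonal, smul_zero, add_zero]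
    rintro ⟨rfl, -, h3⟩
    simp at h3
  · rw [pw_orthogonal, smul_zero]
    rintro ⟨rfl, -, h3⟩
    simp only [Fin.val_last, Fin.val_castSucc] at h3
    omega
  · refine pw_orthogonal q _ _ _ _ ?_
    rintro ⟨rfl, -, h3⟩
    simp at h3
  · by_cases hij : n = n' ∧ (i : ℕ) = i' ∧ (j : ℕ) = j'
    · obtain ⟨rfl, h2, h3⟩ := hij
      obtain rfl := Fin.ext h2
      obtain rfl := Fin.ext h3
      have hε : ε ≠ ε' := fun he => h (by rw [he])
      -- The two matrix coefficients have the same norm, so the inner product is (1 + C C') times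
      -- that squared norm.
      rw [pw_norm_step, Complex.star_def, Complex.conj_ofReal, smul_smul, ← Complex.ofReal_mul,
        coefC_mul q n j hε.symm]
      simp
    · rw [pw_orthogonal, pw_orthogonal, smul_zero, smul_zero, add_zero]
      · simpa using hij
      · simpa using hij

theorem coefC_sub_ne_zero (q : Param) (n : ℕ) (j : Fin n) :
    coefC q ((n : ℝ) / 2) (weight n j.succ) 1 - coefC q ((n : ℝ) / 2) (weight n j.succ) (-1) ≠ 0 := by
  have hw := eigOff_pos q j.2
  have h1 := eigAbs_pos q j.2
  rw [coefC_eq, coefC_eq, ← sub_div]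
  refine div_ne_zero ?_ hw.ne'
  push_cast
  linarith

theorem span_eigVec (q : Param) : Submodule.span ℂ (Set.range (eigVec q)) = ⊤ := by
  set S := Submodule.span ℂ (Set.range (eigVec q)) with hS
  have hmem : ∀ ν, eigVec q ν ∈ S := fun ν => Submodule.subset_span ⟨ν, rfl⟩
  -- The two eigenvectors of a block share the first component, and their coefficients differ
  -- because λ > 0. So their difference isolates the second component.
  have hmid : ∀ n i (j : Fin n), ((0 : A q), pw q n i j.castSucc) ∈ S := by
    intro n i j
    have h1 := S.sub_mem (hmem (EigIdx.mid n i j 1)) (hmem (EigIdx.mid n i j (-1)))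
    simp only [eigVec, Prod.mk_sub_mk, sub_self, ← sub_smul, ← Complex.ofReal_sub] at h1
    have h2 : ((coefC q ((n : ℝ) / 2) (weight n j.succ) 1 -
        coefC q ((n : ℝ) / 2) (weight n j.succ) (-1) : ℝ) : ℂ) ≠ 0 := by
      exact_mod_cast coefC_sub_ne_zero q n j
    exact (S.smul_mem_iff h2).1 (by rwa [Prod.smul_mk, smul_zero])
  have hsnd : ∀ n i j, ((0 : A q), pw q n i j) ∈ S := by
    intro n i j
    induction j using Fin.lastCases with
    | last => exact hmem (EigIdx.low n i)
    | cast j => exact hmid n i j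
  have hfst : ∀ n i j, (pw q n i j, (0 : A q)) ∈ S := by
    intro n i j
    induction j using Fin.cases with
    | zero => exact hmem (EigIdx.up n i)
    | succ j =>
      have h1 := S.sub_mem (hmem (EigIdx.mid n i j 1))
        (S.smul_mem (coefC q ((n : ℝ) / 2) (weight n j.succ) 1 : ℂ) (hmid n i j))
      simpa [eigVec] using h1
  have h1 := span_pw q (S.comap (LinearMap.inl ℂ (A q) (A q))) hfst
  have h2 := span_pw q (S.comap (LinearMap.inr ℂ (A q) (A q))) hsnd
  rw [eq_top_iff]
  rintro ⟨x, y⟩ -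
  have hx : x ∈ S.comap (LinearMap.inl ℂ (A q) (A q)) := by rw [h1]; trivial
  have hy : y ∈ S.comap (LinearMap.inr ℂ (A q) (A q)) := by rw [h2]; trivial
  have := S.add_mem (Submodule.mem_comap.1 hx) (Submodule.mem_comap.1 hy)
  simpa using this

theorem emb_denseRange (q : Param) : DenseRange (emb q) :=
  (WithLp.homeomorphProd 2 (Hh q) (Hh q)).symm.surjective.denseRange.comp
    ((inc_dense q).prodMap (inc_dense q)) (WithLp.homeomorphProd 2 (Hh q) (Hh q)).symm.continuous

theorem span_emb_eigVec (q : Param) :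
    (Submodule.span ℂ (Set.range fun ν => emb q (eigVec q ν))).topologicalClosure = ⊤ := by
  have h : Submodule.span ℂ (Set.range fun ν => emb q (eigVec q ν)) = LinearMap.range (emb q) := by
    rw [LinearMap.range_eq_map, ← span_eigVec, Submodule.map_span, ← Set.range_comp]
    rfl
  rw [h, ← Submodule.dense_iff_topologicalClosure_eq_top]
  exact emb_denseRange q

/-! ### Essential self-adjointness -/

theorem emb_mem_domain (q : Param) (v : A q × A q) : emb q v ∈ (Dirac q).domain := ⟨v, rfl⟩

theorem Dirac_emb (q : Param) (v : A q × A q) (h : emb q v ∈ (Dirac q).domain) :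
    Dirac q ⟨emb q v, h⟩ = emb q (preD q v) := toUnbounded_emb q (preD q) v

theorem Dirac_eigVec (q : Param) (ν : EigIdx) (h : emb q (eigVec q ν) ∈ (Dirac q).domain) :
    Dirac q ⟨emb q (eigVec q ν), h⟩ = (eigVal q ν : ℂ) • emb q (eigVec q ν) := by
  rw [Dirac_emb, preD_eigVec, map_smul]

/-- Linear combinations of orthogonal eigenvectors with real eigenvalues exhaust the domain
algebraically, so symmetry needs no further use of adjointness. -/
theorem preD_symmetric (q : Param) (u v : A q × A q) :
    inner ℂ (emb q (preD q u)) (emb q v) = inner ℂ (emb q u) (emb q (preD q v)) := by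
  have hu : u ∈ Submodule.span ℂ (Set.range (eigVec q)) := by rw [span_eigVec]; trivial
  have hv : v ∈ Submodule.span ℂ (Set.range (eigVec q)) := by rw [span_eigVec]; trivial
  induction hu using Submodule.span_induction with
  | mem u hu =>
    obtain ⟨ν, rfl⟩ := hu
    induction hv using Submodule.span_induction with
    | mem v hv =>
      obtain ⟨μ, rfl⟩ := hv
      rw [preD_eigVec, preD_eigVec, map_smul, map_smul, inner_smul_left, inner_smul_right,
        Complex.conj_ofReal]
      by_cases h : ν = μ
      · rw [h]
      · rw [eigVec_orthogonal q h, mul_zero, mul_zero]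
    | zero => simp
    | add v w _ _ hv hw => rw [map_add, map_add, map_add, inner_add_right, inner_add_right, hv, hw]
    | smul z v _ hv => rw [map_smul, map_smul, map_smul, inner_smul_right, inner_smul_right, hv]
  | zero => simp
  | add u w _ _ hu hw => rw [map_add, map_add, map_add, inner_add_left, inner_add_left, hu, hw]
  | smul z u _ hu => rw [map_smul, map_smul, map_smul, inner_smul_left, inner_smul_left, hu]

theorem Dirac_symmetric (q : Param) : (Dirac q).IsFormalAdjoint (Dirac q) := by
  have key : ∀ x : (Dirac q).domain, ∃ u, (x : H q) = emb q u ∧ Dirac q x = emb q (preD q u) := by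
    intro x
    obtain ⟨u, hu⟩ : ∃ u, emb q u = x := x.2
    refine ⟨u, hu.symm, ?_⟩
    rw [← Dirac_emb q u (emb_mem_domain q u)]
    congr 1
    exact Subtype.ext hu.symm
  intro x y
  obtain ⟨u, hu, hu'⟩ := key x
  obtain ⟨v, hv, hv'⟩ := key y
  rw [hu, hu', hv, hv']
  exact preD_symmetric q u v

theorem Dirac_isEssentiallySelfAdjoint (q : Param) : IsEssentiallySelfAdjoint (Dirac q) :=
  isEssentiallySelfAdjoint_of_orthogonal (Dirac_symmetric q)
    (fun ν => ⟨emb q (eigVec q ν), emb_mem_domain q _⟩) (eigVal q) (eigVec_ne_zero q)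
    (fun _ _ h => eigVec_orthogonal q h) (fun ν => Dirac_eigVec q ν _) (span_emb_eigVec q)

/-! ### The commutators -/

theorem repH_emb (q : Param) (α : A q) (v : A q × A q) :
    repH q α (emb q v) = emb q (α * v.1, α * v.2) := by
  change block q (gns q α) 0 0 (gns q α) (emb q v) = _
  rw [emb_apply, block_toLp, gns_inc, gns_inc]
  simp [emb_apply]

theorem Stilde_emb (q : Param) (α : A q) (v : A q × A q) :
    Stilde q α (emb q v) = emb q (dH q α * v.1, -(dH q α * v.2)) := by
  change repH q (dH q α) (block q 1 0 0 (-1) (emb q v)) = _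
  have h : block q 1 0 0 (-1) (emb q v) = emb q (v.1, -v.2) := by
    rw [emb_apply, block_toLp]
    simp [emb_apply]
  rw [h, repH_emb, mul_neg]

theorem Ttilde_emb (q : Param) (α : A q) (v : A q × A q) : Ttilde q α (emb q v) =
    emb q (qpow q (-(1 / 2)) • (de q (kl q α) * v.2), qpow q (1 / 2) • (df q (kl q α) * v.1)) := by
  change block q 0 (qpow q (-(1 / 2)) • gns q (de q (sigmaL q (-(1 / 2)) α)))
    (qpow q (1 / 2) • gns q (df q (sigmaL q (-(1 / 2)) α))) 0 (emb q v) = _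
  rw [emb_apply, block_toLp, sigmaL_neg_half]
  simp only [smul_apply, gns_inc, zero_apply, zero_add, add_zero, emb_apply, map_smul]

theorem hatDelta_one_apply (q : Param) (x y : A q) : hatDelta q 1 (x, y) =
    ((qc q)⁻¹ • kl q (kl q x), qc q • kl q (kl q y)) := by
  have h : qpow q (-1) = (qc q)⁻¹ := by
    rw [eq_comm, inv_eq_of_mul_eq_one_right]
    rw [← qpow_one, qpow_mul_qpow_neg]
  rw [← h, ← qpow_one, ← DeltaL_one, ← DeltaL_one]
  rfl

theorem kl_de (q : Param) (x : A q) : kl q (de q x) = qc q • de q (kl q x) := by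
  rw [circ_de, Units.val_pow_eq_pow_val, qhalf_sq]

theorem kl_df (q : Param) (x : A q) : kl q (df q x) = (qc q)⁻¹ • df q (kl q x) := by
  rw [circ_df, Units.val_zpow_eq_zpow_val, zpow_neg, ← qhalf_sq]
  rfl

/-- The algebraic form of the commutator formula. -/
theorem preD_commutator (q : Param) (α x y : A q) :
    preD q (α * x, α * y) - (α * (preD q (x, y)).1, α * (preD q (x, y)).2) =
      (dH q α * x + qpow q (-(1 / 2)) • (kl q (de q α) * kl q (kl q y)),
        -(dH q α * y) + qpow q (1 / 2) • (kl q (df q α) * kl q (kl q x))) := by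
  -- The outer `kl` undoes the `klInv` on `α`, so the terms with an underived `α` cancel against `α`
  -- times `preD`.
  rw [preD_apply, preD_apply, de_mul, df_mul, dH_mul, dH_mul, map_add, map_add, map_mul, map_mul,
    map_mul, map_mul, kl_klInv]
  simp only [mul_add, mul_sub, mul_neg, mul_smul_comm, smul_add, Prod.mk_sub_mk]
  congr 1 <;> abel

theorem commutator_emb (q : Param) (α : A q) (v : A q × A q)
    (h : emb q v ∈ (commutator (Dirac q) (repH q α)).domain) :
    commutator (Dirac q) (repH q α) ⟨emb q v, h⟩ =
      emb q (dH q α * v.1 + qpow q (-(1 / 2)) • (kl q (de q α) * kl q (kl q v.2)),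
        -(dH q α * v.2) + qpow q (1 / 2) • (kl q (df q α) * kl q (kl q v.1))) := by
  have h1 : commutator (Dirac q) (repH q α) ⟨emb q v, h⟩ =
      Dirac q ⟨repH q α (emb q v), h.2⟩ - repH q α (Dirac q ⟨emb q v, h.1⟩) := rfl
  have h2 : Dirac q ⟨repH q α (emb q v), h.2⟩ = emb q (preD q (α * v.1, α * v.2)) := by
    rw [← Dirac_emb q _ (emb_mem_domain q _)]
    congr 1
    exact Subtype.ext (repH_emb q α v)
  rw [h1, h2, Dirac_emb, repH_emb, ← map_sub, ← preD_commutator]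

/-- Left multiplication maps the algebraic direct sum into itself, so the second condition on the
domain is automatic. -/
theorem commutator_domain (q : Param) (α : A q) :
    (commutator (Dirac q) (repH q α)).domain = (Dirac q).domain := by
  refine le_antisymm inf_le_left (le_inf le_rfl ?_)
  rintro _ ⟨v, rfl⟩
  refine Submodule.mem_comap.2 ?_
  exact ⟨_, (repH_emb q α v).symm⟩

theorem commutator_eq (q : Param) (α : A q) : commutator (Dirac q) (repH q α) =
    (Stilde q α).toLinearMap.toPMap (Dirac q).domain +
      (Ttilde q α).toLinearMap.compPMap (hatDeltaL q) := by
  refine LinearPMap.ext ?_ ?_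
  · rw [commutator_domain]
    exact (inf_idem _).symm
  · rintro _ hf hg
    obtain ⟨v, rfl⟩ := hf.1
    have hs := qc_ne q
    have h1 : ((Stilde q α).toLinearMap.toPMap (Dirac q).domain +
        (Ttilde q α).toLinearMap.compPMap (hatDeltaL q)) ⟨emb q v, hg⟩ =
        Stilde q α (emb q v) + Ttilde q α (hatDeltaL q ⟨emb q v, v, rfl⟩) := rfl
    have h2 : hatDeltaL q ⟨emb q v, v, rfl⟩ = emb q (hatDelta q 1 v) := toUnbounded_emb q _ v
    -- The factors q^{±1} from commuting `kl` past `∂_e` and `∂_f` match the entries q^{±1} of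
    -- `hatDelta q 1`.
    rw [h1, h2, commutator_emb, Stilde_emb, Ttilde_emb, hatDelta_one_apply q v.1 v.2, ← map_add,
      kl_de, kl_df]
    simp only [Prod.mk_add_mk, mul_smul_comm, smul_mul_assoc]

/-! ### An unbounded commutator -/

theorem norm_inc_sq (q : Param) (x : A q) : ‖inc q x‖ ^ 2 = (haar q (star x * x)).re := by
  rw [← inc_inner]
  exact norm_sq_eq_re_inner (𝕜 := ℂ) (inc q x)

theorem star_c_pow (q : Param) (N : ℕ) :
    star (gen q Gen.c ^ N) = ((-(qc q)⁻¹) ^ N) • gen q Gen.b ^ N := by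
  rw [star_pow, star_c, smul_pow]

theorem norm_c_pow_sq (q : Param) (N : ℕ) :
    ‖inc q (gen q Gen.c ^ N)‖ ^ 2 = ((q : ℝ) ^ N * qnum q (N + 1))⁻¹ := by
  have h : haar q (gen q Gen.b ^ N * gen q Gen.c ^ N) =
      (-1 : ℂ) ^ N * ((qnum q (N + 1))⁻¹ : ℝ) := by
    have := haar_mon q 0 N N
    rw [if_pos ⟨rfl, rfl⟩] at this
    rw [← this]
    simp [mon]
  have h2 : ((-(qc q)⁻¹) ^ N) * ((-1 : ℂ) ^ N * ((qnum q (N + 1))⁻¹ : ℝ)) =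
      (((q : ℝ) ^ N * qnum q (N + 1))⁻¹ : ℝ) := by
    rw [← mul_assoc, ← mul_pow, mul_neg_one, neg_neg, qc]
    push_cast
    rw [mul_inv, inv_pow]
  rw [norm_inc_sq, star_c_pow, smul_mul_assoc, map_smul, h, smul_eq_mul, h2, Complex.ofReal_re]

theorem norm_bc_pow_sq (q : Param) (N : ℕ) : ‖inc q (gen q Gen.b * gen q Gen.c ^ N)‖ ^ 2 =
    (q : ℝ) ^ 2 * ‖inc q (gen q Gen.c ^ (N + 1))‖ ^ 2 := by
  have hbc : Commute (gen q Gen.b) (gen q Gen.c) := (gen_rels q).bc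
  have h : star (gen q Gen.b * gen q Gen.c ^ N) * (gen q Gen.b * gen q Gen.c ^ N) =
      qc q ^ 2 • (star (gen q Gen.c ^ (N + 1)) * gen q Gen.c ^ (N + 1)) := by
    have hs := qc_ne q
    rw [star_mul, star_b, star_c_pow, star_c_pow]
    simp only [smul_mul_assoc, mul_smul_comm, smul_smul, mul_assoc]
    rw [← mul_assoc (gen q Gen.c) (gen q Gen.b), ← hbc.eq, mul_assoc, ← pow_succ', ← mul_assoc,
      ← pow_succ]
    congr 1
    rw [pow_succ (-(qc q)⁻¹)]
    field_simp
  rw [norm_inc_sq, norm_inc_sq, h, map_smul, smul_eq_mul, qc, ← Complex.ofReal_pow,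
    Complex.re_ofReal_mul]

/-- Write [N+2] = q^{-(N+1)} + q [N+1] and bound q^{-N} by [N+1]. -/
theorem qnum_ratio_le (q : Param) (N : ℕ) :
    qnum q ((N : ℝ) + 1 + 1) ≤ ((q : ℝ)⁻¹ + q) * qnum q ((N : ℝ) + 1) := by
  have h1 := qnum_add_one q N
  have h2 := qnum_nonneg q (x := (N : ℝ)) (by positivity)
  have h3 := q_pos q
  rw [qnum_add_one q ((N : ℝ) + 1), add_mul]
  have h4 : (q : ℝ) ^ (-((N : ℝ) + 1)) = (q : ℝ)⁻¹ * (q : ℝ) ^ (-(N : ℝ)) := by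
    rw [neg_add, Real.rpow_add h3, Real.rpow_neg_one, mul_comm]
  rw [h4, h1]
  have : 0 ≤ (q : ℝ)⁻¹ * (q * qnum q N) := by positivity
  linarith

/-- The constant does not depend on `N`: multiplication by `b` shrinks `c ^ N` by a bounded factor
only, so it cannot offset the growth q^{-N} in the commutator. -/
theorem norm_bc_pow_ge (q : Param) (N : ℕ) :
    ‖inc q (gen q Gen.c ^ N)‖ ^ 2 ≤
      ((q : ℝ)⁻¹ * ((q : ℝ)⁻¹ + q)) * ‖inc q (gen q Gen.b * gen q Gen.c ^ N)‖ ^ 2 := by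
  have hq := q_pos q
  have h1 := qnum_pos q (x := (N : ℝ) + 1) (by positivity)
  have h2 := qnum_pos q (x := (N : ℝ) + 1 + 1) (by positivity)
  rw [norm_bc_pow_sq, norm_c_pow_sq, norm_c_pow_sq]
  push_cast
  have h3 := qnum_ratio_le q N
  have e : (q : ℝ)⁻¹ * ((q : ℝ)⁻¹ + q) * ((q : ℝ) ^ 2 *
      ((q : ℝ) ^ (N + 1) * qnum q ((N : ℝ) + 1 + 1))⁻¹) =
      ((q : ℝ) ^ N)⁻¹ * (((q : ℝ)⁻¹ + q) * (qnum q ((N : ℝ) + 1 + 1))⁻¹) := by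
    rw [pow_succ (q : ℝ) N]
    field_simp
  rw [e, mul_inv]
  refine mul_le_mul_of_nonneg_left ?_ (by positivity)
  rw [← div_eq_mul_inv, le_div_iff₀ h2, inv_mul_le_iff₀ h1, mul_comm (qnum q ((N : ℝ) + 1))]
  exact h3

theorem commutator_a_unbounded (q : Param) : ¬ ∃ C : ℝ,
    ∀ v : (commutator (Dirac q) (repH q (gen q Gen.a))).domain,
      ‖commutator (Dirac q) (repH q (gen q Gen.a)) v‖ ≤ C * ‖(v : H q)‖ := by
  rintro ⟨C, hC⟩
  have hq := q_pos q
  have key : ∀ N : ℕ, ((q : ℝ) ^ N)⁻¹ * ‖inc q (gen q Gen.b * gen q Gen.c ^ N)‖ ≤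
      C * ‖inc q (gen q Gen.c ^ N)‖ := by
    intro N
    have hmem : emb q (0, gen q Gen.c ^ N) ∈
        (commutator (Dirac q) (repH q (gen q Gen.a))).domain := by
      rw [commutator_domain]
      exact emb_mem_domain q _
    have h := hC ⟨_, hmem⟩
    rw [commutator_emb] at h
    have e1 : ‖emb q (0, gen q Gen.c ^ N)‖ = ‖inc q (gen q Gen.c ^ N)‖ := by
      rw [emb_apply, map_zero]
      exact WithLp.norm_toLp_snd 2 (Hh q) (Hh q) _
    have hh : qpow q (-(1 / 2)) * (qhalf q : ℂ) = 1 := by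
      rw [← qhalf_inv_val, Units.inv_mul]
    -- On `(0, c ^ N)` the bounded part contributes nothing to the first component. There ∂_e(a) =
    -- b, and applying `kl` twice to `c ^ N` gives q^{-N}.
    have e2 : dH q (gen q Gen.a) * 0 + qpow q (-(1 / 2)) •
        (kl q (de q (gen q Gen.a)) * kl q (kl q (gen q Gen.c ^ N))) =
        ((((q : ℝ) ^ N)⁻¹ : ℝ) : ℂ) • (gen q Gen.b * gen q Gen.c ^ N) := by
      rw [mul_zero, zero_add, de_a, kl_c_pow, map_smul, kl_c_pow, circ_b]
      simp only [inv_one, mul_one, smul_mul_assoc, mul_smul_comm, smul_smul]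
      congr 1
      rw [mul_comm _ (qhalf q : ℂ), ← mul_assoc, hh, one_mul, ← mul_pow, ← mul_inv, ← pow_two, qhalf_sq, qc]
      push_cast
      rw [inv_pow]
    rw [e2] at h
    have h3 := (WithLp.norm_fst_le (p := 2) (Hh q) (emb q (((((q : ℝ) ^ N)⁻¹ : ℝ) : ℂ) •
      (gen q Gen.b * gen q Gen.c ^ N), _))).trans h
    rw [e1, emb_apply] at h3
    have h4 : ‖inc q (((((q : ℝ) ^ N)⁻¹ : ℝ) : ℂ) • (gen q Gen.b * gen q Gen.c ^ N))‖ ≤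
      C * ‖inc q (gen q Gen.c ^ N)‖ := h3
    rwa [map_smul, norm_smul, Complex.norm_real, Real.norm_of_nonneg (by positivity)] at h4
  have hbound : ∀ N : ℕ, ((q : ℝ)⁻¹ ^ 2) ^ N ≤ C ^ 2 * ((q : ℝ)⁻¹ * ((q : ℝ)⁻¹ + q)) := by
    intro N
    have h1 := pow_le_pow_left₀ (by positivity) (key N) 2
    rw [mul_pow, mul_pow] at h1
    have hb : 0 < ‖inc q (gen q Gen.b * gen q Gen.c ^ N)‖ ^ 2 := by
      rw [norm_bc_pow_sq, norm_c_pow_sq]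
      have h2 := qnum_pos q (x := ((N + 1 : ℕ) : ℝ) + 1) (by positivity)
      positivity
    -- With ‖c^N‖² replaced by a multiple of ‖b c^N‖², the positive common factor cancels and
    -- q^{-2N} stays below a constant.
    have h2 := h1.trans (mul_le_mul_of_nonneg_left (norm_bc_pow_ge q N) (sq_nonneg C))
    rw [← mul_assoc] at h2
    have h3 := le_of_mul_le_mul_right h2 hb
    rwa [← inv_pow, ← pow_mul, mul_comm N 2, pow_mul] at h3
  have hone : 1 < (q : ℝ)⁻¹ ^ 2 :=
    one_lt_pow₀ (one_lt_inv_iff₀.2 ⟨hq, q_lt q⟩) two_ne_zero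
  obtain ⟨N, hN⟩ := pow_unbounded_of_one_lt (C ^ 2 * ((q : ℝ)⁻¹ * ((q : ℝ)⁻¹ + q))) hone
  exact absurd (hbound N) (not_le.2 hN)

end QSU2

theorem mainTheorem5 (q : QSU2.Param) :
    QSU2.IsEssentiallySelfAdjoint (QSU2.Dirac q) ∧
    -- an orthogonal basis of eigenvectors
    (∀ ν : QSU2.EigIdx, QSU2.emb q (QSU2.eigVec q ν) ≠ 0 ∧
      ∃ hν : QSU2.emb q (QSU2.eigVec q ν) ∈ (QSU2.Dirac q).domain,
        QSU2.Dirac q ⟨QSU2.emb q (QSU2.eigVec q ν), hν⟩ =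
          (QSU2.eigVal q ν : ℂ) • QSU2.emb q (QSU2.eigVec q ν)) ∧
    (∀ ν μ : QSU2.EigIdx, ν ≠ μ →
      inner ℂ (QSU2.emb q (QSU2.eigVec q ν)) (QSU2.emb q (QSU2.eigVec q μ)) = 0) ∧
    (Submodule.span ℂ (Set.range fun ν : QSU2.EigIdx =>
      QSU2.emb q (QSU2.eigVec q ν))).topologicalClosure = ⊤ ∧
    -- the commutators with algebra elements
    (∀ α : QSU2.A q,
      (QSU2.commutator (QSU2.Dirac q) (QSU2.repH q α)).domain = (QSU2.Dirac q).domain ∧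
      QSU2.commutator (QSU2.Dirac q) (QSU2.repH q α) =
        (QSU2.Stilde q α).toLinearMap.toPMap (QSU2.Dirac q).domain +
          (QSU2.Ttilde q α).toLinearMap.compPMap (QSU2.hatDeltaL q)) ∧
    (∃ α : QSU2.A q, ¬ ∃ C : ℝ,
      ∀ v : (QSU2.commutator (QSU2.Dirac q) (QSU2.repH q α)).domain,
        ‖QSU2.commutator (QSU2.Dirac q) (QSU2.repH q α) v‖ ≤ C * ‖(v : QSU2.H q)‖) :=
  ⟨QSU2.Dirac_isEssentiallySelfAdjoint q,
    fun ν => ⟨QSU2.eigVec_ne_zero q ν, QSU2.emb_mem_domain q _, QSU2.Dirac_eigVec q ν _⟩,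
    fun _ _ h => QSU2.eigVec_orthogonal q h, QSU2.span_emb_eigVec q,
    fun α => ⟨QSU2.commutator_domain q α, QSU2.commutator_eq q α⟩,
    ⟨QSU2.gen q QSU2.Gen.a, QSU2.commutator_a_unbounded q⟩⟩

end
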